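/- Let $n\ge 5$, $m\ge 0$, and let $\Omega\subset\mathbb R^n$ be a bounded open set with Lipschitz boundary $\Sigma=\partial\Omega$ (near each boundary point and in suitable orthonormal coordinates, $\Omega$ is the region below the graph of a Lipschitz function). Let $f:\mathbb R^n\setminus\Omega\to\mathbb R^m$ be smooth (up to the boundary) and asymptotically flat, i.e. for some $\tau>\frac{n-4}{3}$, with subscripts denoting partial derivatives, $$|f_i^\alpha(x)|+|f_{ij}^\alpha(x)||x|+|f_{ijk}^\alpha(x)||x|^2=O(|x|^{-\tau/2})\quad(|x|\to\infty)$$ for all $1\le i,j,k\le n$, $1\le\alpha\le m$. Assume that $f$ is constant on each connected component of $\Sigma$. Let $M=\{(x,f(x)):x\in\mathbb R^n\setminus\Omega\}$ carry the induced metric $g_{ij}=\delta_{ij}+\sum_\alpha f_i^\alpha f_j^\alpha$, let $G=\det(g_{ij})$ and $d\mu_M=\sqrt G\,dx$. Let $R_{ijkl}$ be the curvature tensor of $g$ (with $R_{ijij}>0$ on round spheres), $R_{jl}=g^{ik}R_{ijkl}$, $R=g^{jl}R_{jl}$ (repeated indices are summed throughout), and $$P^{ijkl}=R^{ijkl}+R^{jk}g^{il}-R^{jl}g^{ik}-R^{ik}g^{jl}+R^{il}g^{jk}+\tfrac12R(g^{ik}g^{jl}-g^{il}g^{jk}),\qquad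 L_2=P^{ijkl}R_{ijkl}.$$ Put $U_{\alpha\beta}=\delta_{\alpha\beta}+\langle Df^\alpha,Df^\beta\rangle$ with inverse $U^{\alpha\beta}$; let $A^\alpha\partial_i=f^\alpha_{ik}g^{kj}\partial_j$ be the shape operators, $\nabla f^\alpha=g^{jk}f^\alpha_k\partial_j$, $Rc$ the Ricci operator ($\langle Rc\,X,Y\rangle=\mathrm{Ric}(X,Y)$), $R^\perp_{\alpha\beta}=A^\beta A^\alpha-A^\alpha A^\beta$, $T^\perp_\alpha=U^{\mu\nu}\big((\mathrm{Tr}A^\mu)R^\perp_{\nu\alpha}+R^\perp_{\alpha\mu}A^\nu+A^\mu R^\perp_{\alpha\nu}\big)$, and define $L_2^\perp$ by $$\begin{aligned}\tfrac12L_2^\perp={}&U^{\mu\nu}\big\langle\big(A^\mu(A^\nu R^\perp_{\alpha\gamma}+R^\perp_{\nu\gamma}A^\alpha-R^\perp_{\nu\alpha}A^\gamma)+\mathrm{Tr}(A^\alpha A^\mu)R^\perp_{\gamma\nu}\big)\nabla f^\alpha,\nabla f^\gamma\big\rangle\\&-\big\langle(2Rc\,R^\perp_{\alpha\gamma}+T^\perp_\gamma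 A^\alpha+A^\alpha T^\perp_\gamma)\nabla f^\alpha,\nabla f^\gamma\big\rangle\\&+\langle(\mathrm{Tr}A^\alpha)T^\perp_\gamma\nabla f^\alpha,\nabla f^\gamma\rangle+\tfrac12R\langle R^\perp_{\alpha\gamma}\nabla f^\alpha,\nabla f^\gamma\rangle.\end{aligned}$$ Assume that $L_2$ is integrable on $(M,g)$. Let $\omega_{n-1}$ be the area of the unit sphere in $\mathbb R^n$, $c_2(n)=\frac1{2(n-1)(n-2)(n-3)\omega_{n-1}}$, and let $$m_2=c_2(n)\lim_{r\to\infty}\int_{S_r}P^{ijkl}\,\partial_lg_{jk}\,\nu_i\,dS$$ be the second Gauss-Bonnet-Chern mass of $M$, where $S_r=\{|x|=r\}$ and $\nu=x/r$. Put $|Df|^2=\sum_\alpha|Df^\alpha|^2$, and let $H_3$ be the third mean curvature of $\Sigma$ in $\mathbb R^n$, i.e. the third elementary symmetric polynomial of the principal curvatures (positive on spheres bounding balls $\Omega$). Then $\Sigma$ is a $C^2$ hypersurface, with $\Omega$ locally on one side of it, near every point of $\Sigma$ where $Df\neq0$, so that $\big(\frac{|Df|^2}{1+|Df|^2}\big)^2H_3$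 is defined there; at points where $Df=0$ this expression is read as $0$. The limit defining $m_2$ exists, $(L_2+L_2^\perp)\frac1{\sqrt G}$ is integrable on $M$, $\big(\frac{|Df|^2}{1+|Df|^2}\big)^2H_3$ is integrable on $\Sigma$, and $$m_2=\tfrac12c_2(n)\int_M(L_2+L_2^\perp)\frac1{\sqrt G}\,d\mu_M+3c_2(n)\int_\Sigma\Big(\frac{|Df|^2}{1+|Df|^2}\Big)^2H_3\,d\mu_\Sigma.$$ -/

import Mathlib

open MeasureTheory Filter Topology Set Matrix
open scoped ContDiff

namespace GBC

noncomputable section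

/-- Euclidean space `ℝⁿ`. -/
abbrev E (n : ℕ) := EuclideanSpace ℝ (Fin n)

/-- The partial derivative `∂ᵢ h` of a function on the set `s` (one-sided at boundary points
of `s`). -/
def pd {n : ℕ} (s : Set (E n)) (i : Fin n) (h : E n → ℝ) : E n → ℝ :=
  fun x => fderivWithin ℝ h s x (EuclideanSpace.single i 1)

/-! ### Curvature of a Riemannian metric `g = (g_{ij})` given in the coordinates of `s ⊆ ℝⁿ` -/

section Metric

variable {n : ℕ} (s : Set (E n)) (g : E n → Matrix (Fin n) (Fin n) ℝ)

/-- Christoffel symbols `Γ_{ij}^k`. -/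
def christoffel (i j k : Fin n) : E n → ℝ := fun x =>
  (1 / 2) * ∑ l, (g x)⁻¹ k l *
    (pd s i (fun y => g y j l) x + pd s j (fun y => g y i l) x - pd s l (fun y => g y i j) x)

/-- The curvature tensor `R_{ijkl} = ⟨R(∂ᵢ,∂ⱼ)∂ₗ, ∂ₖ⟩`, with
`R(X,Y) = ∇_X ∇_Y - ∇_Y ∇_X - ∇_{[X,Y]}` (so `R_{ijij} > 0` on round spheres). -/
def riem (i j k l : Fin n) : E n → ℝ := fun x =>
  ∑ a, g x k a *
    (pd s i (christoffel s g j l a) x - pd s j (christoffel s g i l a) x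
      + ∑ t, (christoffel s g j l t x * christoffel s g i t a x
              - christoffel s g i l t x * christoffel s g j t a x))

/-- The Ricci tensor `R_{jl} = g^{ik} R_{ijkl}`. -/
def ric (x : E n) : Matrix (Fin n) (Fin n) ℝ :=
  Matrix.of fun j l => ∑ i, ∑ k, (g x)⁻¹ i k * riem s g i j k l x

/-- The scalar curvature `R = g^{jl} R_{jl}`. -/
def scal (x : E n) : ℝ := ∑ j, ∑ l, (g x)⁻¹ j l * ric s g x j l

/-- The curvature tensor with raised indices, `R^{ijkl}`. -/
def riemUp (i j k l : Fin n) : E n → ℝ := fun x =>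
  ∑ a, ∑ b, ∑ c, ∑ d,
    (g x)⁻¹ i a * (g x)⁻¹ j b * (g x)⁻¹ k c * (g x)⁻¹ l d * riem s g a b c d x

/-- The Ricci tensor with raised indices, `R^{ij}`. -/
def ricUp (x : E n) : Matrix (Fin n) (Fin n) ℝ := (g x)⁻¹ * ric s g x * (g x)⁻¹

/-- The tensor `P^{ijkl} = R^{ijkl} + R^{jk} g^{il} - R^{jl} g^{ik} - R^{ik} g^{jl} + R^{il} g^{jk}
+ (R/2) (g^{ik} g^{jl} - g^{il} g^{jk})`. -/
def tensorP (i j k l : Fin n) : E n → ℝ := fun x =>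
  riemUp s g i j k l x
    + ricUp s g x j k * (g x)⁻¹ i l - ricUp s g x j l * (g x)⁻¹ i k
    - ricUp s g x i k * (g x)⁻¹ j l + ricUp s g x i l * (g x)⁻¹ j k
    + (1 / 2) * scal s g x * ((g x)⁻¹ i k * (g x)⁻¹ j l - (g x)⁻¹ i l * (g x)⁻¹ j k)

/-- The second Gauss-Bonnet curvature `L₂ = P^{ijkl} R_{ijkl}`. -/
def gaussBonnet (x : E n) : ℝ :=
  ∑ i, ∑ j, ∑ k, ∑ l, tensorP s g i j k l x * riem s g i j k l x

/-- The Riemannian volume measure `√(det g) dx` on `s`. -/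
def riemVolume : Measure (E n) :=
  (volume.restrict s).withDensity fun x => ENNReal.ofReal (Real.sqrt (g x).det)

/-- `ω_{n-1}`, the area of the unit sphere in `ℝⁿ`. -/
def sphereArea (n : ℕ) : ℝ := (μHE[n - 1] (Metric.sphere (0 : E n) 1)).toReal

/-- `c₂(n) = 1 / (2 (n-1) (n-2) (n-3) ω_{n-1})`. -/
def c2 (n : ℕ) : ℝ :=
  1 / (2 * ((n : ℝ) - 1) * ((n : ℝ) - 2) * ((n : ℝ) - 3) * sphereArea n)

/-- The flux `∫_{S_r} P^{ijkl} ∂ₗ g_{jk} νᵢ dS`, where `S_r` is the coordinate sphere of radius `r`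
and `ν = x / r`. -/
def massFlux (r : ℝ) : ℝ :=
  ∫ x in Metric.sphere (0 : E n) r,
    (∑ i, ∑ j, ∑ k, ∑ l, tensorP s g i j k l x * pd s l (fun y => g y j k) x * (x i / r))
    ∂μHE[n - 1]

/-- `m` is the second Gauss-Bonnet-Chern mass of `(s, g)`: `L₂` is integrable and
`m = c₂(n) lim_{r → ∞} ∫_{S_r} P^{ijkl} ∂ₗ g_{jk} νᵢ dS` (in particular the limit exists). -/
def IsGBCMass (m : ℝ) : Prop :=
  Integrable (gaussBonnet s g) (riemVolume s g) ∧
    Tendsto (fun r : ℝ => c2 n * massFlux s g r) atTop (𝓝 m)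

end Metric

/-! ### Graphs of maps `f : s → ℝᵐ`, `s ⊆ ℝⁿ` -/

section Graph

variable {n m : ℕ} (s : Set (E n)) (f : E n → E m)

/-- `f_i^α`. -/
def d1 (a : Fin m) (i : Fin n) : E n → ℝ := pd s i fun y => f y a

/-- `f_{ij}^α`. -/
def d2 (a : Fin m) (i j : Fin n) : E n → ℝ := pd s j (d1 s f a i)

/-- `f_{ijk}^α`. -/
def d3 (a : Fin m) (i j k : Fin n) : E n → ℝ := pd s k (d2 s f a i j)

/-- `f : s → ℝᵐ` is an asymptotically flat map: it is smooth on `s` (up to the boundary), and for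
some `τ > (n-4)/3` one has `|f_i^α| + |f_{ij}^α| |x| + |f_{ijk}^α| |x|² = O(|x|^{-τ/2})`
at infinity. -/
def AsymptoticallyFlatMap : Prop :=
  ContDiffOn ℝ ∞ f s ∧
    ∃ τ : ℝ, ((n : ℝ) - 4) / 3 < τ ∧ ∀ (a : Fin m) (i j k : Fin n),
      (fun x => |d1 s f a i x| + |d2 s f a i j x| * ‖x‖ + |d3 s f a i j k x| * ‖x‖ ^ 2)
        =O[Bornology.cobounded (E n) ⊓ 𝓟 s] fun x => ‖x‖ ^ (-τ / 2)

/-- `|Df|² = |Df¹|² + ⋯ + |Dfᵐ|²`. -/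
def normSqDf (x : E n) : ℝ := ∑ a, ∑ i, d1 s f a i x ^ 2

/-- The induced metric `g_{ij} = δ_{ij} + f_i^α f_j^α` of the graph of `f`. -/
def graphMetric (x : E n) : Matrix (Fin n) (Fin n) ℝ :=
  1 + Matrix.of fun i j => ∑ a, d1 s f a i x * d1 s f a j x

/-- `U_{αβ} = ⟨η^α, η^β⟩ = δ_{αβ} + ⟨Df^α, Df^β⟩`, the Gram matrix of the normal frame
`η^α = (-Df^α, e_α)`. -/
def normalGram (x : E n) : Matrix (Fin m) (Fin m) ℝ :=
  1 + Matrix.of fun a b => ∑ i, d1 s f a i x * d1 s f b i x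

/-- The shape operator `A^α` with respect to `η^α`, as a matrix in the frame `∂₁, …, ∂ₙ`:
`A^α ∂ᵢ = f_{ik}^α g^{kj} ∂ⱼ`. -/
def shapeOp (a : Fin m) (x : E n) : Matrix (Fin n) (Fin n) ℝ :=
  (graphMetric s f x)⁻¹ * Matrix.of fun i j => d2 s f a i j x

/-- The gradient `∇f^α = g^{jk} f_k^α ∂ⱼ` of `f^α` on the graph, in the frame `∂₁, …, ∂ₙ`. -/
def gradF (a : Fin m) (x : E n) : Fin n → ℝ :=
  (graphMetric s f x)⁻¹ *ᵥ fun i => d1 s f a i x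

/-- The normal curvature operator `R^⊥_{αβ} = A^β A^α - A^α A^β`. -/
def normalCurv (a b : Fin m) (x : E n) : Matrix (Fin n) (Fin n) ℝ :=
  shapeOp s f b x * shapeOp s f a x - shapeOp s f a x * shapeOp s f b x

/-- The Ricci operator `Rc` of the graph, `⟨Rc X, Y⟩ = Ric(X, Y)`, in the frame `∂₁, …, ∂ₙ`. -/
def ricciOp (x : E n) : Matrix (Fin n) (Fin n) ℝ :=
  (graphMetric s f x)⁻¹ * ric s (graphMetric s f) x

/-- `T^⊥_α = U^{μν} ((Tr A^μ) R^⊥_{να} + R^⊥_{αμ} A^ν + A^μ R^⊥_{αν})`. -/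
def tPerp (a : Fin m) (x : E n) : Matrix (Fin n) (Fin n) ℝ :=
  ∑ p, ∑ q, (normalGram s f x)⁻¹ p q •
    ((shapeOp s f p x).trace • normalCurv s f q a x
      + normalCurv s f a p x * shapeOp s f q x
      + shapeOp s f p x * normalCurv s f a q x)

/-- `⟨B ∇f^α, ∇f^γ⟩` for an operator `B` on the tangent space, `⟨ , ⟩` being the graph metric. -/
def gradPairing (B : Matrix (Fin n) (Fin n) ℝ) (a c : Fin m) (x : E n) : ℝ :=
  (B *ᵥ gradF s f a x) ⬝ᵥ (graphMetric s f x *ᵥ gradF s f c x)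

/-- The normal curvature quantity `L₂^⊥`, given (with summation over repeated indices) by
`½ L₂^⊥ = U^{μν} ⟨(A^μ (A^ν R^⊥_{αγ} + R^⊥_{νγ} A^α - R^⊥_{να} A^γ)
            + Tr(A^α A^μ) R^⊥_{γν}) ∇f^α, ∇f^γ⟩
  - ⟨(2 Rc R^⊥_{αγ} + T^⊥_γ A^α + A^α T^⊥_γ) ∇f^α, ∇f^γ⟩
  + ⟨(Tr A^α) T^⊥_γ ∇f^α, ∇f^γ⟩ + ½ R ⟨R^⊥_{αγ} ∇f^α, ∇f^γ⟩`. -/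
def gaussBonnetPerp (x : E n) : ℝ :=
  2 * ∑ a, ∑ c,
    ((∑ p, ∑ q, (normalGram s f x)⁻¹ p q *
        gradPairing s f
          (shapeOp s f p x *
              (shapeOp s f q x * normalCurv s f a c x + normalCurv s f q c x * shapeOp s f a x
                - normalCurv s f q a x * shapeOp s f c x)
            + (shapeOp s f a x * shapeOp s f p x).trace • normalCurv s f c q x) a c x)
      - gradPairing s f
          ((2 : ℝ) • (ricciOp s f x * normalCurv s f a c x) + tPerp s f c x * shapeOp s f a x
            + shapeOp s f a x * tPerp s f c x) a c x
      + gradPairing s f ((shapeOp s f a x).trace • tPerp s f c x) a c x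
      + (1 / 2) * scal s (graphMetric s f) x * gradPairing s f (normalCurv s f a c x) a c x)

end Graph

/-! ### Lipschitz boundaries and the third mean curvature of a boundary -/

section Boundary

variable {n : ℕ} (Ω : Set (E n))

/-- `Ω` has Lipschitz boundary: near every boundary point, in suitable orthonormal coordinates,
`Ω` is the region below the graph of a Lipschitz function (of the coordinates orthogonal to the
unit vector `e`). -/
def HasLipschitzBoundary : Prop :=
  ∀ p ∈ frontier Ω, ∃ e : E n, ‖e‖ = 1 ∧ ∃ (K : NNReal) (φ : E n → ℝ), LipschitzWith K φ ∧
    ∀ᶠ x in 𝓝 p, (x ∈ Ω ↔ inner ℝ e x < φ (x - inner ℝ e x • e))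

/-- `ρ` is a `C²` defining function of `Ω` near `p`: `Ω = {ρ < 0}` near `p`, and `Dρ(p) ≠ 0`. -/
def IsDefiningFunctionAt (ρ : E n → ℝ) (p : E n) : Prop :=
  ContDiffAt ℝ 2 ρ p ∧ fderiv ℝ ρ p ≠ 0 ∧ ∀ᶠ x in 𝓝 p, (x ∈ Ω ↔ ρ x < 0)

/-- The outward unit normal `Dρ / |Dρ|` of `{ρ < 0}` at `p`. -/
def unitNormal (ρ : E n → ℝ) (p : E n) : Fin n → ℝ := fun i =>
  fderiv ℝ ρ p (EuclideanSpace.single i 1) / ‖fderiv ℝ ρ p‖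

/-- The shape operator of the level set of `ρ` through `p` with respect to the normal
`ν = Dρ / |Dρ|`, extended by `0` to the normal direction:
`Π (D²ρ / |Dρ|) Π` with `Π = 1 - ν νᵀ` the projection onto the tangent space.
It is positive for the boundary spheres of balls `{ρ < 0}`. -/
def levelShapeOp (ρ : E n → ℝ) (p : E n) : Matrix (Fin n) (Fin n) ℝ :=
  let proj : Matrix (Fin n) (Fin n) ℝ := 1 - Matrix.vecMulVec (unitNormal ρ p) (unitNormal ρ p)
  let hess : Matrix (Fin n) (Fin n) ℝ := Matrix.of fun i j =>
    fderiv ℝ (fderiv ℝ ρ) p (EuclideanSpace.single i 1) (EuclideanSpace.single j 1)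
  ‖fderiv ℝ ρ p‖⁻¹ • (proj * hess * proj)

open Classical in
/-- The third mean curvature `H₃` of `∂Ω` at `p`: the third elementary symmetric polynomial of the
principal curvatures, the latter taken with respect to the sign for which spheres bounding balls
have positive curvatures. (The eigenvalues of `levelShapeOp` are the principal curvatures together
with one additional `0`, which does not affect the symmetric polynomial; the value does not depend
on the defining function.) At points near which `∂Ω` is not a `C²` hypersurface the value is set
to `0`. -/
def thirdMeanCurvature (p : E n) : ℝ :=
  if h : ∃ ρ, IsDefiningFunctionAt Ω ρ p then
    (levelShapeOp (Classical.choose h) p).charpoly.roots.esymm 3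
  else 0

end Boundary

end

end GBC

set_option linter.unusedSectionVars false

/-! Everything is carried by the vector field Y^i = P^{ijkl} ∂_l g_{jk} on the complement of Ω. Its
flux through S_r defines the mass, its Euclidean divergence is (L₂ + L₂^⊥)/2, and its flux through Σ
in the direction ν is 3 (|Df|²/(1+|Df|²))² H₃. The formula is the divergence theorem for Y; the
factor 1/√G only cancels the density of the Riemannian volume.

Interior. By the Gauss equation (`gaussEq_graphMetric`), contracting P with a symmetric matrix gives
a polarised third Newton tensor N, so Y = ½ U^{pq} N(A^a, A^p, A^q) ∇f^a (`massField_eq`). N is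
symmetric in its three arguments and antisymmetric in its covariant slots. In the divergence this
antisymmetry kills all third derivatives of f, and the derivatives of U cancel against parts of the
derivatives of the shape operators (`sum_divergence_terms`). What is left is U^{ab} U^{pq} tr(N(A^a,
A^p, A^q) A^b) = L₂, together with a remainder built from products of non-commuting shape operators.
Symmetrised over its two pairs of normal indices, the remainder is L₂^⊥ (`remainder_symmetrized`,
`gaussBonnetPerp_eq`), which gives `sum_pd_newtonField`.

Boundary. Σ is only Lipschitz, but f is constant on its components. Projecting along the direction e
of a local graph gives a Lipschitz height ρ with f(x - ρ(x) e) locally constant; where Df ≠ 0 this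
identity determines Dρ in terms of Df and ρ, and bootstrapping makes ρ of class C²
(`contDiffAt_of_const_along`). At such points each Df^a is a multiple c^a of the normal and the
tangential Hessian of f^a is c^a times the shape operator of Σ, so Y·ν can be computed
(`newtonField_dotProduct_unit`).

At critical points of f the hypersurface has no further regularity. Gauss-Green is therefore applied
to η_k(|Df|²) χ Y, where η_k vanishes near 0, so that only C¹ pieces of Σ are met, and then k → ∞
(`boundary_flux`). On compact sets both Y and the gradient of |Df|² are O(|Df|), which bounds the
error η_k'(|Df|²) ∂(|Df|²) Y uniformly, while ∂Y vanishes almost everywhere on the critical set. On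
Σ the integrand is dominated because it is a multiple of Y·ν with Y bounded.

Infinity. L₂ is integrable by assumption. L₂^⊥ contains two gradients and four Hessians, hence is
O(|x|^{-3τ-4}), and 3τ + 4 > n is exactly the decay condition. So the ball integrals converge, and
with them the flux through S_r. -/

namespace GBC

/-! ### Algebra of the polarised third Newton tensor -/

section NewtonTensor

variable {ι : Type*} [Fintype ι] [DecidableEq ι]

/-- The full polarisation of `6 e₃` of a matrix. -/
def polarE3 (A B C : Matrix ι ι ℝ) : ℝ :=
  A.trace * B.trace * C.trace - A.trace * (B * C).trace - B.trace * (A * C).trace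
    - C.trace * (A * B).trace + (A * B * C).trace + (A * C * B).trace

/-- The full polarisation of six times the third Newton tensor of a matrix. -/
def polarNewton (A B C : Matrix ι ι ℝ) : Matrix ι ι ℝ :=
  polarE3 A B C • (1 : Matrix ι ι ℝ)
    - ((B.trace * C.trace - (B * C).trace) • A + (A.trace * C.trace - (A * C).trace) • B
        + (A.trace * B.trace - (A * B).trace) • C)
    + (C.trace • (A * B + B * A) + B.trace • (A * C + C * A) + A.trace • (B * C + C * B))
    - (A * B * C + A * C * B + B * A * C + B * C * A + C * A * B + C * B * A)

theorem polarNewton_swap_right (A B C : Matrix ι ι ℝ) :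
    polarNewton A C B = polarNewton A B C := by
  simp only [polarNewton, polarE3, Matrix.trace_mul_comm C B]
  have : A.trace * C.trace * B.trace - A.trace * (B * C).trace - C.trace * (A * B).trace
    - B.trace * (A * C).trace + (A * C * B).trace + (A * B * C).trace
    = A.trace * B.trace * C.trace - A.trace * (B * C).trace - B.trace * (A * C).trace
    - C.trace * (A * B).trace + (A * B * C).trace + (A * C * B).trace := by ring
  rw [this, mul_comm C.trace B.trace]
  module

theorem polarNewton_swap_left (A B C : Matrix ι ι ℝ) :
    polarNewton B A C = polarNewton A B C := by
  have h1 : (B * A * C).trace = (A * C * B).trace := by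
    rw [Matrix.mul_assoc, Matrix.trace_mul_comm]
  have h2 : (B * C * A).trace = (A * B * C).trace := by
    rw [Matrix.trace_mul_comm, Matrix.mul_assoc]
  simp only [polarNewton, polarE3, Matrix.trace_mul_comm B A, h1, h2]
  have : B.trace * A.trace * C.trace - B.trace * (A * C).trace - A.trace * (B * C).trace
    - C.trace * (A * B).trace + (A * C * B).trace + (A * B * C).trace
    = A.trace * B.trace * C.trace - A.trace * (B * C).trace - B.trace * (A * C).trace
    - C.trace * (A * B).trace + (A * B * C).trace + (A * C * B).trace := by ring
  rw [this, mul_comm B.trace A.trace]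
  module

theorem polarNewton_add (A A' B C : Matrix ι ι ℝ) :
    polarNewton (A + A') B C = polarNewton A B C + polarNewton A' B C := by
  simp only [polarNewton, polarE3, Matrix.trace_add, Matrix.add_mul, Matrix.mul_add]
  module

theorem polarNewton_smul (c : ℝ) (A B C : Matrix ι ι ℝ) :
    polarNewton (c • A) B C = c • polarNewton A B C := by
  simp only [polarNewton, polarE3, Matrix.trace_smul, Matrix.smul_mul, Matrix.mul_smul,
    smul_eq_mul]
  module

theorem trace_vecMulVec_mul (v b : ι → ℝ) (M : Matrix ι ι ℝ) :
    (Matrix.vecMulVec v b * M).trace = b ⬝ᵥ M *ᵥ v := by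
  rw [Matrix.vecMulVec_mul, Matrix.trace_vecMulVec, dotProduct_comm, ← Matrix.dotProduct_mulVec]

theorem vecMulVec_mulVec_eq_smul (v b w : ι → ℝ) :
    Matrix.vecMulVec v b *ᵥ w = (b ⬝ᵥ w) • v := by
  ext i
  simp [Matrix.vecMulVec_mulVec, mul_comm]

/-- Linearity in the first argument makes rank-one matrices v ⊗ b the essential case. Written out in
scalars, the form is visibly alternating in the covariant vectors a, b and in the vectors u, v, as
befits a contraction with a generalised Kronecker delta. -/
theorem dotProduct_polarNewton_vecMulVec_mulVec (a b u v : ι → ℝ) (B C : Matrix ι ι ℝ) :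
    a ⬝ᵥ polarNewton (Matrix.vecMulVec v b) B C *ᵥ u =
    (a ⬝ᵥ u) * ((B.trace * C.trace - (B * C).trace) * (b ⬝ᵥ v) - B.trace * (b ⬝ᵥ C *ᵥ v)
      - C.trace * (b ⬝ᵥ B *ᵥ v) + b ⬝ᵥ (B * C) *ᵥ v + b ⬝ᵥ (C * B) *ᵥ v)
    - ((B.trace * C.trace - (B * C).trace) * ((a ⬝ᵥ v) * (b ⬝ᵥ u))
      + (C.trace * ((a ⬝ᵥ B *ᵥ u) * (b ⬝ᵥ v)) - (a ⬝ᵥ B *ᵥ u) * (b ⬝ᵥ C *ᵥ v))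
      + (B.trace * ((a ⬝ᵥ C *ᵥ u) * (b ⬝ᵥ v)) - (a ⬝ᵥ C *ᵥ u) * (b ⬝ᵥ B *ᵥ v)))
    + (C.trace * ((a ⬝ᵥ v) * (b ⬝ᵥ B *ᵥ u) + (a ⬝ᵥ B *ᵥ v) * (b ⬝ᵥ u))
      + B.trace * ((a ⬝ᵥ v) * (b ⬝ᵥ C *ᵥ u) + (a ⬝ᵥ C *ᵥ v) * (b ⬝ᵥ u))
      + ((a ⬝ᵥ (B * C) *ᵥ u) * (b ⬝ᵥ v) + (a ⬝ᵥ (C * B) *ᵥ u) * (b ⬝ᵥ v)))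
    - ((a ⬝ᵥ v) * (b ⬝ᵥ (B * C) *ᵥ u) + (a ⬝ᵥ v) * (b ⬝ᵥ (C * B) *ᵥ u)
      + (a ⬝ᵥ B *ᵥ v) * (b ⬝ᵥ C *ᵥ u) + (a ⬝ᵥ (B * C) *ᵥ v) * (b ⬝ᵥ u)
      + (a ⬝ᵥ C *ᵥ v) * (b ⬝ᵥ B *ᵥ u) + (a ⬝ᵥ (C * B) *ᵥ v) * (b ⬝ᵥ u)) := by
  simp only [polarNewton, polarE3, Matrix.trace_vecMulVec, Matrix.mul_assoc,
    trace_vecMulVec_mul, Matrix.sub_mulVec, Matrix.add_mulVec, Matrix.smul_mulVec,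
    Matrix.one_mulVec, dotProduct_add, dotProduct_sub, dotProduct_smul, smul_eq_mul,
    ← Matrix.mulVec_mulVec, vecMulVec_mulVec_eq_smul, Matrix.mulVec_smul, dotProduct_comm v b]
  ring

/-- Antisymmetry of the polarised Newton tensor in the covariant slots. -/
theorem dotProduct_polarNewton_vecMulVec_swap (a b u v : ι → ℝ) (B C : Matrix ι ι ℝ) :
    a ⬝ᵥ polarNewton (Matrix.vecMulVec v b) B C *ᵥ u =
      - (b ⬝ᵥ polarNewton (Matrix.vecMulVec v a) B C *ᵥ u) := by
  rw [dotProduct_polarNewton_vecMulVec_mulVec, dotProduct_polarNewton_vecMulVec_mulVec]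
  ring

theorem sum_single_dotProduct_mul (x y : ι → ℝ) (C : Matrix ι ι ℝ) :
    ∑ i, (Pi.single i 1 ⬝ᵥ x) * (C *ᵥ Pi.single i 1 ⬝ᵥ y) = y ⬝ᵥ C *ᵥ x := by
  simp only [single_dotProduct, one_mul, Matrix.mulVec_single_one]
  simp only [dotProduct, Matrix.mulVec, Matrix.col_apply, Finset.mul_sum]
  rw [Finset.sum_comm]
  exact Finset.sum_congr rfl fun i _ => Finset.sum_congr rfl fun j _ => by ring

/-- This partial trace is the shape of the terms of the divergence that do not cancel; expanding it
turns them into words in the shape operators. -/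
theorem sum_dotProduct_polarNewton_vecMulVec (C : Matrix ι ι ℝ) (u v : ι → ℝ)
    (B D : Matrix ι ι ℝ) :
    ∑ i, (Pi.single i 1 ⬝ᵥ
      polarNewton (Matrix.vecMulVec v (C *ᵥ Pi.single i 1)) B D *ᵥ u) =
    ((B.trace * D.trace - (B * D).trace) * (v ⬝ᵥ C *ᵥ u) - B.trace * ((D *ᵥ v) ⬝ᵥ C *ᵥ u)
      - D.trace * ((B *ᵥ v) ⬝ᵥ C *ᵥ u)
      + ((B * D) *ᵥ v) ⬝ᵥ C *ᵥ u + ((D * B) *ᵥ v) ⬝ᵥ C *ᵥ u)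
    - ((B.trace * D.trace - (B * D).trace) * (u ⬝ᵥ C *ᵥ v)
      + (D.trace * (v ⬝ᵥ C *ᵥ B *ᵥ u) - (D *ᵥ v) ⬝ᵥ C *ᵥ B *ᵥ u)
      + (B.trace * (v ⬝ᵥ C *ᵥ D *ᵥ u) - (B *ᵥ v) ⬝ᵥ C *ᵥ D *ᵥ u))
    + (D.trace * ((B *ᵥ u) ⬝ᵥ C *ᵥ v + u ⬝ᵥ C *ᵥ B *ᵥ v)
      + B.trace * ((D *ᵥ u) ⬝ᵥ C *ᵥ v + u ⬝ᵥ C *ᵥ D *ᵥ v)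
      + (v ⬝ᵥ C *ᵥ (B * D) *ᵥ u + v ⬝ᵥ C *ᵥ (D * B) *ᵥ u))
    - (((B * D) *ᵥ u) ⬝ᵥ C *ᵥ v + ((D * B) *ᵥ u) ⬝ᵥ C *ᵥ v
      + (D *ᵥ u) ⬝ᵥ C *ᵥ B *ᵥ v + u ⬝ᵥ C *ᵥ (B * D) *ᵥ v
      + (B *ᵥ u) ⬝ᵥ C *ᵥ D *ᵥ v + u ⬝ᵥ C *ᵥ (D * B) *ᵥ v) := by
  simp only [dotProduct_polarNewton_vecMulVec_mulVec]
  generalize B.trace * D.trace - (B * D).trace = t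
  simp only [mul_add, mul_sub, Finset.sum_add_distrib,
    Finset.sum_sub_distrib, mul_left_comm _ (Matrix.trace _) _, mul_left_comm _ t _,
    ← Finset.mul_sum, sum_single_dotProduct_mul]


/-- The part of the divergence identity that comes from the normal curvature, symmetrised over
the two pairs of normal indices. -/
theorem remainder_symmetrized (g a c p q : Matrix ι ι ℝ) (x y : ι → ℝ) (hg : gᵀ = g)
    (ha : (g * a)ᵀ = g * a) (hc : (g * c)ᵀ = g * c) (hp : (g * p)ᵀ = g * p)
    (hq : (g * q)ᵀ = g * q) (E W : Matrix ι ι ℝ → Matrix ι ι ℝ → Matrix ι ι ℝ → Matrix ι ι ℝ →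
      (ι → ℝ) → (ι → ℝ) → ℝ)
    (hE : ∀ a c p q x y, E a c p q x y =
      - ∑ i, (Pi.single i 1 ⬝ᵥ
        polarNewton (Matrix.vecMulVec y ((g * a * c) *ᵥ Pi.single i 1)) p q *ᵥ x)
      - 2 * ∑ i, (Pi.single i 1 ⬝ᵥ
        polarNewton (Matrix.vecMulVec y ((g * p * c) *ᵥ Pi.single i 1)) a q *ᵥ x))
    (hW : ∀ a c p q x y, W a c p q x y =
      y ⬝ᵥ g *ᵥ (p * (q * (c * a - a * c) + (c * q - q * c) * a - (a * q - q * a) * c)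
        + (a * p).trace • (q * c - c * q)) *ᵥ x
      - y ⬝ᵥ g *ᵥ ((2 : ℝ) • ((p.trace • q - p * q) * (c * a - a * c))
        + (p.trace • (c * q - q * c) + (p * c - c * p) * q + p * (q * c - c * q)) * a
        + a * (p.trace • (c * q - q * c) + (p * c - c * p) * q + p * (q * c - c * q))) *ᵥ x
      + a.trace * (y ⬝ᵥ g *ᵥ
          (p.trace • (c * q - q * c) + (p * c - c * p) * q + p * (q * c - c * q)) *ᵥ x)
      + (1 / 2) * (p.trace * q.trace - (p * q).trace) * (y ⬝ᵥ g *ᵥ (c * a - a * c) *ᵥ x)) :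
    E a c p q x y + E c a p q y x + E a c q p x y + E c a q p y x =
      2 * (W a c p q x y + W c a p q y x + W a c q p x y + W c a q p y x) := by
  -- All four operators are self-adjoint for g. Hence every pairing can be brought to the form v ⬝ g
  -- (word) w, and a word pairing x with y becomes the reversed word pairing y with x.
  have adj (M : Matrix ι ι ℝ) (hM : (g * M)ᵀ = g * M) (v w : ι → ℝ) :
      (M *ᵥ v) ⬝ᵥ g *ᵥ w = v ⬝ᵥ g *ᵥ M *ᵥ w := by
    rw [Matrix.mulVec_mulVec, ← hM, Matrix.transpose_mul, hg, ← Matrix.mulVec_mulVec,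
      Matrix.dotProduct_mulVec v, Matrix.vecMul_transpose]
  have symm (v w : ι → ℝ) : v ⬝ᵥ g *ᵥ w = w ⬝ᵥ g *ᵥ v := by
    conv_lhs => rw [← hg, Matrix.mulVec_transpose, dotProduct_comm, ← Matrix.dotProduct_mulVec]
  have s2 (M N : Matrix ι ι ℝ) (hM : (g * M)ᵀ = g * M) (hN : (g * N)ᵀ = g * N) :
      x ⬝ᵥ g *ᵥ M *ᵥ N *ᵥ y = y ⬝ᵥ g *ᵥ N *ᵥ M *ᵥ x := by
    rw [symm, adj M hM, adj N hN]
  have s3 (M N P : Matrix ι ι ℝ) (hM : (g * M)ᵀ = g * M) (hN : (g * N)ᵀ = g * N)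
      (hP : (g * P)ᵀ = g * P) :
      x ⬝ᵥ g *ᵥ M *ᵥ N *ᵥ P *ᵥ y = y ⬝ᵥ g *ᵥ P *ᵥ N *ᵥ M *ᵥ x := by
    rw [symm, adj M hM, adj N hN, adj P hP]
  have s4 (M N P Q : Matrix ι ι ℝ) (hM : (g * M)ᵀ = g * M) (hN : (g * N)ᵀ = g * N)
      (hP : (g * P)ᵀ = g * P) (hQ : (g * Q)ᵀ = g * Q) :
      x ⬝ᵥ g *ᵥ M *ᵥ N *ᵥ P *ᵥ Q *ᵥ y = y ⬝ᵥ g *ᵥ Q *ᵥ P *ᵥ N *ᵥ M *ᵥ x := by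
    rw [symm, adj M hM, adj N hN, adj P hP, adj Q hQ]
  simp only [hE, hW, sum_dotProduct_polarNewton_vecMulVec]
  simp only [Matrix.mul_add, Matrix.add_mul,
    Matrix.mul_sub, Matrix.sub_mul, Matrix.smul_mul, Matrix.mul_smul, Matrix.add_mulVec,
    Matrix.sub_mulVec, Matrix.smul_mulVec, Matrix.mulVec_add, Matrix.mulVec_sub,
    Matrix.mulVec_smul, dotProduct_add, dotProduct_sub, dotProduct_smul, smul_eq_mul,
    ← Matrix.mulVec_mulVec, adj a ha, adj c hc, adj p hp, adj q hq, smul_add, smul_sub]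
  -- With all words read from y to x, the noncommutative identity is a polynomial identity in the
  -- remaining scalar pairings and traces.
  simp only [s2 _ _, s3 _ _ _, s4 _ _ _ _, ha, hc, hp, hq, Matrix.trace_mul_comm q p]
  ring


/-- The part of A outside the compression is grouped into two rank-one matrices, one with ν as
column factor and one with ν as row factor: exactly the two shapes on which the antisymmetries of
the Newton tensor act. -/
theorem proj_mul_mul_proj (ν : ι → ℝ) (A : Matrix ι ι ℝ) :
    A = (1 - Matrix.vecMulVec ν ν) * A * (1 - Matrix.vecMulVec ν ν)
      + (Matrix.vecMulVec ν (ν ᵥ* A - (ν ⬝ᵥ A *ᵥ ν) • ν) + Matrix.vecMulVec (A *ᵥ ν) ν) := by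
  simp only [Matrix.sub_mul, Matrix.mul_sub, Matrix.one_mul, Matrix.mul_one,
    Matrix.vecMulVec_mul, Matrix.mul_vecMulVec, Matrix.vecMulVec_sub, Matrix.vecMulVec_smul,
    Matrix.sub_mulVec, vecMulVec_mulVec_eq_smul, ← Matrix.dotProduct_mulVec,
    Matrix.sub_vecMulVec, Matrix.smul_vecMulVec]
  abel

/-- Contracting the polarised Newton tensor with a unit vector `ν` gives the polarised third
elementary symmetric polynomial of the compressions to the orthogonal complement of `ν`. -/
theorem dotProduct_polarNewton_unit (ν : ι → ℝ) (hν : ν ⬝ᵥ ν = 1) (A B C : Matrix ι ι ℝ) :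
    ν ⬝ᵥ polarNewton A B C *ᵥ ν =
      polarE3 ((1 - Matrix.vecMulVec ν ν) * A * (1 - Matrix.vecMulVec ν ν))
        ((1 - Matrix.vecMulVec ν ν) * B * (1 - Matrix.vecMulVec ν ν))
        ((1 - Matrix.vecMulVec ν ν) * C * (1 - Matrix.vecMulVec ν ν)) := by
  -- The rank-one parts contribute nothing when both outer vectors are ν: `h1` is the antisymmetry
  -- in the vectors, `h2` that in the covectors.
  have h1 (b : ι → ℝ) (B C : Matrix ι ι ℝ) :
      ν ⬝ᵥ polarNewton (Matrix.vecMulVec ν b) B C *ᵥ ν = 0 := by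
    rw [dotProduct_polarNewton_vecMulVec_mulVec]
    ring
  have h2 (v : ι → ℝ) (B C : Matrix ι ι ℝ) :
      ν ⬝ᵥ polarNewton (Matrix.vecMulVec v ν) B C *ᵥ ν = 0 := by
    have := dotProduct_polarNewton_vecMulVec_swap ν ν ν v B C
    linarith
  have h3 (A B C : Matrix ι ι ℝ) : ν ⬝ᵥ polarNewton A B C *ᵥ ν =
      ν ⬝ᵥ polarNewton ((1 - Matrix.vecMulVec ν ν) * A * (1 - Matrix.vecMulVec ν ν)) B C *ᵥ ν := by
    conv_lhs => rw [proj_mul_mul_proj ν A, polarNewton_add, polarNewton_add]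
    simp only [Matrix.add_mulVec, dotProduct_add, h1, h2, add_zero]
  -- Each argument is moved to the first slot in turn and replaced there by its compression.
  rw [h3, ← polarNewton_swap_left, h3, polarNewton_swap_left, polarNewton_swap_right,
    ← polarNewton_swap_left, h3, polarNewton_swap_left, polarNewton_swap_right]
  -- Compressions annihilate ν, so of all terms of the Newton tensor only the multiple of the
  -- identity survives.
  have h0 (A : Matrix ι ι ℝ) :
      ((1 - Matrix.vecMulVec ν ν) * A * (1 - Matrix.vecMulVec ν ν)) *ᵥ ν = 0 := by
    rw [← Matrix.mulVec_mulVec, Matrix.sub_mulVec, vecMulVec_mulVec_eq_smul, hν]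
    simp
  have hA := h0 A
  have hB := h0 B
  have hC := h0 C
  generalize (1 - Matrix.vecMulVec ν ν) * A * (1 - Matrix.vecMulVec ν ν) = A' at *
  generalize (1 - Matrix.vecMulVec ν ν) * B * (1 - Matrix.vecMulVec ν ν) = B' at *
  generalize (1 - Matrix.vecMulVec ν ν) * C * (1 - Matrix.vecMulVec ν ν) = C' at *
  simp only [polarNewton, Matrix.sub_mulVec, Matrix.add_mulVec, Matrix.smul_mulVec,
    Matrix.one_mulVec, dotProduct_add, dotProduct_sub, dotProduct_smul, smul_eq_mul,
    ← Matrix.mulVec_mulVec, hA, hB, hC, Matrix.mulVec_zero, dotProduct_zero, hν]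
  ring

theorem polarNewton_zero (B C : Matrix ι ι ℝ) : polarNewton 0 B C = 0 := by
  simpa using polarNewton_smul 0 0 B C

theorem polarNewton_sum {κ : Type*} (t : Finset κ) (A : κ → Matrix ι ι ℝ) (B C : Matrix ι ι ℝ) :
    polarNewton (∑ k ∈ t, A k) B C = ∑ k ∈ t, polarNewton (A k) B C := by
  classical
  induction t using Finset.induction_on with
  | empty => simp [polarNewton_zero]
  | insert a t ha ih => rw [Finset.sum_insert ha, Finset.sum_insert ha, polarNewton_add, ih]

/-- A symmetric weight sees only the symmetric part of the summand. Several identities below hold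
termwise only after symmetrisation in the two normal indices. -/
theorem sum_smul_symm {κ M : Type*} [Fintype κ] [AddCommGroup M] [Module ℝ M]
    (U : Matrix κ κ ℝ) (hU : Uᵀ = U) (T T' : κ → κ → M)
    (h : ∀ p q, T p q + T q p = T' p q + T' q p) :
    ∑ p, ∑ q, U p q • T p q = ∑ p, ∑ q, U p q • T' p q := by
  have key (T : κ → κ → M) : (2 : ℝ) • ∑ p, ∑ q, U p q • T p q
      = ∑ p, ∑ q, U p q • (T p q + T q p) := by
    have h1 : ∑ p, ∑ q, U p q • T q p = ∑ p, ∑ q, U p q • T p q := by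
      rw [Finset.sum_comm]
      refine Finset.sum_congr rfl fun p _ => Finset.sum_congr rfl fun q _ => ?_
      rw [← Matrix.transpose_apply U, hU]
    simp only [smul_add, Finset.sum_add_distrib, h1, two_smul]
  have := (key T).trans ((by simp only [h] : _ = _) : _ = ∑ p, ∑ q, U p q • (T' p q + T' q p))
  rw [← key T'] at this
  exact smul_right_injective M (two_ne_zero' ℝ) this

end NewtonTensor

end GBC


namespace GBC

/-! ### Contractions of a curvature tensor given by the Gauss equation -/

section GaussTensor

theorem sum_mul_sum_sum_comm {ι κ : Type*} [Fintype ι] [Fintype κ] (c : ι → ℝ) (U : κ → κ → ℝ)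
    (X : κ → κ → ι → ℝ) :
    ∑ i, c i * ∑ p, ∑ q, U p q * X p q i = ∑ p, ∑ q, U p q * ∑ i, c i * X p q i := by
  simp only [Finset.mul_sum]
  rw [Finset.sum_comm]
  refine Finset.sum_congr rfl fun p _ => ?_
  rw [Finset.sum_comm]
  exact Finset.sum_congr rfl fun q _ => Finset.sum_congr rfl fun i _ => by ring

theorem sum_sum_mul_sum_sum_comm {ι κ : Type*} [Fintype ι] [Fintype κ] (c : ι → ι → ℝ)
    (U : κ → κ → ℝ) (X : κ → κ → ι → ι → ℝ) :
    ∑ i, ∑ k, c i k * ∑ p, ∑ q, U p q * X p q i k =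
      ∑ p, ∑ q, U p q * ∑ i, ∑ k, c i k * X p q i k := by
  simpa only [Fintype.sum_prod_type] using
    sum_mul_sum_sum_comm (fun y : ι × ι => c y.1 y.2) U fun p q y => X p q y.1 y.2

theorem sum_four_mul {ι : Type*} [Fintype ι] (w x y z : ι → ℝ) (X Y : ι → ι → ℝ) :
    ∑ a, ∑ b, ∑ c, ∑ d, w a * x b * y c * z d * (X a c * Y b d) =
      (∑ a, ∑ c, w a * y c * X a c) * ∑ b, ∑ d, x b * z d * Y b d := by
  simp only [Finset.sum_mul]
  refine Finset.sum_congr rfl fun a _ => ?_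
  rw [Finset.sum_comm]
  refine Finset.sum_congr rfl fun c _ => ?_
  simp only [Finset.mul_sum]
  exact Finset.sum_congr rfl fun b _ => Finset.sum_congr rfl fun d _ => by ring

theorem sum_four_mul' {ι : Type*} [Fintype ι] (w x y z : ι → ℝ) (X Y : ι → ι → ℝ) :
    ∑ a, ∑ b, ∑ c, ∑ d, w a * x b * y c * z d * (X a d * Y b c) =
      (∑ a, ∑ d, w a * z d * X a d) * ∑ b, ∑ c, x b * y c * Y b c := by
  rw [← sum_four_mul]
  refine Finset.sum_congr rfl fun a _ => Finset.sum_congr rfl fun b _ => ?_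
  rw [Finset.sum_comm]
  exact Finset.sum_congr rfl fun c _ => Finset.sum_congr rfl fun d _ => by ring

theorem sum_mul_mul_eq {ι : Type*} [Fintype ι] (A B C : Matrix ι ι ℝ) (i k : ι) (hC : Cᵀ = C) :
    ∑ a, ∑ c, A i a * C k c * B a c = (A * B * C) i k := by
  simp only [Matrix.mul_apply, Finset.sum_mul]
  rw [Finset.sum_comm]
  refine Finset.sum_congr rfl fun c _ => Finset.sum_congr rfl fun a _ => ?_
  rw [← Matrix.transpose_apply C, hC]
  ring

theorem sum_mul_eq_trace {ι : Type*} [Fintype ι] (A B : Matrix ι ι ℝ) (hB : Bᵀ = B) :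
    ∑ i, ∑ k, A i k * B i k = (A * B).trace := by
  simp only [Matrix.trace, Matrix.diag_apply, Matrix.mul_apply]
  refine Finset.sum_congr rfl fun i _ => Finset.sum_congr rfl fun k _ => ?_
  rw [← Matrix.transpose_apply B, hB]

theorem sum_mul_mul_eq' {ι : Type*} [Fintype ι] (A B C : Matrix ι ι ℝ) (i k : ι) (hB : Bᵀ = B) :
    ∑ j, ∑ l, A i l * C j k * B j l = (A * B * C) i k := by
  simp only [Matrix.mul_apply, Finset.sum_mul]
  refine Finset.sum_congr rfl fun j _ => Finset.sum_congr rfl fun l _ => ?_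
  rw [← Matrix.transpose_apply B, hB]
  ring

variable {n m : ℕ} {s : Set (E n)} {g : E n → Matrix (Fin n) (Fin n) ℝ} {x : E n}
  {U : Matrix (Fin m) (Fin m) ℝ} {S : Fin m → Matrix (Fin n) (Fin n) ℝ}

/-- The curvature tensor of `g` at `x` is given by the Gauss equation with Hessians `S^α` and
inverse normal Gram matrix `U`. -/
def GaussEq (s : Set (E n)) (g : E n → Matrix (Fin n) (Fin n) ℝ) (x : E n)
    (U : Matrix (Fin m) (Fin m) ℝ) (S : Fin m → Matrix (Fin n) (Fin n) ℝ) : Prop :=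
  ∀ i j k l, riem s g i j k l x = ∑ p, ∑ q, U p q * (S p i k * S q j l - S p i l * S q j k)

theorem GaussEq.ric_eq (h : GaussEq s g x U S) (hg : (g x)⁻¹ᵀ = (g x)⁻¹) (hS : ∀ p, (S p)ᵀ = S p) :
    ric s g x = ∑ p, ∑ q, U p q • (((g x)⁻¹ * S p).trace • S q - S q * (g x)⁻¹ * S p) := by
  ext j l
  have h1 (p q) : ∑ i, ∑ k, (g x)⁻¹ i k * (S p i k * S q j l - S p i l * S q j k)
      = ((g x)⁻¹ * S p).trace * S q j l - (S q * (g x)⁻¹ * S p) j l := by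
    rw [← sum_mul_eq_trace _ _ (hS p), ← sum_mul_mul_eq _ _ _ _ _ (hS p)]
    simp only [mul_sub, Finset.sum_sub_distrib, Finset.sum_mul]
    congr 1
    · exact Finset.sum_congr rfl fun i _ => Finset.sum_congr rfl fun k _ => by ring
    · rw [Finset.sum_comm]
      refine Finset.sum_congr rfl fun i _ => Finset.sum_congr rfl fun k _ => ?_
      rw [← Matrix.transpose_apply (S p), hS p, ← Matrix.transpose_apply (g x)⁻¹, hg]
      ring
  simp only [ric, Matrix.of_apply, h _ _ _ _, Matrix.sum_apply, Matrix.smul_apply,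
    Matrix.sub_apply, smul_eq_mul, ← h1]
  exact sum_sum_mul_sum_sum_comm (fun i k => (g x)⁻¹ i k) U
    fun p q i k => S p i k * S q j l - S p i l * S q j k

theorem GaussEq.ricUp_eq (h : GaussEq s g x U S) (hg : (g x)⁻¹ᵀ = (g x)⁻¹)
    (hS : ∀ p, (S p)ᵀ = S p) :
    ricUp s g x = ∑ p, ∑ q, U p q • (((g x)⁻¹ * S p).trace • ((g x)⁻¹ * S q * (g x)⁻¹)
      - (g x)⁻¹ * S q * ((g x)⁻¹ * S p) * (g x)⁻¹) := by
  simp only [ricUp, h.ric_eq hg hS, Matrix.mul_sum, Matrix.sum_mul, Matrix.mul_smul,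
    Matrix.smul_mul, Matrix.mul_sub, Matrix.sub_mul, Matrix.mul_assoc]

theorem GaussEq.scal_eq (h : GaussEq s g x U S) (hg : (g x)⁻¹ᵀ = (g x)⁻¹)
    (hS : ∀ p, (S p)ᵀ = S p) :
    scal s g x = ∑ p, ∑ q, U p q * (((g x)⁻¹ * S p).trace * ((g x)⁻¹ * S q).trace
      - ((g x)⁻¹ * S p * ((g x)⁻¹ * S q)).trace) := by
  have h0 : scal s g x = ((ric s g x)ᵀ * (g x)⁻¹).trace := by
    simp only [scal, Matrix.trace, Matrix.diag_apply, Matrix.mul_apply, Matrix.transpose_apply]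
    rw [Finset.sum_comm]
    exact Finset.sum_congr rfl fun i _ => Finset.sum_congr rfl fun k _ => mul_comm _ _
  rw [h0, ← Matrix.trace_transpose, Matrix.transpose_mul, Matrix.transpose_transpose, hg,
    h.ric_eq hg hS]
  simp only [Matrix.mul_sum, Matrix.trace_sum, Matrix.mul_smul, Matrix.trace_smul, smul_eq_mul,
    Matrix.mul_sub, Matrix.trace_sub]
  refine Finset.sum_congr rfl fun p _ => Finset.sum_congr rfl fun q _ => ?_
  rw [Matrix.trace_mul_comm ((g x)⁻¹ * S p)]
  simp only [Matrix.mul_assoc]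

theorem GaussEq.riemUp_eq (h : GaussEq s g x U S) (hg : (g x)⁻¹ᵀ = (g x)⁻¹) (i j k l : Fin n) :
    riemUp s g i j k l x = ∑ p, ∑ q, U p q *
      (((g x)⁻¹ * S p * (g x)⁻¹) i k * ((g x)⁻¹ * S q * (g x)⁻¹) j l
        - ((g x)⁻¹ * S p * (g x)⁻¹) i l * ((g x)⁻¹ * S q * (g x)⁻¹) j k) := by
  have key (p q) : ∑ a, ∑ b, ∑ c, ∑ d, (g x)⁻¹ i a * (g x)⁻¹ j b * (g x)⁻¹ k c * (g x)⁻¹ l d *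
      (S p a c * S q b d - S p a d * S q b c) =
      ((g x)⁻¹ * S p * (g x)⁻¹) i k * ((g x)⁻¹ * S q * (g x)⁻¹) j l
        - ((g x)⁻¹ * S p * (g x)⁻¹) i l * ((g x)⁻¹ * S q * (g x)⁻¹) j k := by
    simp only [← sum_mul_mul_eq _ _ _ _ _ hg, mul_sub, Finset.sum_sub_distrib]
    rw [← sum_four_mul ((g x)⁻¹ i) ((g x)⁻¹ j) ((g x)⁻¹ k) ((g x)⁻¹ l) (S p) (S q),
      ← sum_four_mul' ((g x)⁻¹ i) ((g x)⁻¹ j) ((g x)⁻¹ k) ((g x)⁻¹ l) (S p) (S q)]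
  simp only [← key, riemUp, h _ _ _ _]
  have := sum_mul_sum_sum_comm (ι := Fin n × Fin n × Fin n × Fin n)
    (fun y => (g x)⁻¹ i y.1 * (g x)⁻¹ j y.2.1 * (g x)⁻¹ k y.2.2.1 * (g x)⁻¹ l y.2.2.2) U
    (fun p q y => S p y.1 y.2.2.1 * S q y.2.1 y.2.2.2 - S p y.1 y.2.2.2 * S q y.2.1 y.2.2.1)
  simpa only [Fintype.sum_prod_type] using this

/-- The Ricci and scalar terms of P are antisymmetric by their form; the Riemann term is so by the
Gauss equation. -/
theorem GaussEq.tensorP_antisymm (h : GaussEq s g x U S) (hg : (g x)⁻¹ᵀ = (g x)⁻¹)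
    (i j k l : Fin n) : tensorP s g i j l k x = - tensorP s g i j k l x := by
  have : riemUp s g i j l k x = - riemUp s g i j k l x := by
    rw [h.riemUp_eq hg, h.riemUp_eq hg]
    simp only [← Finset.sum_neg_distrib, ← mul_neg, neg_sub]
  simp only [tensorP, this]
  ring

/-- Contraction of `P` with a symmetric matrix in the second and fourth slots. -/
theorem GaussEq.sum_tensorP_mul (h : GaussEq s g x U S) (hg : (g x)⁻¹ᵀ = (g x)⁻¹)
    (hS : ∀ p, (S p)ᵀ = S p) (hU : Uᵀ = U) (Q : Matrix (Fin n) (Fin n) ℝ) (hQ : Qᵀ = Q)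
    (i k : Fin n) :
    ∑ j, ∑ l, tensorP s g i j k l x * Q j l =
      ((1 / 2 : ℝ) • ∑ p, ∑ q, U p q •
        (polarNewton ((g x)⁻¹ * Q) ((g x)⁻¹ * S p) ((g x)⁻¹ * S q) * (g x)⁻¹)) i k := by
  have e1 : ∑ j, ∑ l, riemUp s g i j k l x * Q j l = (∑ p, ∑ q, U p q •
      (((g x)⁻¹ * S q * (g x)⁻¹ * Q).trace • ((g x)⁻¹ * S p * (g x)⁻¹)
        - (g x)⁻¹ * S p * (g x)⁻¹ * Q * ((g x)⁻¹ * S q * (g x)⁻¹))) i k := by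
    simp only [h.riemUp_eq hg, mul_comm _ (Q _ _)]
    rw [sum_sum_mul_sum_sum_comm (fun j l => Q j l) U fun p q j l =>
      ((g x)⁻¹ * S p * (g x)⁻¹) i k * ((g x)⁻¹ * S q * (g x)⁻¹) j l
        - ((g x)⁻¹ * S p * (g x)⁻¹) i l * ((g x)⁻¹ * S q * (g x)⁻¹) j k]
    simp only [Matrix.sum_apply, Matrix.smul_apply, Matrix.sub_apply, smul_eq_mul]
    refine Finset.sum_congr rfl fun p _ => Finset.sum_congr rfl fun q _ => ?_
    rw [← sum_mul_eq_trace _ _ hQ, ← sum_mul_mul_eq' _ _ _ _ _ hQ]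
    simp only [mul_sub, Finset.sum_sub_distrib, Finset.sum_mul]
    congr 2
    · exact Finset.sum_congr rfl fun i _ => Finset.sum_congr rfl fun k _ => by ring
    · exact Finset.sum_congr rfl fun i _ => Finset.sum_congr rfl fun k _ => by ring
  have e2 : ∑ j, ∑ l, tensorP s g i j k l x * Q j l =
      ∑ j, ∑ l, riemUp s g i j k l x * Q j l
      + ((g x)⁻¹ * Q * ricUp s g x - (ricUp s g x * Q).trace • (g x)⁻¹
        - ((g x)⁻¹ * Q).trace • ricUp s g x + ricUp s g x * Q * (g x)⁻¹
        + (1 / 2 * scal s g x) • (((g x)⁻¹ * Q).trace • (g x)⁻¹ - (g x)⁻¹ * Q * (g x)⁻¹)) i k := by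
    simp only [Matrix.sub_apply, Matrix.add_apply, Matrix.smul_apply, smul_eq_mul,
      ← sum_mul_eq_trace _ _ hQ, ← sum_mul_mul_eq' _ _ _ _ _ hQ, Finset.sum_mul, Finset.mul_sum,
      mul_sub, ← Finset.sum_add_distrib, ← Finset.sum_sub_distrib]
    refine Finset.sum_congr rfl fun j _ => Finset.sum_congr rfl fun l _ => ?_
    simp only [tensorP]
    ring
  rw [e2, e1, ← Matrix.add_apply, h.ricUp_eq hg hS, h.scal_eq hg hS]
  refine congrArg (fun M : Matrix (Fin n) (Fin n) ℝ => M i k) ?_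
  have : (1 / 2 : ℝ) • ∑ p, ∑ q, U p q •
        (polarNewton ((g x)⁻¹ * Q) ((g x)⁻¹ * S p) ((g x)⁻¹ * S q) * (g x)⁻¹)
      = ∑ p, ∑ q, U p q •
        ((1 / 2 : ℝ) • (polarNewton ((g x)⁻¹ * Q) ((g x)⁻¹ * S p) ((g x)⁻¹ * S q) * (g x)⁻¹)) := by
    simp only [Finset.smul_sum, smul_comm (1 / 2 : ℝ)]
  rw [this]
  simp only [Finset.mul_sum, Finset.sum_smul, Matrix.mul_sum, Matrix.sum_mul, Matrix.trace_sum,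
    Finset.smul_sum, Matrix.trace_smul, Matrix.smul_mul, Matrix.mul_smul, ← Finset.sum_add_distrib,
    ← Finset.sum_sub_distrib, smul_eq_mul, mul_smul, smul_comm _ (U _ _), ← smul_add, ← smul_sub,
    mul_left_comm _ (U _ _)]
  -- The Newton tensor is symmetric in p and q, the Riemann, Ricci and scalar terms are not
  -- individually so; the two sides agree after symmetrisation and cyclicity of the trace.
  refine sum_smul_symm U hU _ _ fun p q => ?_
  simp only [Matrix.mul_assoc, polarNewton, polarE3, Matrix.add_mul, Matrix.sub_mul,
    Matrix.smul_mul, Matrix.one_mul, Matrix.mul_add, Matrix.mul_sub, Matrix.trace_sub,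
    Matrix.mul_smul, Matrix.trace_smul, smul_eq_mul]
  generalize (g x)⁻¹ = G
  have t1 (M N : Matrix (Fin n) (Fin n) ℝ) : (G * (M * (G * N))).trace = (G * (N * (G * M))).trace := by
    rw [← Matrix.mul_assoc, Matrix.trace_mul_comm, Matrix.mul_assoc]
  have t2 (M N P : Matrix (Fin n) (Fin n) ℝ) : (G * (M * (G * (N * (G * P))))).trace
      = (G * (N * (G * (P * (G * M))))).trace := by
    rw [← Matrix.mul_assoc, Matrix.trace_mul_comm]
    simp only [Matrix.mul_assoc]
  rw [t1 (S p) Q, t1 (S q) Q, t1 (S q) (S p), ← t2 Q (S q) (S p), ← t2 Q (S p) (S q)]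
  module

end GaussTensor

end GBC


namespace GBC

/-! ### The divergence of the mass field as pointwise algebra -/

section AlgebraicDivergence

variable {n m : ℕ}

theorem sum_single_dotProduct_mulVec (M : Matrix (Fin n) (Fin n) ℝ) :
    ∑ i, (Pi.single i 1 : Fin n → ℝ) ⬝ᵥ M *ᵥ Pi.single i 1 = M.trace := by
  simp [Matrix.trace]

theorem sum_dotProduct_single_mul (v w : Fin n → ℝ) :
    ∑ i, (v ⬝ᵥ Pi.single i 1) * ((Pi.single i 1 : Fin n → ℝ) ⬝ᵥ w) = v ⬝ᵥ w := by
  simp only [dotProduct_single_one, single_one_dotProduct]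
  rfl

theorem sum_vecMulVec_mulVec_single (M : Matrix (Fin n) (Fin n) ℝ) :
    ∑ i, Matrix.vecMulVec (M *ᵥ Pi.single i 1) (Pi.single i 1) = M := by
  ext a b
  simp [Matrix.sum_apply, Matrix.vecMulVec_apply, Pi.single_apply]

theorem mulVec_dotProduct_of_symm {S : Matrix (Fin n) (Fin n) ℝ} (hS : Sᵀ = S)
    (v w : Fin n → ℝ) : (S *ᵥ v) ⬝ᵥ w = (S *ᵥ w) ⬝ᵥ v := by
  rw [dotProduct_comm, Matrix.dotProduct_mulVec, ← Matrix.mulVec_transpose, hS]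

theorem mulVec_sum' {κ : Type*} (t : Finset κ) (M : Matrix (Fin n) (Fin n) ℝ)
    (v : κ → Fin n → ℝ) : M *ᵥ ∑ k ∈ t, v k = ∑ k ∈ t, M *ᵥ v k := by
  exact map_sum (Matrix.mulVecLin M) v t

theorem sum_mulVec' {κ : Type*} (t : Finset κ) (M : κ → Matrix (Fin n) (Fin n) ℝ)
    (v : Fin n → ℝ) : (∑ k ∈ t, M k) *ᵥ v = ∑ k ∈ t, M k *ᵥ v := by
  ext i
  simp only [Matrix.mulVec, Finset.sum_apply, dotProduct, Matrix.sum_apply, Finset.sum_mul]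
  exact Finset.sum_comm

theorem dotProduct_sum' {κ : Type*} (t : Finset κ) (u : Fin n → ℝ) (v : κ → Fin n → ℝ) :
    u ⬝ᵥ ∑ k ∈ t, v k = ∑ k ∈ t, u ⬝ᵥ v k := by
  simp only [dotProduct, Finset.sum_apply, Finset.mul_sum]
  exact Finset.sum_comm

theorem polarNewton_sub (A A' B C : Matrix (Fin n) (Fin n) ℝ) :
    polarNewton (A - A') B C = polarNewton A B C - polarNewton A' B C := by
  rw [eq_sub_iff_add_eq, ← polarNewton_add, sub_add_cancel]

/-- Decomposing g⁻¹T_i into the rank-one matrices (g⁻¹ T_i e_j) ⊗ e_j exposes e_i and e_j in two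
covariant slots, where the Newton tensor is antisymmetric while T is symmetric in i and j. This
plays the role of the Codazzi equation. -/
theorem sum_polarNewton_third (gi : Matrix (Fin n) (Fin n) ℝ)
    (T : Fin n → Matrix (Fin n) (Fin n) ℝ) (hT : ∀ i j a, T i a j = T j a i)
    (B C : Matrix (Fin n) (Fin n) ℝ) (u : Fin n → ℝ) :
    ∑ i, (Pi.single i 1 : Fin n → ℝ) ⬝ᵥ polarNewton (gi * T i) B C *ᵥ u = 0 := by
  have h1 (i : Fin n) : (Pi.single i 1 : Fin n → ℝ) ⬝ᵥ polarNewton (gi * T i) B C *ᵥ u =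
      ∑ j, (Pi.single i 1 : Fin n → ℝ) ⬝ᵥ
        polarNewton (Matrix.vecMulVec (gi *ᵥ fun a => T i a j) (Pi.single j 1)) B C *ᵥ u := by
    conv_lhs => rw [← sum_vecMulVec_mulVec_single (gi * T i)]
    rw [polarNewton_sum, sum_mulVec', dotProduct_sum']
    refine Finset.sum_congr rfl fun j _ => ?_
    rw [← Matrix.mulVec_mulVec, Matrix.mulVec_single_one]
    rfl
  have h2 : ∑ i, (Pi.single i 1 : Fin n → ℝ) ⬝ᵥ polarNewton (gi * T i) B C *ᵥ u =
      - ∑ i, (Pi.single i 1 : Fin n → ℝ) ⬝ᵥ polarNewton (gi * T i) B C *ᵥ u := by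
    simp only [h1]
    conv_lhs => rw [Finset.sum_comm]
    rw [← Finset.sum_neg_distrib]
    refine Finset.sum_congr rfl fun j _ => ?_
    rw [← Finset.sum_neg_distrib]
    refine Finset.sum_congr rfl fun i _ => ?_
    rw [dotProduct_polarNewton_vecMulVec_swap]
    simp only [hT i j]
  linarith

variable (gi : Matrix (Fin n) (Fin n) ℝ) (S : Fin m → Matrix (Fin n) (Fin n) ℝ)
  (T : Fin m → Fin n → Matrix (Fin n) (Fin n) ℝ) (U : Matrix (Fin m) (Fin m) ℝ)
  (φ : Fin m → Fin n → ℝ)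

/-- The derivative of the shape operator `A^α` in the direction `∂ᵢ`. -/
def dShape (a : Fin m) (i : Fin n) : Matrix (Fin n) (Fin n) ℝ :=
  gi * T a i - ∑ b, (Matrix.vecMulVec ((gi * S b) *ᵥ Pi.single i 1) (S a *ᵥ φ b)
    + Matrix.vecMulVec (φ b) ((S a * (gi * S b)) *ᵥ Pi.single i 1))

/-- The derivative of `∇f^α` in the direction `∂ᵢ`. -/
def dGrad (a : Fin m) (i : Fin n) : Fin n → ℝ :=
  ∑ b, (U a b • ((gi * S b) *ᵥ Pi.single i 1) - ((S b *ᵥ φ a) ⬝ᵥ Pi.single i 1) • φ b)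

/-- The derivative of `U^{αβ}` in the direction `∂ᵢ`. -/
def dGramInv (i : Fin n) (p q : Fin m) : ℝ :=
  - ∑ c, (U p c * ((S c *ᵥ φ q) ⬝ᵥ Pi.single i 1) + U c q * ((S c *ᵥ φ p) ⬝ᵥ Pi.single i 1))

theorem sum_polarNewton_dShape (hT : ∀ a i j k, T a i k j = T a j k i) (a : Fin m)
    (B C : Matrix (Fin n) (Fin n) ℝ) (u : Fin n → ℝ) :
    ∑ i, (Pi.single i 1 : Fin n → ℝ) ⬝ᵥ polarNewton (dShape gi S T φ a i) B C *ᵥ u =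
      ∑ b, ((S a *ᵥ φ b) ⬝ᵥ polarNewton (gi * S b) B C *ᵥ u
        - ∑ i, (Pi.single i 1 : Fin n → ℝ) ⬝ᵥ polarNewton
          (Matrix.vecMulVec (φ b) ((S a * (gi * S b)) *ᵥ Pi.single i 1)) B C *ᵥ u) := by
  have h1 (b : Fin m) : (S a *ᵥ φ b) ⬝ᵥ polarNewton (gi * S b) B C *ᵥ u =
      - ∑ i, (Pi.single i 1 : Fin n → ℝ) ⬝ᵥ polarNewton
        (Matrix.vecMulVec ((gi * S b) *ᵥ Pi.single i 1) (S a *ᵥ φ b)) B C *ᵥ u := by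
    conv_lhs => rw [← sum_vecMulVec_mulVec_single (gi * S b)]
    rw [polarNewton_sum, sum_mulVec', dotProduct_sum', ← Finset.sum_neg_distrib]
    exact Finset.sum_congr rfl fun i _ => dotProduct_polarNewton_vecMulVec_swap _ _ _ _ _ _
  simp only [dShape, polarNewton_sub, polarNewton_sum, polarNewton_add, Matrix.sub_mulVec,
    sum_mulVec', Matrix.add_mulVec, dotProduct_sub, dotProduct_add, dotProduct_sum',
    Finset.sum_sub_distrib, sum_polarNewton_third gi (T a) (hT a), h1, Finset.sum_add_distrib,
    Finset.sum_neg_distrib]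
  simp only [Finset.sum_comm (s := (Finset.univ : Finset (Fin n)))
    (t := (Finset.univ : Finset (Fin m)))]
  ring

theorem sum_dotProduct_dGrad (a : Fin m) (N : Matrix (Fin n) (Fin n) ℝ) :
    ∑ i, (Pi.single i 1 : Fin n → ℝ) ⬝ᵥ N *ᵥ dGrad gi S U φ a i =
      ∑ b, (U a b * (N * (gi * S b)).trace - (S b *ᵥ φ a) ⬝ᵥ N *ᵥ φ b) := by
  simp only [dGrad, mulVec_sum', dotProduct_sum']
  rw [Finset.sum_comm]
  refine Finset.sum_congr rfl fun b _ => ?_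
  simp only [Matrix.mulVec_sub, Matrix.mulVec_smul, dotProduct_sub, dotProduct_smul, smul_eq_mul,
    Finset.sum_sub_distrib, ← Finset.mul_sum, sum_dotProduct_single_mul]
  rw [← sum_single_dotProduct_mulVec]
  simp only [Matrix.mulVec_mulVec]

theorem sum_dGramInv_mul (p q : Fin m) (w : Fin n → ℝ) :
    ∑ i, dGramInv S U φ i p q * ((Pi.single i 1 : Fin n → ℝ) ⬝ᵥ w) =
      - ∑ c, (U p c * ((S c *ᵥ φ q) ⬝ᵥ w) + U c q * ((S c *ᵥ φ p) ⬝ᵥ w)) := by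
  simp only [dGramInv, neg_mul, Finset.sum_mul, Finset.sum_neg_distrib]
  rw [Finset.sum_comm]
  congr 1
  refine Finset.sum_congr rfl fun c _ => ?_
  simp only [add_mul, Finset.sum_add_distrib, mul_assoc, ← Finset.mul_sum,
    sum_dotProduct_single_mul]

-- Index bookkeeping. Here `f` stands for ⟨S_s φ_b, N φ_u⟩, `r` for the remainder terms and `t` for
-- the traces. The `f` terms from the derivative of U cancel those from the second and third shape
-- operators, and the ones from the first shape operator cancel those from ∇f. The two remainder
-- terms with a differentiated p or q agree by symmetry of U, whence the factor 2.
omit gi S T φ in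
theorem sum_rearrange (hU : Uᵀ = U) (f : Fin m → Fin m → Fin m → Fin m → Fin m → Fin m → ℝ)
    (hf1 : ∀ s b x y z u, f s b x y z u = f s b y x z u)
    (hf2 : ∀ s b x y z u, f s b x y z u = f s b x z y u)
    (r : Fin m → Fin m → Fin m → Fin m → Fin m → ℝ) (t : Fin m → Fin m → Fin m → Fin m → ℝ) :
    ∑ a, ∑ p, ∑ q, -(∑ c, U p c * f c q a p q a + ∑ c, U c q * f c p a p q a) +
      (∑ a, ∑ p, ∑ q, U p q * ∑ b, (f a b b p q a - r a b p q a)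
        + ∑ a, ∑ p, ∑ q, U p q * ∑ b, (f p b b a q a - r p b a q a)
        + ∑ a, ∑ p, ∑ q, U p q * ∑ b, (f q b b a p a - r q b a p a)
        + ∑ a, ∑ p, ∑ q, U p q * ∑ b, (U a b * t a b p q - f b a a p q b)) =
    ∑ a, ∑ b, ∑ p, ∑ q, U a b * U p q * t a b p q
      + ∑ a, ∑ b, ∑ p, ∑ q, U p q * (- r a b p q a - 2 * r p b a q a) := by
  have hUpq (p q : Fin m) : U q p = U p q := by rw [← Matrix.transpose_apply U, hU]
  have reorder (F : Fin m → Fin m → Fin m → Fin m → ℝ) :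
      ∑ a, ∑ b, ∑ p, ∑ q, F a b p q = ∑ a, ∑ p, ∑ q, ∑ b, F a b p q := by
    refine Finset.sum_congr rfl fun a _ => ?_
    rw [Finset.sum_comm]
    exact Finset.sum_congr rfl fun p _ => Finset.sum_comm
  have swap (F : Fin m → Fin m → Fin m → Fin m → ℝ) :
      ∑ a, ∑ p, ∑ q, ∑ b, F a p q b = ∑ a, ∑ p, ∑ q, ∑ b, F a q p b :=
    Finset.sum_congr rfl fun a _ => Finset.sum_comm
  have h1 : ∑ a, ∑ p, ∑ q, ∑ c, U p c * f c q a p q a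
      = ∑ a, ∑ p, ∑ q, ∑ b, U p q * f q b b a p a := by
    refine Finset.sum_congr rfl fun a _ => Finset.sum_congr rfl fun p _ => ?_
    rw [Finset.sum_comm]
    refine Finset.sum_congr rfl fun q _ => Finset.sum_congr rfl fun b _ => ?_
    rw [hf1 q b b a p, hf2]
  have h2 : ∑ a, ∑ p, ∑ q, ∑ c, U c q * f c p a p q a
      = ∑ a, ∑ p, ∑ q, ∑ b, U p q * f p b b a q a := by
    refine Finset.sum_congr rfl fun a _ => ?_
    rw [Finset.sum_comm]
    conv_rhs => rw [Finset.sum_comm]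
    refine Finset.sum_congr rfl fun q _ => ?_
    rw [Finset.sum_comm]
    refine Finset.sum_congr rfl fun p _ => Finset.sum_congr rfl fun b _ => ?_
    rw [hf1 p b b a q]
  have h3 : ∑ a, ∑ p, ∑ q, ∑ b, U p q * f a b b p q a
      = ∑ a, ∑ p, ∑ q, ∑ b, U p q * f b a a p q b := by
    rw [← reorder (fun a b p q => U p q * f a b b p q a),
      ← reorder (fun a b p q => U p q * f b a a p q b), Finset.sum_comm]
  have h4 : ∑ a, ∑ p, ∑ q, ∑ b, U p q * r q b a p a
      = ∑ a, ∑ p, ∑ q, ∑ b, U p q * r p b a q a := by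
    rw [swap]
    simp only [hUpq]
  have hR : ∑ a, ∑ b, ∑ p, ∑ q, U a b * U p q * t a b p q
      + ∑ a, ∑ b, ∑ p, ∑ q, U p q * (- r a b p q a - 2 * r p b a q a)
      = ∑ a, ∑ p, ∑ q, ∑ b, U p q * (U a b * t a b p q)
        + (- ∑ a, ∑ p, ∑ q, ∑ b, U p q * r a b p q a
          - 2 * ∑ a, ∑ p, ∑ q, ∑ b, U p q * r p b a q a) := by
    rw [reorder (fun a b p q => U a b * U p q * t a b p q),
      reorder (fun a b p q => U p q * (- r a b p q a - 2 * r p b a q a))]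
    simp only [Finset.mul_sum, ← Finset.sum_neg_distrib, ← Finset.sum_sub_distrib,
      ← Finset.sum_add_distrib]
    exact Finset.sum_congr rfl fun a _ => Finset.sum_congr rfl fun p _ =>
      Finset.sum_congr rfl fun q _ => Finset.sum_congr rfl fun b _ => by ring
  rw [hR]
  simp only [Finset.mul_sum, mul_sub, Finset.sum_add_distrib, Finset.sum_sub_distrib,
    Finset.sum_neg_distrib]
  rw [h1, h2, h3, h4]
  simp only [← Finset.mul_sum]
  ring

theorem sum_divergence_terms (hT : ∀ a i j k, T a i k j = T a j k i) (hU : Uᵀ = U) :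
    ∑ i, (Pi.single i 1 : Fin n → ℝ) ⬝ᵥ ∑ a, ∑ p, ∑ q,
      (dGramInv S U φ i p q • (polarNewton (gi * S a) (gi * S p) (gi * S q) *ᵥ φ a)
        + U p q • ((polarNewton (dShape gi S T φ a i) (gi * S p) (gi * S q)
            + polarNewton (gi * S a) (dShape gi S T φ p i) (gi * S q)
            + polarNewton (gi * S a) (gi * S p) (dShape gi S T φ q i)) *ᵥ φ a
          + polarNewton (gi * S a) (gi * S p) (gi * S q) *ᵥ dGrad gi S U φ a i)) =
    (∑ a, ∑ b, ∑ p, ∑ q, U a b * U p q *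
      (polarNewton (gi * S a) (gi * S p) (gi * S q) * (gi * S b)).trace)
    + ∑ a, ∑ b, ∑ p, ∑ q, U p q *
      (- ∑ i, ((Pi.single i 1 : Fin n → ℝ) ⬝ᵥ polarNewton (Matrix.vecMulVec (φ b)
          ((S a * (gi * S b)) *ᵥ Pi.single i 1)) (gi * S p) (gi * S q) *ᵥ φ a)
      - 2 * ∑ i, ((Pi.single i 1 : Fin n → ℝ) ⬝ᵥ polarNewton (Matrix.vecMulVec (φ b)
          ((S p * (gi * S b)) *ᵥ Pi.single i 1)) (gi * S a) (gi * S q) *ᵥ φ a)) := by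
  -- By symmetry in the arguments the differentiated operator may always be placed in the first
  -- slot.
  have e1 : ∀ a p q i, polarNewton (gi * S a) (dShape gi S T φ p i) (gi * S q)
      = polarNewton (dShape gi S T φ p i) (gi * S a) (gi * S q) :=
    fun a p q i => polarNewton_swap_left _ _ _
  have e2 : ∀ a p q i, polarNewton (gi * S a) (gi * S p) (dShape gi S T φ q i)
      = polarNewton (dShape gi S T φ q i) (gi * S a) (gi * S p) := fun a p q i => by
    rw [polarNewton_swap_right, polarNewton_swap_left]
  simp only [dotProduct_sum']
  rw [Finset.sum_comm]
  simp only [Finset.sum_comm (s := (Finset.univ : Finset (Fin n)))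
    (t := (Finset.univ : Finset (Fin m)))]
  simp only [dotProduct_add, dotProduct_smul, smul_eq_mul, Matrix.add_mulVec,
    Finset.sum_add_distrib, e1, e2, ← Finset.mul_sum, sum_dGramInv_mul,
    sum_polarNewton_dShape gi S T φ hT, sum_dotProduct_dGrad, mul_add]
  exact sum_rearrange U hU
    (fun s b x y z u => (S s *ᵥ φ b) ⬝ᵥ polarNewton (gi * S x) (gi * S y) (gi * S z) *ᵥ φ u)
    (fun s b x y z u => by rw [polarNewton_swap_left])
    (fun s b x y z u => by rw [polarNewton_swap_right])
    (fun s b x y u => ∑ i, (Pi.single i 1 : Fin n → ℝ) ⬝ᵥ polarNewton (Matrix.vecMulVec (φ b)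
          ((S s * (gi * S b)) *ᵥ Pi.single i 1)) (gi * S x) (gi * S y) *ᵥ φ u)
    (fun a b p q => (polarNewton (gi * S a) (gi * S p) (gi * S q) * (gi * S b)).trace)

end AlgebraicDivergence

end GBC



namespace GBC

/-! ### Calculus of one-sided partial derivatives, entrywise for matrices -/

section PartialDerivatives

variable {n : ℕ} {s : Set (E n)} {x : E n} {ι κ η : Type*} [Fintype ι] [Fintype κ] [Fintype η]

theorem pd_congr {h k : E n → ℝ} (hhk : Set.EqOn h k s) (hx : x ∈ s) (i : Fin n) :
    pd s i h x = pd s i k x := by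
  simp only [pd, fderivWithin_congr hhk (hhk hx)]

theorem pd_add (hs : UniqueDiffWithinAt ℝ s x) {h k : E n → ℝ}
    (hh : DifferentiableWithinAt ℝ h s x) (hk : DifferentiableWithinAt ℝ k s x) (i : Fin n) :
    pd s i (fun y => h y + k y) x = pd s i h x + pd s i k x := by
  simp only [pd, fderivWithin_fun_add hs hh hk, _root_.add_apply]

theorem pd_sub (hs : UniqueDiffWithinAt ℝ s x) {h k : E n → ℝ}
    (hh : DifferentiableWithinAt ℝ h s x) (hk : DifferentiableWithinAt ℝ k s x) (i : Fin n) :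
    pd s i (fun y => h y - k y) x = pd s i h x - pd s i k x := by
  simp only [pd, fderivWithin_fun_sub hs hh hk, _root_.sub_apply]

theorem pd_mul (hs : UniqueDiffWithinAt ℝ s x) {h k : E n → ℝ}
    (hh : DifferentiableWithinAt ℝ h s x) (hk : DifferentiableWithinAt ℝ k s x) (i : Fin n) :
    pd s i (fun y => h y * k y) x = pd s i h x * k x + h x * pd s i k x := by
  simp only [pd, fderivWithin_fun_mul hs hh hk, _root_.add_apply,
    _root_.smul_apply, smul_eq_mul]
  ring

theorem pd_sum (hs : UniqueDiffWithinAt ℝ s x) (t : Finset κ) {h : κ → E n → ℝ}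
    (hh : ∀ k ∈ t, DifferentiableWithinAt ℝ (h k) s x) (i : Fin n) :
    pd s i (fun y => ∑ k ∈ t, h k y) x = ∑ k ∈ t, pd s i (h k) x := by
  simp only [pd, fderivWithin_fun_sum hs hh, _root_.sum_apply]

theorem pd_const (c : ℝ) (i : Fin n) : pd s i (fun _ => c) x = 0 := by
  simp [pd]

theorem contDiffOn_pd (hs : UniqueDiffOn ℝ s) {h : E n → ℝ} (hh : ContDiffOn ℝ ∞ h s) (i : Fin n) :
    ContDiffOn ℝ ∞ (pd s i h) s :=
  (hh.fderivWithin hs (m := ∞) le_rfl).clm_apply contDiffOn_const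

/-- One-sided second derivatives commute also at boundary points, because such points are limits of
interior points. -/
theorem pd_comm (hs : UniqueDiffOn ℝ s) (hcl : s ⊆ closure (interior s)) {h : E n → ℝ}
    (hh : ContDiffOn ℝ ∞ h s) (hx : x ∈ s) (i j : Fin n) :
    pd s i (pd s j h) x = pd s j (pd s i h) x := by
  have h1 : DifferentiableWithinAt ℝ (fderivWithin ℝ h s) s x :=
    ((hh.fderivWithin hs (m := ∞) le_rfl).differentiableOn (by simp)) x hx
  have h2 (i j : Fin n) : pd s i (pd s j h) x
      = fderivWithin ℝ (fderivWithin ℝ h s) s x (EuclideanSpace.single i 1)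
        (EuclideanSpace.single j 1) := by
    have : pd s j h = fun y => fderivWithin ℝ h s y (EuclideanSpace.single j 1) := rfl
    rw [this, pd, fderivWithin_clm_apply (hs x hx) h1 (differentiableWithinAt_const _)]
    simp
  rw [h2, h2]
  exact ((hh x hx).isSymmSndFDerivWithinAt
    (by simp; exact WithTop.coe_le_coe.2 le_top) hs (hcl hx) hx).eq _ _

/-- Entrywise smoothness of a matrix valued function on `s`. -/
def SmoothM (s : Set (E n)) (M : E n → Matrix ι κ ℝ) : Prop :=
  ∀ a b, ContDiffOn ℝ ∞ (fun y => M y a b) s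

/-- Entrywise smoothness of a vector valued function on `s`. -/
def SmoothV (s : Set (E n)) (v : E n → ι → ℝ) : Prop :=
  ∀ a, ContDiffOn ℝ ∞ (fun y => v y a) s

theorem _root_.ContDiffOn.diffWithin {h : E n → ℝ} (hh : ContDiffOn ℝ ∞ h s) (hx : x ∈ s) :
    DifferentiableWithinAt ℝ h s x :=
  hh.differentiableOn (by simp) x hx

namespace SmoothM

variable {M M' : E n → Matrix ι κ ℝ} {N : E n → Matrix κ η ℝ}

theorem mul (hM : SmoothM s M) (hN : SmoothM s N) : SmoothM s fun y => M y * N y := fun a b => by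
  simp only [Matrix.mul_apply]
  exact ContDiffOn.sum fun k _ => (hM a k).mul (hN k b)

theorem add (hM : SmoothM s M) (hM' : SmoothM s M') : SmoothM s fun y => M y + M' y := fun a b =>
  (hM a b).add (hM' a b)

theorem sub (hM : SmoothM s M) (hM' : SmoothM s M') : SmoothM s fun y => M y - M' y := fun a b =>
  (hM a b).sub (hM' a b)

theorem smul {c : E n → ℝ} (hc : ContDiffOn ℝ ∞ c s) (hM : SmoothM s M) :
    SmoothM s fun y => c y • M y := fun a b => hc.mul (hM a b)

theorem transpose (hM : SmoothM s M) : SmoothM s fun y => (M y)ᵀ := fun a b => hM b a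

theorem const (M : Matrix ι κ ℝ) : SmoothM s fun _ => M := fun _ _ => contDiffOn_const

theorem trace {M : E n → Matrix ι ι ℝ} (hM : SmoothM s M) :
    ContDiffOn ℝ ∞ (fun y => (M y).trace) s :=
  ContDiffOn.sum fun k _ => hM k k

theorem mulVec {v : E n → κ → ℝ} (hM : SmoothM s M) (hv : SmoothV s v) :
    SmoothV s fun y => M y *ᵥ v y := fun a => by
  simp only [Matrix.mulVec, dotProduct]
  exact ContDiffOn.sum fun k _ => (hM a k).mul (hv k)

theorem det [DecidableEq ι] {M : E n → Matrix ι ι ℝ} (hM : SmoothM s M) :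
    ContDiffOn ℝ ∞ (fun y => (M y).det) s := by
  simp only [Matrix.det_apply]
  refine ContDiffOn.sum fun σ _ => ContDiffOn.const_smul _ ?_
  exact contDiffOn_prod fun k _ => hM _ _

/-- Cramer's rule: the entries of the inverse are determinants of smooth entries divided by a
nonvanishing determinant. -/
theorem inv [DecidableEq ι] {M : E n → Matrix ι ι ℝ} (hM : SmoothM s M)
    (hdet : ∀ y ∈ s, (M y).det ≠ 0) : SmoothM s fun y => (M y)⁻¹ := fun a b => by
  simp only [Matrix.inv_def, Ring.inverse_eq_inv', Matrix.smul_apply, smul_eq_mul,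
    Matrix.adjugate_apply]
  refine (hM.det.inv hdet).mul (SmoothM.det fun c d => ?_)
  by_cases h : c = b
  · simp only [h, Matrix.updateRow_self]
    exact contDiffOn_const
  · simp only [Matrix.updateRow_ne h]
    exact hM c d

end SmoothM

/-- `h` is differentiable at `x` within `s`, and its `i`-th partial derivative is `h'`. -/
def HasPd (s : Set (E n)) (i : Fin n) (x : E n) (h : E n → ℝ) (h' : ℝ) : Prop :=
  DifferentiableWithinAt ℝ h s x ∧ pd s i h x = h'

/-- Entrywise version of `HasPd` for matrices. -/
def HasPdM (s : Set (E n)) (i : Fin n) (x : E n) (M : E n → Matrix ι κ ℝ) (M' : Matrix ι κ ℝ) :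
    Prop :=
  ∀ a b, HasPd s i x (fun y => M y a b) (M' a b)

/-- Entrywise version of `HasPd` for vectors. -/
def HasPdV (s : Set (E n)) (i : Fin n) (x : E n) (v : E n → ι → ℝ) (v' : ι → ℝ) : Prop :=
  ∀ a, HasPd s i x (fun y => v y a) (v' a)

variable {i : Fin n}

namespace HasPd

variable {h k : E n → ℝ} {h' k' : ℝ}

theorem add (hs : UniqueDiffWithinAt ℝ s x) (hh : HasPd s i x h h') (hk : HasPd s i x k k') :
    HasPd s i x (fun y => h y + k y) (h' + k') :=
  ⟨hh.1.add hk.1, by rw [pd_add hs hh.1 hk.1, hh.2, hk.2]⟩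

theorem sub (hs : UniqueDiffWithinAt ℝ s x) (hh : HasPd s i x h h') (hk : HasPd s i x k k') :
    HasPd s i x (fun y => h y - k y) (h' - k') :=
  ⟨hh.1.sub hk.1, by rw [pd_sub hs hh.1 hk.1, hh.2, hk.2]⟩

theorem mul (hs : UniqueDiffWithinAt ℝ s x) (hh : HasPd s i x h h') (hk : HasPd s i x k k') :
    HasPd s i x (fun y => h y * k y) (h' * k x + h x * k') :=
  ⟨hh.1.mul hk.1, by rw [pd_mul hs hh.1 hk.1, hh.2, hk.2]⟩

theorem sum (hs : UniqueDiffWithinAt ℝ s x) {t : Finset κ} {h : κ → E n → ℝ} {h' : κ → ℝ}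
    (hh : ∀ k ∈ t, HasPd s i x (h k) (h' k)) :
    HasPd s i x (fun y => ∑ k ∈ t, h k y) (∑ k ∈ t, h' k) :=
  ⟨DifferentiableWithinAt.fun_sum fun k hk => (hh k hk).1, by
    rw [pd_sum hs t fun k hk => (hh k hk).1]
    exact Finset.sum_congr rfl fun k hk => (hh k hk).2⟩

theorem smulM (hs : UniqueDiffWithinAt ℝ s x) {c : E n → ℝ} {c' : ℝ} (hc : HasPd s i x c c')
    {M : E n → Matrix ι κ ℝ} {M' : Matrix ι κ ℝ} (hM : HasPdM s i x M M') :
    HasPdM s i x (fun y => c y • M y) (c' • M x + c x • M') :=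
  fun a b => hc.mul hs (hM a b)

theorem const (c : ℝ) : HasPd s i x (fun _ => c) 0 :=
  ⟨differentiableWithinAt_const _, pd_const c i⟩

end HasPd

namespace HasPdM

variable {M M₁ : E n → Matrix ι κ ℝ} {M' M₁' : Matrix ι κ ℝ} {N : E n → Matrix κ η ℝ}
  {N' : Matrix κ η ℝ}

theorem add (hs : UniqueDiffWithinAt ℝ s x) (hM : HasPdM s i x M M') (hM₁ : HasPdM s i x M₁ M₁') :
    HasPdM s i x (fun y => M y + M₁ y) (M' + M₁') := fun a b => (hM a b).add hs (hM₁ a b)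

theorem sub (hs : UniqueDiffWithinAt ℝ s x) (hM : HasPdM s i x M M') (hM₁ : HasPdM s i x M₁ M₁') :
    HasPdM s i x (fun y => M y - M₁ y) (M' - M₁') := fun a b => (hM a b).sub hs (hM₁ a b)

theorem mul (hs : UniqueDiffWithinAt ℝ s x) (hM : HasPdM s i x M M') (hN : HasPdM s i x N N') :
    HasPdM s i x (fun y => M y * N y) (M' * N x + M x * N') := fun a b => by
  simp only [Matrix.mul_apply, Matrix.add_apply, ← Finset.sum_add_distrib]
  exact HasPd.sum hs fun k _ => (hM a k).mul hs (hN k b)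

theorem const (M : Matrix ι κ ℝ) : HasPdM s i x (fun _ => M) 0 := fun _ _ => HasPd.const _

theorem transpose (hM : HasPdM s i x M M') : HasPdM s i x (fun y => (M y)ᵀ) M'ᵀ :=
  fun a b => hM b a

theorem trace (hs : UniqueDiffWithinAt ℝ s x) {M : E n → Matrix ι ι ℝ} {M' : Matrix ι ι ℝ}
    (hM : HasPdM s i x M M') : HasPd s i x (fun y => (M y).trace) M'.trace :=
  HasPd.sum hs fun k _ => hM k k

theorem mulVec (hs : UniqueDiffWithinAt ℝ s x) {v : E n → κ → ℝ} {v' : κ → ℝ}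
    (hM : HasPdM s i x M M') (hv : HasPdV s i x v v') :
    HasPdV s i x (fun y => M y *ᵥ v y) (M' *ᵥ v x + M x *ᵥ v') := fun a => by
  simp only [Matrix.mulVec, dotProduct, Pi.add_apply, ← Finset.sum_add_distrib]
  exact HasPd.sum hs fun k _ => (hM a k).mul hs (hv k)

theorem congr_deriv {M'' : Matrix ι κ ℝ} (hM : HasPdM s i x M M') (h : M' = M'') :
    HasPdM s i x M M'' := h ▸ hM

theorem unique {M'' : Matrix ι κ ℝ} (hM : HasPdM s i x M M') (hM' : HasPdM s i x M M'') :
    M' = M'' := by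
  ext a b
  rw [← (hM a b).2, ← (hM' a b).2]

theorem polarNewton [DecidableEq ι] (hs : UniqueDiffWithinAt ℝ s x) {A B C : E n → Matrix ι ι ℝ}
    {A' B' C' : Matrix ι ι ℝ} (hA : HasPdM s i x A A') (hB : HasPdM s i x B B')
    (hC : HasPdM s i x C C') :
    HasPdM s i x (fun y => GBC.polarNewton (A y) (B y) (C y))
      (GBC.polarNewton A' (B x) (C x) + GBC.polarNewton (A x) B' (C x)
        + GBC.polarNewton (A x) (B x) C') := by
  have hE : HasPd s i x (fun y => GBC.polarE3 (A y) (B y) (C y)) _ :=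
    ((((((hA.trace hs).mul hs (hB.trace hs)).mul hs (hC.trace hs)).sub hs
      ((hA.trace hs).mul hs ((hB.mul hs hC).trace hs))).sub hs
      ((hB.trace hs).mul hs ((hA.mul hs hC).trace hs))).sub hs
      ((hC.trace hs).mul hs ((hA.mul hs hB).trace hs))).add hs
      (((hA.mul hs hB).mul hs hC).trace hs) |>.add hs (((hA.mul hs hC).mul hs hB).trace hs)
  have := (((hE.smulM hs (HasPdM.const 1)).sub hs
    ((((((hB.trace hs).mul hs (hC.trace hs)).sub hs ((hB.mul hs hC).trace hs)).smulM hs hA).add hs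
      ((((hA.trace hs).mul hs (hC.trace hs)).sub hs ((hA.mul hs hC).trace hs)).smulM hs hB)).add hs
      ((((hA.trace hs).mul hs (hB.trace hs)).sub hs ((hA.mul hs hB).trace hs)).smulM hs hC))).add hs
    ((((hC.trace hs).smulM hs ((hA.mul hs hB).add hs (hB.mul hs hA))).add hs
      ((hB.trace hs).smulM hs ((hA.mul hs hC).add hs (hC.mul hs hA)))).add hs
      ((hA.trace hs).smulM hs ((hB.mul hs hC).add hs (hC.mul hs hB))))).sub hs
    (((((((hA.mul hs hB).mul hs hC).add hs ((hA.mul hs hC).mul hs hB)).add hs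
      ((hB.mul hs hA).mul hs hC)).add hs ((hB.mul hs hC).mul hs hA)).add hs
      ((hC.mul hs hA).mul hs hB)).add hs ((hC.mul hs hB).mul hs hA))
  refine this.congr_deriv ?_
  simp only [GBC.polarNewton, GBC.polarE3, Matrix.trace_add, Matrix.add_mul, Matrix.mul_assoc]
  module

end HasPdM

theorem HasPdV.unique {v : E n → ι → ℝ} {v' v'' : ι → ℝ} (hv : HasPdV s i x v v')
    (hv' : HasPdV s i x v v'') : v' = v'' :=
  funext fun a => (hv a).2.symm.trans (hv' a).2

section Newton

variable [DecidableEq ι] {A B C : E n → Matrix ι ι ℝ}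

theorem SmoothM.polarE3 (hA : SmoothM s A) (hB : SmoothM s B) (hC : SmoothM s C) :
    ContDiffOn ℝ ∞ (fun y => GBC.polarE3 (A y) (B y) (C y)) s := by
  unfold GBC.polarE3
  exact (((((hA.trace.mul hB.trace).mul hC.trace).sub (hA.trace.mul (hB.mul hC).trace)).sub
    (hB.trace.mul (hA.mul hC).trace)).sub (hC.trace.mul (hA.mul hB).trace)).add
    ((hA.mul hB).mul hC).trace |>.add ((hA.mul hC).mul hB).trace

theorem SmoothM.polarNewton (hA : SmoothM s A) (hB : SmoothM s B) (hC : SmoothM s C) :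
    SmoothM s fun y => GBC.polarNewton (A y) (B y) (C y) := by
  unfold GBC.polarNewton
  exact (((SmoothM.smul (hA.polarE3 hB hC) (SmoothM.const 1)).sub
    (((SmoothM.smul ((hB.trace.mul hC.trace).sub (hB.mul hC).trace) hA).add
      (SmoothM.smul ((hA.trace.mul hC.trace).sub (hA.mul hC).trace) hB)).add
      (SmoothM.smul ((hA.trace.mul hB.trace).sub (hA.mul hB).trace) hC))).add
    (((SmoothM.smul hC.trace ((hA.mul hB).add (hB.mul hA))).add
      (SmoothM.smul hB.trace ((hA.mul hC).add (hC.mul hA)))).add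
      (SmoothM.smul hA.trace ((hB.mul hC).add (hC.mul hB))))).sub
    (((((((hA.mul hB).mul hC).add ((hA.mul hC).mul hB)).add ((hB.mul hA).mul hC)).add
      ((hB.mul hC).mul hA)).add ((hC.mul hA).mul hB)).add ((hC.mul hB).mul hA))

end Newton

end PartialDerivatives

end GBC


namespace GBC

/-! ### First and second order geometry of a graph -/

section GraphCalculus

variable {n m : ℕ} {s : Set (E n)} {f : E n → E m} {x : E n}

/-- The Jacobian matrix `(f_i^α)`. -/
noncomputable def jac (s : Set (E n)) (f : E n → E m) (x : E n) : Matrix (Fin m) (Fin n) ℝ :=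
  Matrix.of fun a i => d1 s f a i x

/-- The Hessian matrix `(f_{ij}^α)`. -/
noncomputable def hess (s : Set (E n)) (f : E n → E m) (a : Fin m) (x : E n) :
    Matrix (Fin n) (Fin n) ℝ :=
  Matrix.of fun i j => d2 s f a i j x

/-- The matrices of third derivatives `(f_{jki}^α)_{jk}`. -/
noncomputable def thirdD (s : Set (E n)) (f : E n → E m) (a : Fin m) (i : Fin n) (x : E n) :
    Matrix (Fin n) (Fin n) ℝ :=
  Matrix.of fun j k => d3 s f a j k i x

theorem graphMetric_eq (x : E n) : graphMetric s f x = 1 + (jac s f x)ᵀ * jac s f x := by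
  ext i j
  simp [graphMetric, jac, Matrix.mul_apply]

theorem normalGram_eq (x : E n) : normalGram s f x = 1 + jac s f x * (jac s f x)ᵀ := by
  ext i j
  simp [normalGram, jac, Matrix.mul_apply]

theorem posDef_one_add_transpose_mul {ι κ : Type*} [Fintype ι] [Fintype κ] [DecidableEq κ]
    (F : Matrix ι κ ℝ) : (1 + Fᵀ * F).PosDef := by
  have := Matrix.PosDef.one.add_posSemidef (Matrix.posSemidef_conjTranspose_mul_self F)
  simpa [Matrix.conjTranspose_eq_transpose_of_trivial] using this

theorem graphMetric_posDef (x : E n) : (graphMetric s f x).PosDef := by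
  rw [graphMetric_eq]
  exact posDef_one_add_transpose_mul _

theorem normalGram_posDef (x : E n) : (normalGram s f x).PosDef := by
  rw [normalGram_eq]
  simpa using posDef_one_add_transpose_mul (jac s f x)ᵀ

theorem graphMetric_det_ne_zero (x : E n) : (graphMetric s f x).det ≠ 0 :=
  (graphMetric_posDef x).det_pos.ne'

theorem graphMetric_isUnit (x : E n) : IsUnit (graphMetric s f x).det :=
  (graphMetric_det_ne_zero x).isUnit

theorem graphMetric_transpose (x : E n) : (graphMetric s f x)ᵀ = graphMetric s f x := by
  simp [graphMetric_eq, Matrix.transpose_mul]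

theorem graphMetric_inv_transpose (x : E n) : (graphMetric s f x)⁻¹ᵀ = (graphMetric s f x)⁻¹ := by
  rw [Matrix.transpose_nonsing_inv, graphMetric_transpose]

theorem normalGram_inv_transpose (x : E n) : (normalGram s f x)⁻¹ᵀ = (normalGram s f x)⁻¹ := by
  rw [Matrix.transpose_nonsing_inv]
  simp [normalGram_eq, Matrix.transpose_mul]

/-- The Woodbury identity for 1 + F Fᵀ and 1 + Fᵀ F. Entrywise, U^{ab} = δ_{ab} - ⟨Df^a, ∇f^b⟩,
which is how U enters every derivative formula below. -/
theorem normalGram_inv_eq (x : E n) : (normalGram s f x)⁻¹ =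
    1 - jac s f x * (graphMetric s f x)⁻¹ * (jac s f x)ᵀ := by
  apply Matrix.inv_eq_right_inv
  have h := Matrix.mul_nonsing_inv _ (graphMetric_isUnit (s := s) (f := f) x)
  have h2 : (jac s f x)ᵀ * jac s f x = graphMetric s f x - 1 := by rw [graphMetric_eq]; simp
  rw [normalGram_eq]
  calc (1 + jac s f x * (jac s f x)ᵀ) * (1 - jac s f x * (graphMetric s f x)⁻¹ * (jac s f x)ᵀ)
      = 1 + jac s f x * (jac s f x)ᵀ - jac s f x * (graphMetric s f x)⁻¹ * (jac s f x)ᵀ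
        - jac s f x * ((jac s f x)ᵀ * jac s f x) * (graphMetric s f x)⁻¹ * (jac s f x)ᵀ := by
        simp only [Matrix.add_mul, Matrix.mul_sub, Matrix.one_mul, Matrix.mul_one,
          Matrix.mul_assoc]
        abel
    _ = 1 + jac s f x * (jac s f x)ᵀ
        - jac s f x * (graphMetric s f x * (graphMetric s f x)⁻¹) * (jac s f x)ᵀ := by
        rw [h2]
        simp only [Matrix.sub_mul, Matrix.mul_sub, Matrix.one_mul, Matrix.mul_one,
          Matrix.mul_assoc]
        abel
    _ = 1 := by rw [h]; simp

theorem gradF_eq (a : Fin m) (x : E n) :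
    gradF s f a x = (graphMetric s f x)⁻¹ *ᵥ jac s f x a := rfl

theorem shapeOp_eq (a : Fin m) (x : E n) :
    shapeOp s f a x = (graphMetric s f x)⁻¹ * hess s f a x := rfl

theorem normalGram_inv_apply (a b : Fin m) (x : E n) :
    (normalGram s f x)⁻¹ a b = (1 : Matrix (Fin m) (Fin m) ℝ) a b
      - jac s f x a ⬝ᵥ gradF s f b x := by
  rw [normalGram_inv_eq, gradF_eq, Matrix.sub_apply, Matrix.mul_assoc]
  rfl

section Smooth

variable (hs : UniqueDiffOn ℝ s) (hcl : s ⊆ closure (interior s)) (hf : ContDiffOn ℝ ∞ f s)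
include hs hf

theorem contDiffOn_coord (a : Fin m) : ContDiffOn ℝ ∞ (fun y => f y a) s :=
  contDiffOn_euclidean.1 hf a

theorem contDiffOn_d1 (a : Fin m) (i : Fin n) : ContDiffOn ℝ ∞ (d1 s f a i) s :=
  contDiffOn_pd hs (contDiffOn_euclidean.1 hf a) i

theorem contDiffOn_d2 (a : Fin m) (i j : Fin n) : ContDiffOn ℝ ∞ (d2 s f a i j) s :=
  contDiffOn_pd hs (contDiffOn_d1 hs hf a i) j

theorem smoothM_jac : SmoothM s (jac s f) := fun a i => contDiffOn_d1 hs hf a i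

theorem smoothM_hess (a : Fin m) : SmoothM s (hess s f a) := fun i j => contDiffOn_d2 hs hf a i j

theorem smoothM_graphMetric : SmoothM s (graphMetric s f) := by
  have := (SmoothM.const 1).add ((smoothM_jac hs hf).transpose.mul (smoothM_jac hs hf))
  exact fun i j => (this i j).congr fun y _ => by rw [graphMetric_eq]

theorem smoothM_graphMetric_inv : SmoothM s fun y => (graphMetric s f y)⁻¹ :=
  (smoothM_graphMetric hs hf).inv fun y _ => graphMetric_det_ne_zero y

theorem smoothM_normalGram_inv : SmoothM s fun y => (normalGram s f y)⁻¹ := by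
  have := (SmoothM.const 1).sub (((smoothM_jac hs hf).mul (smoothM_graphMetric_inv hs hf)).mul
    (smoothM_jac hs hf).transpose)
  exact fun i j => (this i j).congr fun y _ => by simp only [normalGram_inv_eq]

theorem smoothM_shapeOp (a : Fin m) : SmoothM s (shapeOp s f a) :=
  (smoothM_graphMetric_inv hs hf).mul (smoothM_hess hs hf a)

theorem smoothV_gradF (a : Fin m) : SmoothV s (gradF s f a) :=
  (smoothM_graphMetric_inv hs hf).mulVec fun i => smoothM_jac hs hf a i

variable (hx : x ∈ s)
include hx

theorem SmoothM.hasPdM {ι κ : Type*} {M : E n → Matrix ι κ ℝ} (hM : SmoothM s M) (i : Fin n) :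
    ∃ M', HasPdM s i x M M' :=
  ⟨Matrix.of fun a b => pd s i (fun y => M y a b) x, fun a b => ⟨(hM a b).diffWithin hx, rfl⟩⟩

theorem hasPdM_jac (i : Fin n) :
    HasPdM s i x (jac s f) (Matrix.of fun a k => hess s f a x k i) :=
  fun a k => ⟨(smoothM_jac hs hf a k).diffWithin hx, rfl⟩

theorem hasPdM_hess (a : Fin m) (i : Fin n) : HasPdM s i x (hess s f a) (thirdD s f a i x) :=
  fun k l => ⟨(smoothM_hess hs hf a k l).diffWithin hx, rfl⟩

theorem hasPdM_graphMetric (i : Fin n) : HasPdM s i x (graphMetric s f)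
    (∑ b, (Matrix.vecMulVec (hess s f b x *ᵥ Pi.single i 1) (jac s f x b)
      + Matrix.vecMulVec (jac s f x b) (hess s f b x *ᵥ Pi.single i 1))) := by
  have h := (HasPdM.const 1).add (hs x hx)
    ((hasPdM_jac hs hf hx i).transpose.mul (hs x hx) (hasPdM_jac hs hf hx i))
  have h2 : graphMetric s f = fun y => 1 + (jac s f y)ᵀ * jac s f y :=
    funext fun y => graphMetric_eq y
  rw [h2]
  refine h.congr_deriv ?_
  ext k l
  simp [Matrix.mul_apply, Matrix.sum_apply, Matrix.vecMulVec_apply, Finset.sum_add_distrib]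

include hcl

theorem hess_transpose (a : Fin m) : (hess s f a x)ᵀ = hess s f a x := by
  ext i j
  exact pd_comm hs hcl (contDiffOn_euclidean.1 hf a) hx i j

theorem thirdD_symm (a : Fin m) (i j k : Fin n) : thirdD s f a i x k j = thirdD s f a j x k i :=
  pd_comm hs hcl (contDiffOn_d1 hs hf a k) hx i j

theorem hess_mulVec_dotProduct (a b : Fin m) (v : Fin n → ℝ) :
    (hess s f b x *ᵥ v) ⬝ᵥ gradF s f a x = (hess s f b x *ᵥ gradF s f a x) ⬝ᵥ v :=
  mulVec_dotProduct_of_symm (hess_transpose hs hcl hf hx b) _ _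

theorem jac_dotProduct_inv_mulVec (a : Fin m) (v : Fin n → ℝ) :
    jac s f x a ⬝ᵥ (graphMetric s f x)⁻¹ *ᵥ v = gradF s f a x ⬝ᵥ v := by
  rw [gradF_eq, mulVec_dotProduct_of_symm (graphMetric_inv_transpose x), dotProduct_comm]

/-- Differentiate g ∇f^a = Df^a and solve, which avoids differentiating g⁻¹. The Hessian of f^a and
the terms with ⟨Df^b, ∇f^a⟩ combine into the coefficient U^{ab}. -/
theorem hasPdV_gradF (a : Fin m) (i : Fin n) : HasPdV s i x (gradF s f a)
    (dGrad (graphMetric s f x)⁻¹ (fun b => hess s f b x) (normalGram s f x)⁻¹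
      (fun b => gradF s f b x) a i) := by
  have hu := graphMetric_isUnit (s := s) (f := f) x
  have hv : HasPdV s i x (gradF s f a) (fun k => pd s i (fun y => gradF s f a y k) x) :=
    fun k => ⟨(smoothV_gradF hs hf a k).diffWithin hx, rfl⟩
  set v' := fun k => pd s i (fun y => gradF s f a y k) x with hv'
  have h1 := (hasPdM_graphMetric hs hf hx i).mulVec (hs x hx) hv
  have h2 : (fun y => graphMetric s f y *ᵥ gradF s f a y) = fun y => jac s f y a := by
    funext y
    rw [gradF_eq, Matrix.mulVec_mulVec, Matrix.mul_nonsing_inv _ (graphMetric_isUnit y),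
      Matrix.one_mulVec]
  rw [h2] at h1
  have h0 : HasPdV s i x (fun y => jac s f y a) (hess s f a x *ᵥ Pi.single i 1) := fun k => by
    rw [Matrix.mulVec_single_one]
    exact hasPdM_jac hs hf hx i a k
  have h3 := h0.unique h1
  have h4 : v' = (graphMetric s f x)⁻¹ *ᵥ (graphMetric s f x *ᵥ v') := by
    rw [Matrix.mulVec_mulVec, Matrix.nonsing_inv_mul _ hu, Matrix.one_mulVec]
  have h5 : v' = dGrad (graphMetric s f x)⁻¹ (fun b => hess s f b x) (normalGram s f x)⁻¹
      (fun b => gradF s f b x) a i := by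
    rw [h4, ← sub_eq_of_eq_add' h3, dGrad, sum_mulVec', Matrix.mulVec_sub, mulVec_sum',
      Finset.sum_sub_distrib]
    have h6 : ∑ b, (normalGram s f x)⁻¹ a b • ((graphMetric s f x)⁻¹ * hess s f b x) *ᵥ
        (Pi.single i 1 : Fin n → ℝ) = (graphMetric s f x)⁻¹ *ᵥ hess s f a x *ᵥ Pi.single i 1
        - ∑ b, (jac s f x b ⬝ᵥ gradF s f a x) • ((graphMetric s f x)⁻¹ * hess s f b x) *ᵥ
          (Pi.single i 1 : Fin n → ℝ) := by
      have : ∀ b, (normalGram s f x)⁻¹ a b = (normalGram s f x)⁻¹ b a := fun b => by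
        conv_lhs => rw [← normalGram_inv_transpose, Matrix.transpose_apply]
      simp only [this, normalGram_inv_apply, sub_smul, Finset.sum_sub_distrib, Matrix.one_apply]
      simp only [ite_smul, zero_smul, one_smul, Finset.sum_ite_eq', Finset.mem_univ, if_true,
        Matrix.mulVec_mulVec]
    rw [h6, sub_sub, ← Finset.sum_add_distrib]
    congr 1
    refine Finset.sum_congr rfl fun b _ => ?_
    rw [Matrix.add_mulVec, vecMulVec_mulVec_eq_smul, vecMulVec_mulVec_eq_smul, Matrix.mulVec_add,
      Matrix.mulVec_smul, Matrix.mulVec_smul, Matrix.mulVec_mulVec,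
      hess_mulVec_dotProduct hs hcl hf hx, gradF_eq b]
  rwa [h5] at hv

/-- The same device applied to g A^a = D²f^a. -/
theorem hasPdM_shapeOp (a : Fin m) (i : Fin n) : HasPdM s i x (shapeOp s f a)
    (dShape (graphMetric s f x)⁻¹ (fun b => hess s f b x) (fun b i => thirdD s f b i x)
      (fun b => gradF s f b x) a i) := by
  have hu := graphMetric_isUnit (s := s) (f := f) x
  obtain ⟨A', hA'⟩ := SmoothM.hasPdM hs hf hx (smoothM_shapeOp hs hf a) i
  have h1 := (hasPdM_graphMetric hs hf hx i).mul (hs x hx) hA'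
  have h2 : (fun y => graphMetric s f y * shapeOp s f a y) = hess s f a := by
    funext y
    rw [shapeOp_eq, ← Matrix.mul_assoc, Matrix.mul_nonsing_inv _ (graphMetric_isUnit y),
      Matrix.one_mul]
  rw [h2] at h1
  have h3 := h1.unique (hasPdM_hess hs hf hx a i)
  have h4 : A' = (graphMetric s f x)⁻¹ * (graphMetric s f x * A') := by
    rw [← Matrix.mul_assoc, Matrix.nonsing_inv_mul _ hu, Matrix.one_mul]
  refine hA'.congr_deriv ?_
  have hS := hess_transpose hs hcl hf hx
  have hgi := graphMetric_inv_transpose (s := s) (f := f) x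
  have hA : (shapeOp s f a x)ᵀ = hess s f a x * (graphMetric s f x)⁻¹ := by
    rw [shapeOp_eq, Matrix.transpose_mul, hgi, hS]
  rw [h4, ← sub_eq_of_eq_add' h3.symm, dShape, Matrix.mul_sub, Matrix.sum_mul, Matrix.mul_sum]
  congr 1
  refine Finset.sum_congr rfl fun b _ => ?_
  rw [Matrix.add_mul, Matrix.mul_add, Matrix.vecMulVec_mul, Matrix.vecMulVec_mul,
    ← Matrix.mulVec_transpose, ← Matrix.mulVec_transpose, hA, Matrix.mul_vecMulVec,
    Matrix.mul_vecMulVec, gradF_eq, Matrix.mulVec_mulVec, Matrix.mulVec_mulVec,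
    Matrix.mulVec_mulVec, Matrix.mul_assoc]

theorem hasPd_normalGram_inv (p q : Fin m) (i : Fin n) :
    HasPd s i x (fun y => (normalGram s f y)⁻¹ p q)
      (dGramInv (fun b => hess s f b x) (normalGram s f x)⁻¹ (fun b => gradF s f b x) i p q) := by
  refine ⟨(smoothM_normalGram_inv hs hf p q).diffWithin hx, ?_⟩
  have h1 : HasPd s i x (fun y => ∑ k, jac s f y p k * gradF s f q y k) _ :=
    HasPd.sum (hs x hx) fun k _ => (hasPdM_jac hs hf hx i p k).mul (hs x hx)
      (hasPdV_gradF hs hcl hf hx q i k)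
  have h2 := (HasPd.const ((1 : Matrix (Fin m) (Fin m) ℝ) p q)).sub (hs x hx) h1
  have h3 : (fun y => (normalGram s f y)⁻¹ p q) = fun y => (1 : Matrix (Fin m) (Fin m) ℝ) p q
      - ∑ k, jac s f y p k * gradF s f q y k := funext fun y => normalGram_inv_apply p q y
  rw [h3, h2.2, Finset.sum_add_distrib]
  have h4 : ∑ k, (Matrix.of fun a k => hess s f a x k i) p k * gradF s f q x k
      = (hess s f p x *ᵥ gradF s f q x) ⬝ᵥ Pi.single i 1 := by
    rw [← hess_mulVec_dotProduct hs hcl hf hx, Matrix.mulVec_single_one]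
    rfl
  have h5 : ∑ k, jac s f x p k * dGrad (graphMetric s f x)⁻¹ (fun b => hess s f b x)
      (normalGram s f x)⁻¹ (fun b => gradF s f b x) q i k
      = ∑ b, ((normalGram s f x)⁻¹ b q * ((hess s f b x *ᵥ gradF s f p x) ⬝ᵥ Pi.single i 1)
        - ((hess s f b x *ᵥ gradF s f q x) ⬝ᵥ Pi.single i 1)
          * ((1 : Matrix (Fin m) (Fin m) ℝ) p b - (normalGram s f x)⁻¹ p b)) := by
    change jac s f x p ⬝ᵥ _ = _
    rw [dGrad, dotProduct_sum']
    refine Finset.sum_congr rfl fun b _ => ?_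
    rw [dotProduct_sub, dotProduct_smul, dotProduct_smul, ← Matrix.mulVec_mulVec,
      jac_dotProduct_inv_mulVec hs hcl hf hx, dotProduct_comm, hess_mulVec_dotProduct hs hcl hf hx,
      normalGram_inv_apply p b, sub_sub_cancel, smul_eq_mul, smul_eq_mul]
    conv_lhs => rw [← normalGram_inv_transpose, Matrix.transpose_apply]
  rw [h4, h5, dGramInv]
  simp only [Finset.sum_sub_distrib, mul_sub, Finset.sum_add_distrib, Matrix.one_apply]
  simp only [mul_ite, mul_one, mul_zero, Finset.sum_ite_eq, Finset.mem_univ, if_true,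
    mul_comm ((normalGram s f x)⁻¹ p _)]
  ring

end Smooth

end GraphCalculus

end GBC


namespace GBC

/-! ### Curvature of the graph and divergence of the mass field -/

section GraphCurvature

variable {n m : ℕ} {s : Set (E n)} {f : E n → E m} {x : E n}

/-- The vector field `P^{ijkl} ∂ₗ g_{jk}` of the graph. -/
noncomputable def massField (s : Set (E n)) (f : E n → E m) (i : Fin n) (x : E n) : ℝ :=
  ∑ j, ∑ k, ∑ l, tensorP s (graphMetric s f) i j k l x * pd s l (fun y => graphMetric s f y j k) x

/-- The field `P^{ijkl} ∂ₗ g_{jk}` in terms of shape operators. -/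
noncomputable def newtonField (s : Set (E n)) (f : E n → E m) (x : E n) : Fin n → ℝ :=
  (1 / 2 : ℝ) • ∑ a, ∑ p, ∑ q, (normalGram s f x)⁻¹ p q •
    (polarNewton (shapeOp s f a x) (shapeOp s f p x) (shapeOp s f q x) *ᵥ gradF s f a x)

variable (hs : UniqueDiffOn ℝ s) (hcl : s ⊆ closure (interior s)) (hf : ContDiffOn ℝ ∞ f s)
include hs hf

theorem smoothV_newtonField : SmoothV s (newtonField s f) := fun i => by
  have : (fun y => newtonField s f y i) = fun y => (1 / 2 : ℝ) * ∑ a, ∑ p, ∑ q,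
      (normalGram s f y)⁻¹ p q * (polarNewton (shapeOp s f a y) (shapeOp s f p y)
        (shapeOp s f q y) *ᵥ gradF s f a y) i := by
    funext y
    simp [newtonField, Finset.sum_apply]
  rw [this]
  exact contDiffOn_const.mul (ContDiffOn.sum fun a _ => ContDiffOn.sum fun p _ =>
    ContDiffOn.sum fun q _ => (smoothM_normalGram_inv hs hf p q).mul
      ((((smoothM_shapeOp hs hf a).polarNewton (smoothM_shapeOp hs hf p)
        (smoothM_shapeOp hs hf q)).mulVec (smoothV_gradF hs hf a)) i))

variable (hx : x ∈ s)
include hx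

theorem pd_graphMetric (i j k : Fin n) : pd s i (fun y => graphMetric s f y j k) x =
    ∑ a, (hess s f a x j i * jac s f x a k + jac s f x a j * hess s f a x k i) := by
  rw [(hasPdM_graphMetric hs hf hx i j k).2]
  simp [Matrix.sum_apply, Matrix.vecMulVec_apply]

include hcl

theorem hess_symm (a : Fin m) (i j : Fin n) : hess s f a x i j = hess s f a x j i := by
  conv_lhs => rw [← hess_transpose hs hcl hf hx a, Matrix.transpose_apply]

/-- Of the six terms f_{··} f_· in the Koszul combination, four cancel in pairs and the other two
are equal. -/
theorem christoffel_graphMetric (i j k : Fin n) :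
    christoffel s (graphMetric s f) i j k x = ∑ a, hess s f a x i j * gradF s f a x k := by
  have h (l : Fin n) : pd s i (fun y => graphMetric s f y j l) x
      + pd s j (fun y => graphMetric s f y i l) x - pd s l (fun y => graphMetric s f y i j) x
      = 2 * ∑ a, hess s f a x i j * jac s f x a l := by
    simp only [pd_graphMetric hs hf hx, ← Finset.sum_add_distrib, ← Finset.sum_sub_distrib,
      Finset.mul_sum]
    refine Finset.sum_congr rfl fun a _ => ?_
    rw [hess_symm hs hcl hf hx a j i, hess_symm hs hcl hf hx a l i, hess_symm hs hcl hf hx a l j]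
    ring
  simp only [christoffel, h, gradF_eq, Matrix.mulVec, dotProduct, Finset.mul_sum]
  rw [Finset.sum_comm]
  exact Finset.sum_congr rfl fun a _ => Finset.sum_congr rfl fun l _ => by ring

/-- The derivative of the Christoffel symbols, with the upper index lowered. -/
theorem sum_graphMetric_mul_pd_christoffel (i j l k : Fin n) :
    ∑ a, graphMetric s f x k a * pd s i (christoffel s (graphMetric s f) j l a) x =
      ∑ a, thirdD s f a i x j l * jac s f x a k
        + ∑ p, ∑ q, (normalGram s f x)⁻¹ p q * (hess s f q x k i * hess s f p x j l)
        - ∑ p, ∑ q, hess s f p x j l * ((hess s f q x *ᵥ gradF s f p x) i * jac s f x q k) := by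
  have h1 (a : Fin n) : pd s i (christoffel s (graphMetric s f) j l a) x =
      ∑ b, (thirdD s f b i x j l * gradF s f b x a + hess s f b x j l *
        dGrad (graphMetric s f x)⁻¹ (fun b => hess s f b x) (normalGram s f x)⁻¹
          (fun b => gradF s f b x) b i a) := by
    rw [pd_congr (fun y hy => christoffel_graphMetric hs hcl hf hy j l a) hx]
    exact (HasPd.sum (hs x hx) fun b _ => (hasPdM_hess hs hf hx b i j l).mul (hs x hx)
      (hasPdV_gradF hs hcl hf hx b i a)).2
  have h2 (v : Fin n → ℝ) : ∑ a, graphMetric s f x k a * v a = (graphMetric s f x *ᵥ v) k := rfl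
  have h3 (v : Fin n → ℝ) : graphMetric s f x *ᵥ (graphMetric s f x)⁻¹ *ᵥ v = v := by
    rw [Matrix.mulVec_mulVec, Matrix.mul_nonsing_inv _ (graphMetric_isUnit x), Matrix.one_mulVec]
  have h4 (b : Fin m) : graphMetric s f x *ᵥ gradF s f b x = jac s f x b := h3 _
  have h5 : (fun a => pd s i (christoffel s (graphMetric s f) j l a) x) =
      ∑ b, (thirdD s f b i x j l • gradF s f b x + hess s f b x j l •
        dGrad (graphMetric s f x)⁻¹ (fun b => hess s f b x) (normalGram s f x)⁻¹
          (fun b => gradF s f b x) b i) := by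
    funext a
    rw [h1]
    simp [Finset.sum_apply]
  rw [h2 (fun a => pd s i (christoffel s (graphMetric s f) j l a) x), h5]
  simp only [dGrad, mulVec_sum', Matrix.mulVec_add, Matrix.mulVec_sub, Matrix.mulVec_smul, h4,
    ← Matrix.mulVec_mulVec, h3, Finset.sum_apply, Pi.add_apply, Pi.smul_apply, Pi.sub_apply,
    smul_eq_mul, Finset.sum_add_distrib, dotProduct_single_one, Finset.mul_sum, mul_sub,
    Finset.sum_sub_distrib]
  rw [add_sub_assoc]
  congr 2
  refine Finset.sum_congr rfl fun p _ => Finset.sum_congr rfl fun q _ => ?_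
  rw [Matrix.mulVec_single_one]
  simp only [Matrix.col_apply]
  ring

/-- With the upper index lowered, ∂Γ splits into third derivatives, a term quadratic in Hessians
with weight U, and a tangential term. The first cancels on antisymmetrising in i, j, the last
cancels against ΓΓ, and the weight-U term is the Gauss equation. -/
theorem gaussEq_graphMetric :
    GaussEq s (graphMetric s f) x (normalGram s f x)⁻¹ fun a => hess s f a x := by
  intro i j k l
  have hquad (i j : Fin n) : ∑ a, graphMetric s f x k a *
      ∑ t, christoffel s (graphMetric s f) j l t x * christoffel s (graphMetric s f) i t a x
      = ∑ p, ∑ q, hess s f p x j l * ((hess s f q x *ᵥ gradF s f p x) i * jac s f x q k) := by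
    have h1 (q : Fin m) : ∑ a, graphMetric s f x k a * gradF s f q x a = jac s f x q k := by
      change (graphMetric s f x *ᵥ gradF s f q x) k = _
      rw [gradF_eq, Matrix.mulVec_mulVec, Matrix.mul_nonsing_inv _ (graphMetric_isUnit x),
        Matrix.one_mulVec]
    have h2 : ∀ a, ∑ t, christoffel s (graphMetric s f) j l t x
        * christoffel s (graphMetric s f) i t a x
        = ∑ p, ∑ q, hess s f p x j l * ((hess s f q x *ᵥ gradF s f p x) i * gradF s f q x a) := by
      intro a
      simp only [christoffel_graphMetric hs hcl hf hx, Finset.sum_mul_sum]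
      rw [Finset.sum_comm]
      refine Finset.sum_congr rfl fun p _ => ?_
      rw [Finset.sum_comm]
      refine Finset.sum_congr rfl fun q _ => ?_
      simp only [Matrix.mulVec, dotProduct, Finset.sum_mul, Finset.mul_sum]
      exact Finset.sum_congr rfl fun t _ => by ring
    simp only [h2, ← h1, Finset.mul_sum]
    rw [Finset.sum_comm]
    refine Finset.sum_congr rfl fun p _ => ?_
    rw [Finset.sum_comm]
    exact Finset.sum_congr rfl fun q _ => Finset.sum_congr rfl fun a _ => by ring
  have hT (a : Fin m) : thirdD s f a i x j l = thirdD s f a j x i l := by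
    have h (i j : Fin n) : thirdD s f a i x j l = thirdD s f a i x l j := by
      have e : Set.EqOn (d2 s f a j l) (d2 s f a l j) s := fun y hy =>
        hess_symm hs hcl hf hy a j l
      exact pd_congr e hx i
    rw [h i j, h j i, thirdD_symm hs hcl hf hx]
  simp only [riem, mul_add, mul_sub, Finset.sum_add_distrib, Finset.sum_sub_distrib, hquad,
    sum_graphMetric_mul_pd_christoffel hs hcl hf hx, hT]
  have hU : ∀ p q, (normalGram s f x)⁻¹ q p = (normalGram s f x)⁻¹ p q := fun p q => by
    conv_lhs => rw [← normalGram_inv_transpose, Matrix.transpose_apply]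
  have e1 : ∑ p, ∑ q, (normalGram s f x)⁻¹ p q * (hess s f p x i k * hess s f q x j l)
      = ∑ p, ∑ q, (normalGram s f x)⁻¹ p q * (hess s f q x k i * hess s f p x j l) := by
    rw [Finset.sum_comm]
    refine Finset.sum_congr rfl fun p _ => Finset.sum_congr rfl fun q _ => ?_
    rw [hU, hess_symm hs hcl hf hx q i k]
  have e2 : ∑ p, ∑ q, (normalGram s f x)⁻¹ p q * (hess s f p x i l * hess s f q x j k)
      = ∑ p, ∑ q, (normalGram s f x)⁻¹ p q * (hess s f q x k j * hess s f p x i l) := by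
    refine Finset.sum_congr rfl fun p _ => Finset.sum_congr rfl fun q _ => ?_
    rw [hess_symm hs hcl hf hx q j k]
    ring
  rw [e1, e2]
  ring

/-- Since ∂_l g_{jk} = f_{jl} f_k + f_j f_{kl} and P is antisymmetric in k, l, the second term drops
out. The first contracts P with a Hessian in the slots j, l, which produces the Newton tensor. -/
theorem massField_eq (i : Fin n) : massField s f i x = newtonField s f x i := by
  have hG := gaussEq_graphMetric hs hcl hf hx
  have hgi := graphMetric_inv_transpose (s := s) (f := f) x
  have hS := hess_transpose hs hcl hf hx
  have hU := normalGram_inv_transpose (s := s) (f := f) x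
  have h0 (j : Fin n) (a : Fin m) :
      ∑ k, ∑ l, tensorP s (graphMetric s f) i j k l x * hess s f a x k l = 0 := by
    have : ∑ k, ∑ l, tensorP s (graphMetric s f) i j k l x * hess s f a x k l
        = - ∑ k, ∑ l, tensorP s (graphMetric s f) i j k l x * hess s f a x k l := by
      conv_lhs => rw [Finset.sum_comm]
      simp only [← Finset.sum_neg_distrib]
      refine Finset.sum_congr rfl fun k _ => Finset.sum_congr rfl fun l _ => ?_
      rw [hG.tensorP_antisymm hgi, hess_symm hs hcl hf hx a l k]
      ring
    linarith
  have h1 : massField s f i x = ∑ a, ∑ k,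
      (∑ j, ∑ l, tensorP s (graphMetric s f) i j k l x * hess s f a x j l) * jac s f x a k := by
    have e (j : Fin n) : ∑ k, ∑ l, tensorP s (graphMetric s f) i j k l x *
          pd s l (fun y => graphMetric s f y j k) x
        = ∑ a, ∑ k, ∑ l, tensorP s (graphMetric s f) i j k l x * hess s f a x j l
          * jac s f x a k := by
      have e2 : ∑ k, ∑ l, tensorP s (graphMetric s f) i j k l x *
          pd s l (fun y => graphMetric s f y j k) x
        = ∑ a, ∑ k, ∑ l, tensorP s (graphMetric s f) i j k l x * hess s f a x j l
          * jac s f x a k + ∑ a, jac s f x a j *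
            ∑ k, ∑ l, tensorP s (graphMetric s f) i j k l x * hess s f a x k l := by
        simp only [pd_graphMetric hs hf hx, ← Finset.sum_add_distrib, Finset.mul_sum]
        rw [Finset.sum_comm' (t' := Finset.univ) (s' := fun _ => Finset.univ) (by simp)]
        rw [Finset.sum_comm]
        conv_rhs => rw [Finset.sum_comm]
        refine Finset.sum_congr rfl fun k _ => ?_
        rw [Finset.sum_comm]
        exact Finset.sum_congr rfl fun a _ => Finset.sum_congr rfl fun l _ => by ring
      rw [e2]
      simp [h0]
    simp only [massField, e]
    rw [Finset.sum_comm]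
    refine Finset.sum_congr rfl fun a _ => ?_
    rw [Finset.sum_comm]
    simp only [Finset.sum_mul]
  rw [h1]
  simp only [hG.sum_tensorP_mul hgi hS hU _ (hS _)]
  change ∑ a, (((1 / 2 : ℝ) • ∑ p, ∑ q, (normalGram s f x)⁻¹ p q •
    (polarNewton ((graphMetric s f x)⁻¹ * hess s f a x) ((graphMetric s f x)⁻¹ * hess s f p x)
      ((graphMetric s f x)⁻¹ * hess s f q x) * (graphMetric s f x)⁻¹)) *ᵥ jac s f x a) i = _
  simp only [newtonField, ← shapeOp_eq, Matrix.smul_mulVec, sum_mulVec', gradF_eq,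
    Matrix.mulVec_mulVec, Pi.smul_apply, Finset.sum_apply, smul_eq_mul, Finset.mul_sum]

/-- Insert the Gauss equation for R in P^{ijkl} R_{ijkl}. Its two terms contribute equally by
antisymmetry of P in k, l, and this 2 absorbs the ½ in the contraction formula for P. -/
theorem gaussBonnet_eq : gaussBonnet s (graphMetric s f) x =
    ∑ a, ∑ b, ∑ p, ∑ q, (normalGram s f x)⁻¹ a b * (normalGram s f x)⁻¹ p q *
      (polarNewton (shapeOp s f a x) (shapeOp s f p x) (shapeOp s f q x) * shapeOp s f b x).trace
      := by
  have hG := gaussEq_graphMetric hs hcl hf hx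
  have hgi := graphMetric_inv_transpose (s := s) (f := f) x
  have hS := hess_transpose hs hcl hf hx
  have hU := normalGram_inv_transpose (s := s) (f := f) x
  set P := tensorP s (graphMetric s f) with hP
  have h1 (a b : Fin m) : ∑ i, ∑ j, ∑ k, ∑ l, P i j k l x *
      (hess s f b x i k * hess s f a x j l - hess s f b x i l * hess s f a x j k)
      = ∑ p, ∑ q, (normalGram s f x)⁻¹ p q *
      (polarNewton (shapeOp s f a x) (shapeOp s f p x) (shapeOp s f q x) * shapeOp s f b x).trace
      := by
    have e1 : ∑ i, ∑ j, ∑ k, ∑ l, P i j k l x *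
      (hess s f b x i k * hess s f a x j l - hess s f b x i l * hess s f a x j k) =
      2 * ∑ i, ∑ k, (∑ j, ∑ l, P i j k l x * hess s f a x j l) * hess s f b x i k := by
      have e2 (i : Fin n) : ∑ j, ∑ k, ∑ l, P i j k l x *
          (hess s f b x i l * hess s f a x j k)
          = - ∑ j, ∑ k, ∑ l, P i j k l x * (hess s f b x i k * hess s f a x j l) := by
        rw [← Finset.sum_neg_distrib]
        refine Finset.sum_congr rfl fun j _ => ?_
        rw [Finset.sum_comm, ← Finset.sum_neg_distrib]
        refine Finset.sum_congr rfl fun l _ => ?_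
        rw [← Finset.sum_neg_distrib]
        refine Finset.sum_congr rfl fun k _ => ?_
        rw [hP, hG.tensorP_antisymm hgi]
        ring
      have e3 (i : Fin n) : ∑ k, (∑ j, ∑ l, P i j k l x * hess s f a x j l) * hess s f b x i k
          = ∑ j, ∑ k, ∑ l, P i j k l x * (hess s f b x i k * hess s f a x j l) := by
        simp only [Finset.sum_mul]
        rw [Finset.sum_comm]
        exact Finset.sum_congr rfl fun j _ => Finset.sum_congr rfl fun k _ =>
          Finset.sum_congr rfl fun l _ => by ring
      simp only [mul_sub, Finset.sum_sub_distrib, e2, e3, Finset.sum_neg_distrib]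
      ring
    rw [e1]
    simp only [hP, hG.sum_tensorP_mul hgi hS hU _ (hS _)]
    rw [sum_mul_eq_trace _ _ (hS b)]
    simp only [← shapeOp_eq, Matrix.smul_mul, Matrix.sum_mul, Matrix.trace_smul, Matrix.trace_sum,
      smul_eq_mul, Matrix.mul_assoc]
    ring
  have h2 : gaussBonnet s (graphMetric s f) x = ∑ b, ∑ a, (normalGram s f x)⁻¹ b a *
      ∑ i, ∑ j, ∑ k, ∑ l, P i j k l x *
      (hess s f b x i k * hess s f a x j l - hess s f b x i l * hess s f a x j k) := by
    have := sum_mul_sum_sum_comm (ι := Fin n × Fin n × Fin n × Fin n)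
      (fun y => P y.1 y.2.1 y.2.2.1 y.2.2.2 x) (fun p q => (normalGram s f x)⁻¹ p q)
      (fun p q y => hess s f p x y.1 y.2.2.1 * hess s f q x y.2.1 y.2.2.2
        - hess s f p x y.1 y.2.2.2 * hess s f q x y.2.1 y.2.2.1)
    simp only [Fintype.sum_prod_type] at this
    simp only [gaussBonnet, hG _ _ _ _]
    exact this
  rw [h2, Finset.sum_comm]
  refine Finset.sum_congr rfl fun a _ => Finset.sum_congr rfl fun b _ => ?_
  rw [h1]
  simp only [Finset.mul_sum, mul_assoc]
  have hUab : (normalGram s f x)⁻¹ b a = (normalGram s f x)⁻¹ a b := by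
    conv_lhs => rw [← normalGram_inv_transpose, Matrix.transpose_apply]
  rw [hUab]

theorem hasPdV_newtonField (i : Fin n) : HasPdV s i x (newtonField s f) ((1 / 2 : ℝ) •
    ∑ a, ∑ p, ∑ q,
      (dGramInv (fun b => hess s f b x) (normalGram s f x)⁻¹ (fun b => gradF s f b x) i p q •
        (polarNewton (shapeOp s f a x) (shapeOp s f p x) (shapeOp s f q x) *ᵥ gradF s f a x)
      + (normalGram s f x)⁻¹ p q •
        ((polarNewton (dShape (graphMetric s f x)⁻¹ (fun b => hess s f b x)
            (fun b i => thirdD s f b i x) (fun b => gradF s f b x) a i)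
              (shapeOp s f p x) (shapeOp s f q x)
          + polarNewton (shapeOp s f a x) (dShape (graphMetric s f x)⁻¹ (fun b => hess s f b x)
            (fun b i => thirdD s f b i x) (fun b => gradF s f b x) p i) (shapeOp s f q x)
          + polarNewton (shapeOp s f a x) (shapeOp s f p x)
            (dShape (graphMetric s f x)⁻¹ (fun b => hess s f b x)
            (fun b i => thirdD s f b i x) (fun b => gradF s f b x) q i)) *ᵥ gradF s f a x
        + polarNewton (shapeOp s f a x) (shapeOp s f p x) (shapeOp s f q x) *ᵥ
          dGrad (graphMetric s f x)⁻¹ (fun b => hess s f b x) (normalGram s f x)⁻¹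
            (fun b => gradF s f b x) a i))) := by
  intro k
  have hsx := hs x hx
  have h := (HasPd.const (1 / 2 : ℝ)).mul hsx <|
    HasPd.sum (t := Finset.univ) hsx fun (a : Fin m) _ =>
    HasPd.sum (t := Finset.univ) hsx fun (p : Fin m) _ =>
    HasPd.sum (t := Finset.univ) hsx fun (q : Fin m) _ =>
      (hasPd_normalGram_inv hs hcl hf hx p q i).mul hsx
        (((HasPdM.polarNewton hsx (hasPdM_shapeOp hs hcl hf hx a i)
          (hasPdM_shapeOp hs hcl hf hx p i) (hasPdM_shapeOp hs hcl hf hx q i)).mulVec hsx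
          (hasPdV_gradF hs hcl hf hx a i)) k)
  have e : (fun y => newtonField s f y k) = fun y => (1 / 2 : ℝ) * ∑ a, ∑ p, ∑ q,
      (normalGram s f y)⁻¹ p q * (polarNewton (shapeOp s f a y) (shapeOp s f p y)
        (shapeOp s f q y) *ᵥ gradF s f a y) k := by
    funext y
    simp [newtonField, Finset.sum_apply]
  rw [e]
  convert h using 1
  simp [Finset.sum_apply, mul_add]

theorem graphMetric_mul_shapeOp (a : Fin m) : graphMetric s f x * shapeOp s f a x = hess s f a x := by
  rw [shapeOp_eq, ← Matrix.mul_assoc, Matrix.mul_nonsing_inv _ (graphMetric_isUnit x),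
    Matrix.one_mul]

theorem ricciOp_eq : ricciOp s f x = ∑ p, ∑ q, (normalGram s f x)⁻¹ p q •
    ((shapeOp s f p x).trace • shapeOp s f q x - shapeOp s f p x * shapeOp s f q x) := by
  have hG := gaussEq_graphMetric hs hcl hf hx
  have hgi := graphMetric_inv_transpose (s := s) (f := f) x
  have hU := normalGram_inv_transpose (s := s) (f := f) x
  rw [ricciOp, hG.ric_eq hgi (hess_transpose hs hcl hf hx)]
  simp only [Matrix.mul_sum, Matrix.mul_smul, Matrix.mul_sub]
  refine sum_smul_symm _ hU _ _ fun p q => ?_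
  simp only [shapeOp_eq, Matrix.mul_assoc]
  abel

theorem scal_eq : scal s (graphMetric s f) x = ∑ p, ∑ q, (normalGram s f x)⁻¹ p q *
    ((shapeOp s f p x).trace * (shapeOp s f q x).trace
      - (shapeOp s f p x * shapeOp s f q x).trace) :=
  (gaussEq_graphMetric hs hcl hf hx).scal_eq (graphMetric_inv_transpose x)
    (hess_transpose hs hcl hf hx)

/-- The right side is the remainder left by the divergence of twice the mass field. It matches L₂^⊥
only after symmetrising over the dummy pair a, c and over p, q, the latter allowed because U is
symmetric. -/
theorem gaussBonnetPerp_eq : gaussBonnetPerp s f x =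
    ∑ a, ∑ c, ∑ p, ∑ q, (normalGram s f x)⁻¹ p q *
      (- ∑ i, ((Pi.single i 1 : Fin n → ℝ) ⬝ᵥ polarNewton (Matrix.vecMulVec (gradF s f c x)
          ((hess s f a x * shapeOp s f c x) *ᵥ Pi.single i 1)) (shapeOp s f p x)
            (shapeOp s f q x) *ᵥ gradF s f a x)
      - 2 * ∑ i, ((Pi.single i 1 : Fin n → ℝ) ⬝ᵥ polarNewton (Matrix.vecMulVec (gradF s f c x)
          ((hess s f p x * shapeOp s f c x) *ᵥ Pi.single i 1)) (shapeOp s f a x)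
            (shapeOp s f q x) *ᵥ gradF s f a x)) := by
  have hU := normalGram_inv_transpose (s := s) (f := f) x
  have hg := graphMetric_transpose (s := s) (f := f) x
  let g := graphMetric s f x
  let E : Matrix (Fin n) (Fin n) ℝ → Matrix (Fin n) (Fin n) ℝ → Matrix (Fin n) (Fin n) ℝ →
      Matrix (Fin n) (Fin n) ℝ → (Fin n → ℝ) → (Fin n → ℝ) → ℝ := fun a c p q x y =>
      - ∑ i, ((Pi.single i 1 : Fin n → ℝ) ⬝ᵥ
        polarNewton (Matrix.vecMulVec y ((g * a * c) *ᵥ Pi.single i 1)) p q *ᵥ x)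
      - 2 * ∑ i, ((Pi.single i 1 : Fin n → ℝ) ⬝ᵥ
        polarNewton (Matrix.vecMulVec y ((g * p * c) *ᵥ Pi.single i 1)) a q *ᵥ x)
  -- `W` is the coefficient of U^{pq} in ½ L₂^⊥, once Rc, T^⊥ and R are expanded by the Gauss
  -- equation.
  let W : Matrix (Fin n) (Fin n) ℝ → Matrix (Fin n) (Fin n) ℝ → Matrix (Fin n) (Fin n) ℝ →
      Matrix (Fin n) (Fin n) ℝ → (Fin n → ℝ) → (Fin n → ℝ) → ℝ := fun a c p q x y =>
      y ⬝ᵥ g *ᵥ (p * (q * (c * a - a * c) + (c * q - q * c) * a - (a * q - q * a) * c)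
        + (a * p).trace • (q * c - c * q)) *ᵥ x
      - y ⬝ᵥ g *ᵥ ((2 : ℝ) • ((p.trace • q - p * q) * (c * a - a * c))
        + (p.trace • (c * q - q * c) + (p * c - c * p) * q + p * (q * c - c * q)) * a
        + a * (p.trace • (c * q - q * c) + (p * c - c * p) * q + p * (q * c - c * q))) *ᵥ x
      + a.trace * (y ⬝ᵥ g *ᵥ
          (p.trace • (c * q - q * c) + (p * c - c * p) * q + p * (q * c - c * q)) *ᵥ x)
      + (1 / 2) * (p.trace * q.trace - (p * q).trace) * (y ⬝ᵥ g *ᵥ (c * a - a * c) *ᵥ x)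
  let A := fun a => shapeOp s f a x
  let φ := fun a => gradF s f a x
  have hA (a : Fin m) : g * A a = hess s f a x := graphMetric_mul_shapeOp hs hcl hf hx a
  have hsym : ∀ a c p q, E (A a) (A c) (A p) (A q) (φ a) (φ c) + E (A c) (A a) (A p) (A q) (φ c) (φ a)
      + E (A a) (A c) (A q) (A p) (φ a) (φ c) + E (A c) (A a) (A q) (A p) (φ c) (φ a) =
      2 * (W (A a) (A c) (A p) (A q) (φ a) (φ c) + W (A c) (A a) (A p) (A q) (φ c) (φ a)
      + W (A a) (A c) (A q) (A p) (φ a) (φ c) + W (A c) (A a) (A q) (A p) (φ c) (φ a)) := by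
    intro a c p q
    refine remainder_symmetrized g (A a) (A c) (A p) (A q) (φ a) (φ c) hg ?_ ?_ ?_ ?_ E W
      (fun _ _ _ _ _ _ => rfl) (fun _ _ _ _ _ _ => rfl) <;>
    rw [hA, hess_transpose hs hcl hf hx]
  have hEW : ∑ a, ∑ c, ∑ p, ∑ q, (normalGram s f x)⁻¹ p q * E (A a) (A c) (A p) (A q) (φ a) (φ c)
      = ∑ a, ∑ c, ∑ p, ∑ q, (normalGram s f x)⁻¹ p q *
        (2 * W (A a) (A c) (A p) (A q) (φ a) (φ c)) := by
    -- The four relabelled copies have the same sum, hence the factor 4.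
    have key (T : Fin m → Fin m → Fin m → Fin m → ℝ) :
        4 * ∑ a, ∑ c, ∑ p, ∑ q, (normalGram s f x)⁻¹ p q * T a c p q =
        ∑ a, ∑ c, ∑ p, ∑ q, (normalGram s f x)⁻¹ p q *
          (T a c p q + T c a p q + T a c q p + T c a q p) := by
      have k1 : ∑ a, ∑ c, ∑ p, ∑ q, (normalGram s f x)⁻¹ p q * T c a p q
          = ∑ a, ∑ c, ∑ p, ∑ q, (normalGram s f x)⁻¹ p q * T a c p q := Finset.sum_comm
      have k2 (a c : Fin m) : ∑ p, ∑ q, (normalGram s f x)⁻¹ p q * T a c q p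
          = ∑ p, ∑ q, (normalGram s f x)⁻¹ p q * T a c p q := by
        rw [Finset.sum_comm]
        refine Finset.sum_congr rfl fun p _ => Finset.sum_congr rfl fun q _ => ?_
        conv_lhs => rw [← hU, Matrix.transpose_apply]
      simp only [mul_add, Finset.sum_add_distrib, k2, k1]
      ring
    have h4 := (key fun a c p q => E (A a) (A c) (A p) (A q) (φ a) (φ c)).trans
      ((by
        refine Finset.sum_congr rfl fun a _ => Finset.sum_congr rfl fun c _ =>
          Finset.sum_congr rfl fun p _ => Finset.sum_congr rfl fun q _ => ?_
        rw [hsym]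
        ring : _ = _).trans
        (key fun a c p q => 2 * W (A a) (A c) (A p) (A q) (φ a) (φ c)).symm)
    linarith
  have hrhs : ∑ a, ∑ c, ∑ p, ∑ q, (normalGram s f x)⁻¹ p q *
      (- ∑ i, ((Pi.single i 1 : Fin n → ℝ) ⬝ᵥ polarNewton (Matrix.vecMulVec (gradF s f c x)
          ((hess s f a x * shapeOp s f c x) *ᵥ Pi.single i 1)) (shapeOp s f p x)
            (shapeOp s f q x) *ᵥ gradF s f a x)
      - 2 * ∑ i, ((Pi.single i 1 : Fin n → ℝ) ⬝ᵥ polarNewton (Matrix.vecMulVec (gradF s f c x)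
          ((hess s f p x * shapeOp s f c x) *ᵥ Pi.single i 1)) (shapeOp s f a x)
            (shapeOp s f q x) *ᵥ gradF s f a x))
      = ∑ a, ∑ c, ∑ p, ∑ q, (normalGram s f x)⁻¹ p q * E (A a) (A c) (A p) (A q) (φ a) (φ c) := by
    simp only [E, hA]
    rfl
  rw [hrhs, hEW, gaussBonnetPerp, Finset.mul_sum]
  refine Finset.sum_congr rfl fun a _ => ?_
  rw [Finset.mul_sum]
  refine Finset.sum_congr rfl fun c _ => ?_
  have hpair (B : Matrix (Fin n) (Fin n) ℝ) : gradPairing s f B a c x = φ c ⬝ᵥ g *ᵥ B *ᵥ φ a := by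
    rw [gradPairing, dotProduct_comm]
    exact (mulVec_dotProduct_of_symm hg _ _).trans (dotProduct_comm _ _)
  have hT : tPerp s f c x = ∑ p, ∑ q, (normalGram s f x)⁻¹ p q • ((A p).trace • (A c * A q - A q * A c)
      + (A p * A c - A c * A p) * A q + A p * (A q * A c - A c * A q)) := rfl
  have hsum (M : Fin m → Fin m → Matrix (Fin n) (Fin n) ℝ) :
      φ c ⬝ᵥ g *ᵥ (∑ p, ∑ q, (normalGram s f x)⁻¹ p q • M p q) *ᵥ φ a
        = ∑ p, ∑ q, (normalGram s f x)⁻¹ p q * (φ c ⬝ᵥ g *ᵥ M p q *ᵥ φ a) := by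
    simp only [sum_mulVec', mulVec_sum', dotProduct_sum', Matrix.smul_mulVec, Matrix.mulVec_smul,
      dotProduct_smul, smul_eq_mul]
  have e1 : (2 : ℝ) • (ricciOp s f x * normalCurv s f a c x) + tPerp s f c x * shapeOp s f a x
      + shapeOp s f a x * tPerp s f c x = ∑ p, ∑ q, (normalGram s f x)⁻¹ p q •
      ((2 : ℝ) • (((A p).trace • A q - A p * A q) * (A c * A a - A a * A c))
        + ((A p).trace • (A c * A q - A q * A c) + (A p * A c - A c * A p) * A q
          + A p * (A q * A c - A c * A q)) * A a
        + A a * ((A p).trace • (A c * A q - A q * A c) + (A p * A c - A c * A p) * A q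
          + A p * (A q * A c - A c * A q))) := by
    rw [hT, ricciOp_eq hs hcl hf hx]
    simp only [Matrix.sum_mul, Matrix.mul_sum, Finset.smul_sum, Matrix.smul_mul, Matrix.mul_smul,
      smul_comm (2 : ℝ), ← Finset.sum_add_distrib, ← smul_add]
    rfl
  have e2 : (shapeOp s f a x).trace • tPerp s f c x = ∑ p, ∑ q, (normalGram s f x)⁻¹ p q •
      ((A a).trace • ((A p).trace • (A c * A q - A q * A c) + (A p * A c - A c * A p) * A q
          + A p * (A q * A c - A c * A q))) := by
    rw [hT, Finset.smul_sum]
    refine Finset.sum_congr rfl fun p _ => ?_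
    rw [Finset.smul_sum]
    exact Finset.sum_congr rfl fun q _ => smul_comm _ _ _
  simp only [hpair, e1, e2, hsum, scal_eq hs hcl hf hx]
  rw [Finset.mul_sum, Finset.sum_mul, ← Finset.sum_sub_distrib, ← Finset.sum_add_distrib,
    ← Finset.sum_add_distrib, Finset.mul_sum]
  refine Finset.sum_congr rfl fun p _ => ?_
  rw [Finset.mul_sum, Finset.sum_mul, ← Finset.sum_sub_distrib, ← Finset.sum_add_distrib,
    ← Finset.sum_add_distrib, Finset.mul_sum]
  refine Finset.sum_congr rfl fun q _ => ?_
  simp only [W, Matrix.smul_mulVec, Matrix.mulVec_smul, dotProduct_smul, smul_eq_mul]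
  simp only [normalCurv, A, φ, g]
  ring

/-- The Euclidean divergence of `P^{ijkl} ∂ₗ g_{jk}` is `(L₂ + L₂^⊥) / 2`. -/
theorem sum_pd_newtonField : ∑ i, pd s i (fun y => newtonField s f y i) x =
    (1 / 2) * (gaussBonnet s (graphMetric s f) x + gaussBonnetPerp s f x) := by
  have h := sum_divergence_terms (graphMetric s f x)⁻¹ (fun b => hess s f b x)
    (fun b i => thirdD s f b i x) (normalGram s f x)⁻¹ (fun b => gradF s f b x)
    (fun a i j k => thirdD_symm hs hcl hf hx a i j k) (normalGram_inv_transpose x)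
  rw [gaussBonnet_eq hs hcl hf hx, gaussBonnetPerp_eq hs hcl hf hx]
  simp only [← shapeOp_eq] at h
  rw [← h, Finset.mul_sum]
  refine Finset.sum_congr rfl fun i _ => ?_
  rw [((hasPdV_newtonField hs hcl hf hx i) i).2, single_one_dotProduct]
  rfl

end GraphCurvature

end GBC

/-! ### The third elementary symmetric polynomial of the eigenvalues as traces -/

namespace GBC

/-- Newton's identity in degree three, by adding one root at a time; the step needs the degree two
identity. -/
theorem six_mul_esymm_three (t : Multiset ℝ) :
    6 * t.esymm 3 = t.sum ^ 3 - 3 * t.sum * (t.map (· ^ 2)).sum + 2 * (t.map (· ^ 3)).sum := by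
  have h2 (t : Multiset ℝ) : 2 * t.esymm 2 = t.sum ^ 2 - (t.map (· ^ 2)).sum := by
    induction t using Multiset.induction_on with
    | empty => simp [Multiset.esymm, Multiset.powersetCard_zero_right]
    | cons a t ih =>
      have : (a ::ₘ t).esymm 2 = t.esymm 2 + a * t.sum := by
        simp [Multiset.esymm, Multiset.powersetCard_one,
          Multiset.sum_map_mul_left (f := fun x : ℝ => x)]
      simp only [this, mul_add, ih, Multiset.sum_cons, Multiset.map_cons]
      ring
  induction t using Multiset.induction_on with
  | empty => simp [Multiset.esymm, Multiset.powersetCard_zero_right]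
  | cons a t ih =>
    have : (a ::ₘ t).esymm 3 = t.esymm 3 + a * t.esymm 2 := by
      simp [Multiset.esymm, Multiset.sum_map_mul_left]
    have h := h2 t
    simp only [this, mul_add, ih, Multiset.sum_cons, Multiset.map_cons]
    linear_combination 3 * a * h

/-- A real symmetric matrix is orthogonally diagonalisable, so all its eigenvalues are real roots of
the characteristic polynomial and their power sums are the traces of powers of M. -/
theorem six_mul_esymm_three_charpoly {ι : Type*} [Fintype ι] [DecidableEq ι] (M : Matrix ι ι ℝ)
    (hM : Mᵀ = M) : 6 * M.charpoly.roots.esymm 3 = polarE3 M M M := by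
  have hH : M.IsHermitian := by
    rw [Matrix.IsHermitian, Matrix.conjTranspose_eq_transpose_of_trivial, hM]
  have hsp := hH.splits_charpoly
  have htr (k : ℕ) : (M ^ k).trace = (M.charpoly.roots.map (· ^ k)).sum := by
    have h1 : M ^ k = hH.eigenvectorUnitary.1 * diagonal (hH.eigenvalues ^ k)
        * star hH.eigenvectorUnitary.1 := by
      conv_lhs => rw [hH.spectral_theorem, ← map_pow, Matrix.diagonal_pow]
      rfl
    rw [h1, Matrix.trace_mul_comm, ← Matrix.mul_assoc]
    simp [hH.roots_charpoly_eq_eigenvalues, Matrix.trace]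
  have h1 := htr 1
  have h2 := htr 2
  have h3 := htr 3
  simp only [pow_one, Multiset.map_id'] at h1
  rw [six_mul_esymm_three, ← h1, ← h2, ← h3]
  simp only [polarE3, pow_succ, pow_zero, one_mul]
  ring

end GBC

namespace GBC

/-! ### Area formula for a C¹ map with a linear left inverse -/

section Area

variable {F V : Type*} [NormedAddCommGroup F] [InnerProductSpace ℝ F] [FiniteDimensional ℝ F]
  [MeasurableSpace F] [BorelSpace F] [NormedAddCommGroup V] [InnerProductSpace ℝ V]
  [FiniteDimensional ℝ V] [MeasurableSpace V] [BorelSpace V]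

theorem _root_.LipschitzOnWith.euclideanHausdorffMeasure_image_le {X Y : Type*} [EMetricSpace X]
    [EMetricSpace Y] [MeasurableSpace X] [BorelSpace X] [MeasurableSpace Y] [BorelSpace Y]
    {K : NNReal} {g : X → Y} {t : Set X} (h : LipschitzOnWith K g t) (d : ℕ) :
    μHE[d] (g '' t) ≤ (K : ENNReal) ^ d * μHE[d] t := by
  have := h.hausdorffMeasure_image_le (d := d) d.cast_nonneg
  rw [Measure.euclideanHausdorffMeasure_def, Measure.euclideanHausdorffMeasure_def,
    Measure.smul_apply, Measure.smul_apply, ENNReal.smul_def, ENNReal.smul_def, smul_eq_mul,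
    smul_eq_mul, mul_left_comm]
  gcongr
  simpa using this

variable {G : F → V} {G' : F → F →L[ℝ] V} {P : V →L[ℝ] F}

/-- Near x the images of A under G and under its linear part G' x are related by K-Lipschitz maps in
both directions, both factoring through the left inverse P. The linear image has measure normDet
times volume. -/
theorem euclideanHausdorffMeasure_image_bounds (hG : ∀ x, HasStrictFDerivAt G (G' x) x)
    (hP : ∀ x, P (G x) = x) {K : NNReal} (hK : 1 < K) (x : F) :
    ∃ r > 0, ∀ A ⊆ Metric.closedBall x r,
      μHE[Module.finrank ℝ F] (G '' A) ≤ (K : ENNReal) ^ (Module.finrank ℝ F) *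
        (ENNReal.ofReal ((G' x).toLinearMap.normDet) * volume A) ∧
      ENNReal.ofReal ((G' x).toLinearMap.normDet) * volume A ≤
        (K : ENNReal) ^ (Module.finrank ℝ F) * μHE[Module.finrank ℝ F] (G '' A) := by
  have hPL (v : F) : P (G' x v) = v := by
    have h1 : HasFDerivAt (fun y => P (G y)) (P.comp (G' x)) x :=
      P.hasFDerivAt.comp x (hG x).hasFDerivAt
    have h2 : HasFDerivAt (fun y => P (G y)) (ContinuousLinearMap.id ℝ F) x :=
      (hasFDerivAt_id x).congr_of_eventuallyEq (Eventually.of_forall hP)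
    exact DFunLike.congr_fun (h1.unique h2) v
  have hK' : (1 : ℝ) < K := by exact_mod_cast hK
  obtain ⟨δ, hδ0, hδ1, hδ2⟩ : ∃ δ : ℝ, 0 < δ ∧ 1 + δ ≤ K ∧ 1 ≤ K * (1 - δ) := by
    -- A relative error δ distorts lengths by factors between 1 - δ and 1 + δ; both must lie between
    -- 1/K and K.
    refine ⟨min (K - 1) (1 - 1 / K), ?_, ?_, ?_⟩
    · refine lt_min (by linarith) ?_
      rw [sub_pos, div_lt_one (by linarith)]
      exact hK'
    · linarith [min_le_left ((K : ℝ) - 1) (1 - 1 / K)]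
    · have h : 1 / (K : ℝ) ≤ 1 - min ((K : ℝ) - 1) (1 - 1 / K) := by
        linarith [min_le_right ((K : ℝ) - 1) (1 - 1 / K)]
      calc (1 : ℝ) = K * (1 / K) := by field_simp
        _ ≤ _ := by gcongr
  -- Because P inverts G' x, the norm of v is at most ‖P‖ times that of G' x v, so an error of this
  -- size relative to v is at most δ relative to G' x v. The 1 guards against ‖P‖ = 0.
  have hc : 0 < δ / (‖P‖ + 1) := by positivity
  have hs := (hG x).isLittleO.def hc
  obtain ⟨r, hr, hball⟩ := Metric.eventually_nhds_iff_ball.1 hs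
  refine ⟨r / 2, by positivity, fun A hA => ?_⟩
  have key : ∀ a ∈ A, ∀ b ∈ A, ‖G a - G b - G' x (a - b)‖ ≤ δ * ‖G' x (a - b)‖ := by
    intro a ha b hb
    have hab : (a, b) ∈ Metric.ball (x, x) r := by
      have h1 := Metric.mem_closedBall.1 (hA ha)
      have h2 := Metric.mem_closedBall.1 (hA hb)
      rw [Metric.mem_ball, Prod.dist_eq]
      exact max_lt (by simpa using by linarith) (by simpa using by linarith)
    refine (hball _ hab).trans ?_
    have h3 : ‖a - b‖ ≤ (‖P‖ + 1) * ‖G' x (a - b)‖ := by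
      calc ‖a - b‖ = ‖P (G' x (a - b))‖ := by rw [hPL]
        _ ≤ ‖P‖ * ‖G' x (a - b)‖ := P.le_opNorm _
        _ ≤ _ := by gcongr; linarith
    calc δ / (‖P‖ + 1) * ‖a - b‖ ≤ δ / (‖P‖ + 1) * ((‖P‖ + 1) * ‖G' x (a - b)‖) := by gcongr
      _ = _ := by field_simp
  have hvol : μHE[Module.finrank ℝ F] (G' x '' A)
      = ENNReal.ofReal ((G' x).toLinearMap.normDet) * volume A :=
    LinearMap.euclideanHausdorffMeasure_image_eq_normDet_mul_volume (G' x).toLinearMap A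
  rw [← hvol]
  constructor
  · have hL : LipschitzOnWith K (fun y => G (P y)) (G' x '' A) := by
      refine LipschitzOnWith.of_dist_le_mul ?_
      rintro _ ⟨a, ha, rfl⟩ _ ⟨b, hb, rfl⟩
      rw [hPL, hPL, dist_eq_norm, dist_eq_norm, ← map_sub]
      have h1 := key a ha b hb
      have h2 := norm_le_insert' (G a - G b) (G' x (a - b))
      have h3 : (1 + δ) * ‖G' x (a - b)‖ ≤ K * ‖G' x (a - b)‖ := by gcongr
      linarith
    have h := hL.euclideanHausdorffMeasure_image_le (Module.finrank ℝ F)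
    rwa [image_image, image_congr (fun a _ => by rw [hPL])] at h
  · have hL : LipschitzOnWith K (fun y => G' x (P y)) (G '' A) := by
      refine LipschitzOnWith.of_dist_le_mul ?_
      rintro _ ⟨a, ha, rfl⟩ _ ⟨b, hb, rfl⟩
      rw [hP, hP, dist_eq_norm, dist_eq_norm, ← map_sub]
      have h1 := key a ha b hb
      have h2 := norm_le_insert (G a - G b) (G' x (a - b))
      have h3 : 1 * ‖G' x (a - b)‖ ≤ K * (1 - δ) * ‖G' x (a - b)‖ := by gcongr
      have h4 : (1 - δ) * ‖G' x (a - b)‖ ≤ ‖G a - G b‖ := by linarith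
      have h5 : (K : ℝ) * ((1 - δ) * ‖G' x (a - b)‖) ≤ K * ‖G a - G b‖ := by gcongr
      linarith
    have h := hL.euclideanHausdorffMeasure_image_le (Module.finrank ℝ F)
    rwa [image_image, image_congr (fun a _ => by rw [hP])] at h

theorem measurableEmbedding_of_leftInverse (hG : ∀ x, HasStrictFDerivAt G (G' x) x)
    (hP : ∀ x, P (G x) = x) : MeasurableEmbedding G :=
  (Function.LeftInverse.isClosedEmbedding (f := P) hP P.continuous
    (continuous_iff_continuousAt.2 fun x => (hG x).continuousAt)).measurableEmbedding

/-- The area formula for a `C¹` map with a linear left inverse. -/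
theorem comap_euclideanHausdorffMeasure (hG : ∀ x, HasStrictFDerivAt G (G' x) x)
    (hP : ∀ x, P (G x) = x) : (μHE[Module.finrank ℝ F] : Measure V).comap G =
      volume.withDensity fun x => ENNReal.ofReal ((G' x).toLinearMap.normDet) := by
  have hemb := measurableEmbedding_of_leftInverse hG hP
  set d := Module.finrank ℝ F
  set ν := (μHE[d] : Measure V).comap G with hν
  have hνA (A : Set F) : ν A = μHE[d] (G '' A) := hemb.comap_apply _ _
  have hloc : IsLocallyFiniteMeasure ν := by
    refine ⟨fun x => ?_⟩
    obtain ⟨r, hr, h⟩ := euclideanHausdorffMeasure_image_bounds hG hP one_lt_two x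
    refine ⟨Metric.closedBall x r, Metric.closedBall_mem_nhds x hr, ?_⟩
    rw [hνA]
    refine (h _ subset_rfl).1.trans_lt ?_
    refine ENNReal.mul_lt_top (by finiteness) (ENNReal.mul_lt_top (by finiteness) ?_)
    exact measure_closedBall_lt_top
  have hac : ν ≪ volume := by
    intro A hA
    refine measure_null_of_locally_null A fun x _ => ?_
    obtain ⟨r, hr, h⟩ := euclideanHausdorffMeasure_image_bounds hG hP one_lt_two x
    refine ⟨A ∩ Metric.closedBall x r, ?_, ?_⟩
    · exact inter_mem_nhdsWithin _ (Metric.closedBall_mem_nhds x hr)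
    rw [hνA, ← nonpos_iff_eq_zero]
    refine (h _ inter_subset_right).1.trans ?_
    rw [measure_mono_null inter_subset_left hA]
    simp
  rw [← Measure.withDensity_rnDeriv_eq ν volume hac]
  refine withDensity_congr_ae ?_
  -- Differentiation of measures: the density at x is the limit of ratios on small balls, which the
  -- local bounds squeeze between J / K^d and K^d J. Then K ↓ 1.
  filter_upwards [Besicovitch.ae_tendsto_rnDeriv ν volume] with x hx
  set D := ν.rnDeriv volume x
  set J := ENNReal.ofReal ((G' x).toLinearMap.normDet)
  have hJ : J ≠ ⊤ := ENNReal.ofReal_ne_top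
  have hlim (c : ENNReal) (hc : c ≠ ⊤) :
      Tendsto (fun K : NNReal => (K : ENNReal) ^ d * c) (𝓝[>] 1) (𝓝 c) := by
    have h1 : Tendsto (fun K : NNReal => (K : ENNReal) ^ d) (𝓝[>] 1) (𝓝 1) := by
      have : Continuous fun K : NNReal => ((K ^ d : NNReal) : ENNReal) :=
        ENNReal.continuous_coe.comp (continuous_id.pow d)
      have h := (this.tendsto 1).mono_left (nhdsWithin_le_nhds (s := Ioi 1))
      simpa using h
    simpa using ENNReal.Tendsto.mul_const h1 (Or.inr hc)
  have hb (K : NNReal) (hK : 1 < K) : D ≤ (K : ENNReal) ^ d * J ∧ J ≤ (K : ENNReal) ^ d * D := by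
    obtain ⟨r, hr, h⟩ := euclideanHausdorffMeasure_image_bounds hG hP hK x
    have hev : ∀ᶠ ρ in 𝓝[>] (0 : ℝ), ρ ∈ Ioc 0 r := Ioc_mem_nhdsGT hr
    have hpos (ρ : ℝ) (hρ : 0 < ρ) : volume (Metric.closedBall x ρ) ≠ 0 :=
      (Metric.measure_closedBall_pos volume x hρ).ne'
    have hfin (ρ : ℝ) : volume (Metric.closedBall x ρ) ≠ ⊤ := measure_closedBall_lt_top.ne
    constructor
    · refine le_of_tendsto hx ?_
      filter_upwards [hev] with ρ hρ
      rw [hνA]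
      refine ENNReal.div_le_of_le_mul ?_
      rw [mul_assoc]
      exact (h _ (Metric.closedBall_subset_closedBall hρ.2)).1
    · refine ge_of_tendsto (ENNReal.Tendsto.const_mul hx (Or.inr (by finiteness))) ?_
      filter_upwards [hev] with ρ hρ
      rw [hνA, ← mul_div_assoc, ENNReal.le_div_iff_mul_le (Or.inl (hpos ρ hρ.1)) (Or.inl (hfin ρ))]
      exact (h _ (Metric.closedBall_subset_closedBall hρ.2)).2
  have hDJ : D ≤ J := ge_of_tendsto (hlim J hJ) (by
    filter_upwards [self_mem_nhdsWithin] with K hK using (hb K hK).1)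
  have hD : D ≠ ⊤ := (hDJ.trans_lt hJ.lt_top).ne
  refine le_antisymm hDJ (ge_of_tendsto (hlim D hD) ?_)
  filter_upwards [self_mem_nhdsWithin] with K hK using (hb K hK).2

/-- Integration over the image of a `C¹` map with a linear left inverse. -/
theorem setIntegral_range_euclideanHausdorffMeasure (hG : ∀ x, HasStrictFDerivAt G (G' x) x)
    (hP : ∀ x, P (G x) = x) (hm : Measurable fun x => (G' x).toLinearMap.normDet) (k : V → ℝ) :
    ∫ x in range G, k x ∂μHE[Module.finrank ℝ F] =
      ∫ y, (G' y).toLinearMap.normDet * k (G y) := by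
  have hemb := measurableEmbedding_of_leftInverse hG hP
  rw [← hemb.map_comap, hemb.integral_map, comap_euclideanHausdorffMeasure hG hP]
  have := integral_withDensity_eq_integral_smul (μ := (volume : Measure F))
    hm.real_toNNReal (fun y => k (G y))
  refine this.trans (integral_congr_ae (Eventually.of_forall fun y => ?_))
  simp only [NNReal.smul_def, Real.coe_toNNReal _ (LinearMap.normDet_nonneg _), smul_eq_mul]

end Area
end GBC

namespace GBC

/-! ### Graphs over a hyperplane and their area element -/

section GraphCoordinates

variable {V : Type*} [NormedAddCommGroup V] [InnerProductSpace ℝ V] [FiniteDimensional ℝ V]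
  [MeasurableSpace V] [BorelSpace V]

/-- The orthogonal projection onto the hyperplane orthogonal to `e`. -/
noncomputable abbrev hproj (e : V) : V →L[ℝ] (ℝ ∙ e)ᗮ := (ℝ ∙ e)ᗮ.orthogonalProjectionOnto

theorem hproj_self (e : V) : hproj e e = 0 :=
  Submodule.orthogonalProjectionOnto_orthogonalComplement_singleton_eq_zero e

theorem hproj_coe (e : V) (y : (ℝ ∙ e)ᗮ) : hproj e y = y :=
  Submodule.orthogonalProjectionOnto_mem_subspace_eq_self y

theorem inner_coe_orthogonal (e : V) (y : (ℝ ∙ e)ᗮ) : inner ℝ e (y : V) = 0 :=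
  Submodule.mem_orthogonal_singleton_iff_inner_right.1 y.2

theorem coe_hproj {e : V} (he : ‖e‖ = 1) (x : V) : (hproj e x : V) = x - inner ℝ e x • e := by
  have h : x = (x - inner ℝ e x • e) + inner ℝ e x • e := by abel
  have hm : x - inner ℝ e x • e ∈ (ℝ ∙ e)ᗮ := by
    rw [Submodule.mem_orthogonal_singleton_iff_inner_right, inner_sub_right, inner_smul_right,
      real_inner_self_eq_norm_sq, he]
    ring
  conv_lhs => rw [h]
  rw [map_add, map_smul, hproj_self, smul_zero, add_zero]
  exact congrArg Subtype.val (hproj_coe e ⟨_, hm⟩)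

theorem hproj_add_smul (e : V) (y : (ℝ ∙ e)ᗮ) (t : ℝ) : hproj e ((y : V) + t • e) = y := by
  rw [map_add, map_smul, hproj_self, smul_zero, add_zero, hproj_coe]

theorem inner_add_smul {e : V} (he : ‖e‖ = 1) (y : (ℝ ∙ e)ᗮ) (t : ℝ) :
    inner ℝ e ((y : V) + t • e) = t := by
  rw [inner_add_right, inner_coe_orthogonal, inner_smul_right, real_inner_self_eq_norm_sq, he]
  ring

theorem hproj_add_inner_smul {e : V} (he : ‖e‖ = 1) (x : V) :
    (hproj e x : V) + inner ℝ e x • e = x := by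
  rw [coe_hproj he]
  abel

/-- The isometry `(y, t) ↦ y + t e`. -/
noncomputable def hyperplaneProd {e : V} (he : ‖e‖ = 1) :
    WithLp 2 ((ℝ ∙ e)ᗮ × ℝ) ≃ₗᵢ[ℝ] V where
  toFun z := (z.fst : V) + z.snd • e
  invFun x := WithLp.toLp 2 (hproj e x, inner ℝ e x)
  map_add' z w := by simp [add_smul]; abel
  map_smul' c z := by simp [mul_smul]
  left_inv z := by
    apply (WithLp.equiv 2 _).injective
    exact Prod.ext (hproj_add_smul e z.fst z.snd) (inner_add_smul he z.fst z.snd)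
  right_inv x := hproj_add_inner_smul he x
  norm_map' z := by
    rw [← sq_eq_sq₀ (norm_nonneg _) (norm_nonneg _), WithLp.prod_norm_sq_eq_of_L2]
    change ‖(z.fst : V) + z.snd • e‖ ^ 2 = _
    rw [norm_add_sq_real, inner_smul_right, real_inner_comm, inner_coe_orthogonal, norm_smul, he]
    simp

theorem measurePreserving_hyperplaneProd {e : V} (he : ‖e‖ = 1) :
    MeasurePreserving (fun z : (ℝ ∙ e)ᗮ × ℝ => (z.1 : V) + z.2 • e) := by
  have h1 := (hyperplaneProd he).measurePreserving
  have h2 := (WithLp.volume_preserving_ofLp (U := (ℝ ∙ e)ᗮ) (V := ℝ)).symm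
    (MeasurableEquiv.toLp 2 ((ℝ ∙ e)ᗮ × ℝ)).symm
  exact h1.comp h2

theorem measurePreserving_shear {F : Type*} [MeasureSpace F] [SFinite (volume : Measure F)]
    {φ : F → ℝ} (hφ : Measurable φ) :
    MeasurePreserving (fun z : F × ℝ => (z.1, φ z.1 + z.2)) := by
  refine MeasurePreserving.skew_product (g := fun y t => φ y + t) (MeasurePreserving.id volume) ?_
    (Eventually.of_forall fun y => (measurePreserving_add_left volume (φ y)).map_eq)
  exact (hφ.comp measurable_fst).add measurable_snd

variable {e : V} {φ : (ℝ ∙ e)ᗮ → ℝ}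

/-- The graph of `φ` in the direction `e`. -/
noncomputable def graphMap (e : V) (φ : (ℝ ∙ e)ᗮ → ℝ) (y : (ℝ ∙ e)ᗮ) : V := (y : V) + φ y • e

/-- The derivative of `graphMap`. -/
noncomputable def graphMapDeriv (e : V) (φ : (ℝ ∙ e)ᗮ → ℝ) (y : (ℝ ∙ e)ᗮ) : (ℝ ∙ e)ᗮ →L[ℝ] V :=
  (ℝ ∙ e)ᗮ.subtypeL + (fderiv ℝ φ y).smulRight e

theorem hasStrictFDerivAt_graphMap (hφ : ContDiff ℝ 1 φ) (y : (ℝ ∙ e)ᗮ) :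
    HasStrictFDerivAt (graphMap e φ) (graphMapDeriv e φ y) y :=
  (ℝ ∙ e)ᗮ.subtypeL.hasStrictFDerivAt.add
    ((hφ.contDiffAt.hasStrictFDerivAt one_ne_zero).smul_const e)

/-- The adjoint of the derivative composed with the derivative is v ↦ v + dφ(v) w with w the
gradient of φ, a transvection of determinant 1 + |dφ|². -/
theorem normDet_graphMapDeriv (he : ‖e‖ = 1) (y : (ℝ ∙ e)ᗮ) :
    (graphMapDeriv e φ y).toLinearMap.normDet = Real.sqrt (1 + ‖fderiv ℝ φ y‖ ^ 2) := by
  have h := (graphMapDeriv e φ y).normDet_sq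
  set w := (InnerProductSpace.toDual ℝ (ℝ ∙ e)ᗮ).symm (fderiv ℝ φ y) with hw
  have hwv (v : (ℝ ∙ e)ᗮ) : inner ℝ w v = fderiv ℝ φ y v := by
    rw [hw, InnerProductSpace.toDual_symm_apply]
  have h2 : ((graphMapDeriv e φ y).adjoint ∘L graphMapDeriv e φ y).toLinearMap
      = LinearMap.transvection (fderiv ℝ φ y).toLinearMap w := by
    ext1 v
    refine ext_inner_right ℝ fun u => ?_
    change inner ℝ ((graphMapDeriv e φ y).adjoint (graphMapDeriv e φ y v)) u
      = inner ℝ (v + fderiv ℝ φ y v • w) u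
    rw [ContinuousLinearMap.adjoint_inner_left]
    change inner ℝ ((v : V) + fderiv ℝ φ y v • e) ((u : V) + fderiv ℝ φ y u • e) = _
    simp only [inner_add_left, inner_add_right, inner_smul_left, inner_smul_right, hwv,
      inner_coe_orthogonal, real_inner_comm e, real_inner_self_eq_norm_sq, he]
    simp
    ring
  rw [ContinuousLinearMap.det, h2, LinearMap.transvection.det] at h
  have h3 : (fderiv ℝ φ y) w = ‖fderiv ℝ φ y‖ ^ 2 := by
    rw [← hwv, real_inner_self_eq_norm_sq, hw, LinearIsometryEquiv.norm_map]
  rw [← Real.sqrt_sq (LinearMap.normDet_nonneg (graphMapDeriv e φ y).toLinearMap)]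
  congr 1
  exact h.trans (congrArg (1 + ·) h3)

theorem setIntegral_range_graphMap (he : ‖e‖ = 1) (hφ : ContDiff ℝ 1 φ) (k : V → ℝ) :
    ∫ x in range (graphMap e φ), k x ∂μHE[Module.finrank ℝ V - 1] =
      ∫ y, Real.sqrt (1 + ‖fderiv ℝ φ y‖ ^ 2) * k (graphMap e φ y) := by
  have he0 : e ≠ 0 := by rintro rfl; simp at he
  -- The truncated subtraction is harmless, since a unit vector forces dimension at least 1.
  have hr : Module.finrank ℝ V - 1 = Module.finrank ℝ (ℝ ∙ e)ᗮ := by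
    have := (ℝ ∙ e).finrank_add_finrank_orthogonal
    rw [finrank_span_singleton he0] at this
    omega
  have hm : Measurable fun y => Real.sqrt (1 + ‖fderiv ℝ φ y‖ ^ 2) :=
    (Real.continuous_sqrt.comp (continuous_const.add
      ((hφ.continuous_fderiv one_ne_zero).norm.pow 2))).measurable
  rw [hr, setIntegral_range_euclideanHausdorffMeasure (P := hproj e)
    (hasStrictFDerivAt_graphMap hφ) (fun y => hproj_add_smul e y (φ y))]
  · simp only [normDet_graphMapDeriv he]
  · simpa only [normDet_graphMapDeriv he] using hm

theorem integrableOn_range_graphMap (he : ‖e‖ = 1) (hφ : ContDiff ℝ 1 φ) {k : V → ℝ}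
    (hk : Integrable fun y => Real.sqrt (1 + ‖fderiv ℝ φ y‖ ^ 2) * k (graphMap e φ y)) :
    IntegrableOn k (range (graphMap e φ)) μHE[Module.finrank ℝ V - 1] := by
  have he0 : e ≠ 0 := by rintro rfl; simp at he
  have hr : Module.finrank ℝ V - 1 = Module.finrank ℝ (ℝ ∙ e)ᗮ := by
    have := (ℝ ∙ e).finrank_add_finrank_orthogonal
    rw [finrank_span_singleton he0] at this
    omega
  have hm : Measurable fun y => Real.sqrt (1 + ‖fderiv ℝ φ y‖ ^ 2) :=
    (Real.continuous_sqrt.comp (continuous_const.add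
      ((hφ.continuous_fderiv one_ne_zero).norm.pow 2))).measurable
  have hG := hasStrictFDerivAt_graphMap hφ
  have hP := fun y : (ℝ ∙ e)ᗮ => hproj_add_smul e y (φ y)
  have hemb := measurableEmbedding_of_leftInverse (P := hproj e) hG hP
  rw [hr, IntegrableOn, ← hemb.map_comap, hemb.integrable_map_iff,
    comap_euclideanHausdorffMeasure (P := hproj e) hG hP]
  simp only [normDet_graphMapDeriv he]
  have := integrable_withDensity_iff_integrable_smul (μ := (volume : Measure (ℝ ∙ e)ᗮ))
    hm.real_toNNReal (g := fun y => k (graphMap e φ y))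
  refine this.2 (hk.congr (Eventually.of_forall fun y => ?_))
  simp only [NNReal.smul_def, Real.coe_toNNReal _ (Real.sqrt_nonneg _), smul_eq_mul]

end GraphCoordinates

end GBC

/-! ### Divergence theorem above a C¹ graph -/

namespace GBC

theorem integrableOn_of_continuousOn_of_eq_zero {X : Type*} [TopologicalSpace X] [T2Space X]
    [MeasurableSpace X] [BorelSpace X] {μ : Measure X} [IsFiniteMeasureOnCompacts μ]
    {S K : Set X} {g : X → ℝ} (hS : IsClosed S) (hK : IsCompact K) (hg : ContinuousOn g S)
    (h0 : ∀ x ∉ K, g x = 0) : IntegrableOn g S μ := by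
  have h1 : IntegrableOn g (K ∩ S) μ :=
    (hg.mono inter_subset_right).integrableOn_compact' (hK.inter_right hS)
      (hK.inter_right hS).measurableSet
  exact h1.of_forall_sdiff_eq_zero hS.measurableSet fun x hx => h0 x fun hxK => hx.2 ⟨hxK, hx.1⟩

/-- Integration by parts against the constant function 1. -/
theorem integral_hasFDerivAt_eq_zero {F : Type*} [NormedAddCommGroup F] [InnerProductSpace ℝ F]
    [FiniteDimensional ℝ F] [MeasurableSpace F] [BorelSpace F] {K : Set F} {h : F → ℝ}
    {h' : F → F →L[ℝ] ℝ} {v : F} (hK : IsCompact K) (hd : ∀ x, HasFDerivAt h (h' x) x)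
    (hc : Continuous fun x => h' x v) (h0 : ∀ x ∉ K, h x = 0) (h0' : ∀ x ∉ K, h' x v = 0) :
    ∫ x, h' x v = 0 := by
  have hi {g : F → ℝ} (hg : Continuous g) (hg0 : ∀ x ∉ K, g x = 0) : Integrable g := by
    rw [← integrableOn_univ]
    exact integrableOn_of_continuousOn_of_eq_zero isClosed_univ hK hg.continuousOn hg0
  have := integral_bilinear_hasFDerivAt_right_eq_neg_left_of_integrable (μ := (volume : Measure F))
    (f := fun _ : F => (1 : ℝ)) (f' := fun _ => 0) (g := h) (g' := h') (v := v)
    (B := ContinuousLinearMap.mul ℝ ℝ) (by simp) (by simpa using hi hc h0')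
    (by simpa using hi (continuous_iff_continuousAt.2 fun x => (hd x).continuousAt) h0)
    (fun x _ => hasFDerivAt_const 1 x) (fun x _ => hd x)
  simpa using this

section HalfSpace

variable {V : Type*} [NormedAddCommGroup V] [InnerProductSpace ℝ V] [FiniteDimensional ℝ V]
  [MeasurableSpace V] [BorelSpace V] {e : V} {φ : (ℝ ∙ e)ᗮ → ℝ}

/-- The coordinates `(y, t) ↦ y + (φ y + t) e` straightening the graph of `φ`. -/
noncomputable def shearHomeomorph (he : ‖e‖ = 1) (hφ : Continuous φ) : (ℝ ∙ e)ᗮ × ℝ ≃ₜ V where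
  toFun z := (z.1 : V) + (φ z.1 + z.2) • e
  invFun x := (hproj e x, inner ℝ e x - φ (hproj e x))
  left_inv z := by
    simp only [hproj_add_smul, inner_add_smul he]
    exact Prod.ext rfl (by simp)
  right_inv x := by
    simp only [add_sub_cancel]
    exact hproj_add_inner_smul he x
  continuous_toFun := by fun_prop
  continuous_invFun := by fun_prop

theorem measurePreserving_shearHomeomorph (he : ‖e‖ = 1) (hφ : Continuous φ) :
    MeasurePreserving (shearHomeomorph he hφ) :=
  (measurePreserving_hyperplaneProd he).comp (measurePreserving_shear hφ.measurable)

/-- The divergence theorem on the region above the graph of a `C¹` function. -/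
theorem integral_epigraph (he : ‖e‖ = 1) (hφ : ContDiff ℝ 1 φ) {h : V → ℝ} {h' : V → V →L[ℝ] ℝ}
    {K : Set V} (hK : IsCompact K) (hc : ContinuousOn h {x | φ (hproj e x) ≤ inner ℝ e x})
    (hc' : ContinuousOn h' {x | φ (hproj e x) ≤ inner ℝ e x})
    (hd : ∀ x, φ (hproj e x) < inner ℝ e x → HasFDerivAt h (h' x) x)
    (h0 : ∀ x ∉ K, h x = 0) (h0' : ∀ x ∉ K, h' x = 0) (u : V) :
    ∫ x in {x | φ (hproj e x) ≤ inner ℝ e x}, h' x u =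
      - ∫ y, (inner ℝ e u - fderiv ℝ φ y (hproj e u)) * h (graphMap e φ y) := by
  set Θ := shearHomeomorph he hφ.continuous with hΘ
  set D := {x : V | φ (hproj e x) ≤ inner ℝ e x} with hD
  have hΘap (y : (ℝ ∙ e)ᗮ) (t : ℝ) : Θ (y, t) = (y : V) + (φ y + t) • e := rfl
  have hproj_Θ (y : (ℝ ∙ e)ᗮ) (t : ℝ) : hproj e (Θ (y, t)) = y := hproj_add_smul e y _
  have hinner_Θ (y : (ℝ ∙ e)ᗮ) (t : ℝ) : inner ℝ e (Θ (y, t)) = φ y + t := inner_add_smul he y _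
  have hΘD (y : (ℝ ∙ e)ᗮ) (t : ℝ) : Θ (y, t) ∈ D ↔ 0 ≤ t := by
    simp [hD, hproj_Θ, hinner_Θ]
  have hpre : Θ ⁻¹' D = univ ×ˢ Ici 0 := by
    ext ⟨y, t⟩
    simp [hΘD]
  have hdΘ (y : (ℝ ∙ e)ᗮ) (t : ℝ) (ht : 0 < t) : HasFDerivAt h (h' (Θ (y, t))) (Θ (y, t)) := by
    refine hd _ ?_
    rw [hproj_Θ, hinner_Θ]
    linarith
  set S : Set ((ℝ ∙ e)ᗮ × ℝ) := univ ×ˢ Ici 0 with hS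
  have hSc : IsClosed S := isClosed_univ.prod isClosed_Ici
  have hmaps : MapsTo Θ S D := fun z hz => by
    rw [← mem_preimage, hpre]
    exact hz
  have hKz : IsCompact (Θ ⁻¹' K) := Θ.isCompact_preimage.2 hK
  set a := hproj e u
  set b : ℝ := inner ℝ e u
  have hu : u = (a : V) + b • e := (hproj_add_inner_smul he u).symm
  have hφ' : Continuous (fderiv ℝ φ) := hφ.continuous_fderiv one_ne_zero
  have hcΘ : ContinuousOn (fun z => h' (Θ z)) S := hc'.comp Θ.continuous.continuousOn hmaps
  -- The direction u = a + b e is split into a + dφ(a) e, tangent to the translates of the graph,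
  -- and the vertical multiple (b - dφ(a)) e. Since φ is only C¹, the graph is straightened by a
  -- volume-preserving shear and no second derivative of φ appears.
  let W₁ : (ℝ ∙ e)ᗮ × ℝ → ℝ := fun z => h' (Θ z) ((a : V) + fderiv ℝ φ z.1 a • e)
  let W₂ : (ℝ ∙ e)ᗮ × ℝ → ℝ := fun z => (b - fderiv ℝ φ z.1 a) * h' (Θ z) e
  have hW₁c : ContinuousOn W₁ S := hcΘ.clm_apply (by fun_prop)
  have hW₂c : ContinuousOn W₂ S :=
    ContinuousOn.mul (by fun_prop) (hcΘ.clm_apply continuousOn_const)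
  have hW₁0 : ∀ z ∉ Θ ⁻¹' K, W₁ z = 0 := fun z hz => by simp [W₁, h0' _ hz]
  have hW₂0 : ∀ z ∉ Θ ⁻¹' K, W₂ z = 0 := fun z hz => by simp [W₂, h0' _ hz]
  have hW₁i : IntegrableOn W₁ S := integrableOn_of_continuousOn_of_eq_zero hSc hKz hW₁c hW₁0
  have hW₂i : IntegrableOn W₂ S := integrableOn_of_continuousOn_of_eq_zero hSc hKz hW₂c hW₂0
  have hsum : ∫ x in D, h' x u = (∫ z in S, W₁ z) + ∫ z in S, W₂ z := by
    rw [← (measurePreserving_shearHomeomorph he hφ.continuous).setIntegral_preimage_emb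
      Θ.measurableEmbedding, hpre, ← integral_add hW₁i hW₂i]
    refine integral_congr_ae (Eventually.of_forall fun z => ?_)
    simp only [W₁, W₂]
    conv_lhs => rw [hu]
    simp only [map_add, map_smul, smul_eq_mul]
    ring
  have hK1 : IsCompact (Prod.fst '' (Θ ⁻¹' K)) := hKz.image continuous_fst
  have hK2 : IsCompact (Prod.snd '' (Θ ⁻¹' K)) := hKz.image continuous_snd
  have hvol : (volume : Measure ((ℝ ∙ e)ᗮ × ℝ)).restrict S
      = (volume : Measure (ℝ ∙ e)ᗮ).prod (volume.restrict (Ici 0)) := by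
    rw [hS, Measure.volume_eq_prod, ← Measure.prod_restrict, Measure.restrict_univ]
  -- On each slice t > 0 the integrand is a derivative of a compactly supported function of y. The
  -- slice t = 0, where h need not be differentiable, is null.
  have hI₁ : ∫ z in S, W₁ z = 0 := by
    rw [hvol, integral_prod_symm _ (by rw [← hvol]; exact hW₁i), integral_Ici_eq_integral_Ioi]
    refine setIntegral_eq_zero_of_forall_eq_zero fun t ht => ?_
    have hder (y : (ℝ ∙ e)ᗮ) : HasFDerivAt (fun y => h (Θ (y, t)))
        ((h' (Θ (y, t))).comp (graphMapDeriv e φ y)) y := by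
      have h1 : HasFDerivAt (fun y => Θ (y, t)) (graphMapDeriv e φ y) y := by
        have := ((hasStrictFDerivAt_graphMap hφ y).hasFDerivAt).add_const (t • e)
        refine this.congr_of_eventuallyEq (Eventually.of_forall fun y => ?_)
        simp [hΘap, graphMap, add_smul, add_assoc]
      exact (hdΘ y t ht).comp y h1
    refine integral_hasFDerivAt_eq_zero hK1 hder (v := a) ?_ ?_ ?_
    · exact hW₁c.comp_continuous (by fun_prop) fun y => ⟨mem_univ _, (mem_Ioi.1 ht).le⟩
    · exact fun y hy => h0 _ fun hyK => hy ⟨(y, t), hyK, rfl⟩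
    · exact fun y hy => by simp [h0' _ (fun hyK => hy ⟨(y, t), hyK, rfl⟩)]
  -- The fundamental theorem of calculus along vertical half-lines leaves the value of h on the
  -- graph.
  have hI₂ : ∫ z in S, W₂ z = - ∫ y, (b - fderiv ℝ φ y a) * h (graphMap e φ y) := by
    rw [hvol, integral_prod _ (by rw [← hvol]; exact hW₂i), ← integral_neg]
    refine integral_congr_ae (Eventually.of_forall fun y => ?_)
    simp only [W₂]
    rw [integral_const_mul, integral_Ici_eq_integral_Ioi,
      integral_Ioi_of_hasDerivAt_of_tendsto (f := fun t => h (Θ (y, t))) (m := 0)]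
    · simp [hΘap, graphMap]
    · have : ContinuousOn (fun t => h (Θ (y, t))) (Ici 0) :=
        hc.comp (by fun_prop) fun t ht => (hΘD y t).2 ht
      exact this 0 self_mem_Ici
    · intro t ht
      have h1 : HasDerivAt (fun t => Θ (y, t)) e t := by
        have := (((hasDerivAt_id t).const_add (φ y)).smul_const e).const_add (y : V)
        rw [one_smul] at this
        exact this
      exact (hdΘ y t ht).comp_hasDerivAt t h1
    · refine IntegrableOn.mono_set ?_ Ioi_subset_Ici_self
      refine integrableOn_of_continuousOn_of_eq_zero isClosed_Ici hK2 ?_ ?_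
      · have : ContinuousOn (fun t => h' (Θ (y, t))) (Ici 0) :=
          hc'.comp (by fun_prop) fun t ht => (hΘD y t).2 ht
        exact this.clm_apply continuousOn_const
      · exact fun t ht => by simp [h0' _ (fun htK => ht ⟨(y, t), htK, rfl⟩)]
    · refine tendsto_const_nhds.congr' ?_
      obtain ⟨B, hB⟩ := hK2.bddAbove
      filter_upwards [eventually_gt_atTop B] with t ht
      exact (h0 _ fun htK => absurd (hB ⟨(y, t), htK, rfl⟩) (not_le.2 ht)).symm
  rw [hsum, hI₁, hI₂, zero_add]

end HalfSpace

end GBC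

namespace GBC

/-! ### Gauss-Green formula where the boundary is locally a C¹ graph -/

section GaussGreen

variable {V : Type*} [NormedAddCommGroup V] [InnerProductSpace ℝ V]

/-- `ν` is the outward unit normal of `Ω` at the boundary point `p`. -/
def IsNormalAt (Ω : Set V) (p ν : V) : Prop :=
  ‖ν‖ = 1 ∧ ∃ (ρ : V → ℝ) (c : ℝ), 0 < c ∧ HasFDerivAt ρ (c • innerSL ℝ ν) p ∧ ρ p = 0 ∧
    ∀ᶠ x in 𝓝 p, (x ∈ Ω ↔ ρ x < 0)

/-- Near `p`, the set `Ω` is the region below the graph of a `C¹` function. -/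
def IsC1GraphAt (Ω : Set V) (p : V) : Prop :=
  ∃ e : V, ‖e‖ = 1 ∧ ∃ φ : (ℝ ∙ e)ᗮ → ℝ, ContDiffAt ℝ 1 φ (hproj e p) ∧
    ∀ᶠ x in 𝓝 p, (x ∈ Ω ↔ inner ℝ e x < φ (hproj e x))

theorem eventually_neg_of_hasFDerivAt {ρ : V → ℝ} {L : V →L[ℝ] ℝ} {p v : V}
    (h : HasFDerivAt ρ L p) (h0 : ρ p = 0) (hv : L v < 0) :
    ∀ᶠ t : ℝ in 𝓝[>] 0, ρ (p + t • v) < 0 := by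
  have h1 : HasDerivAt (fun t : ℝ => ρ (p + t • v)) (L v) 0 := by
    have h2 : HasDerivAt (fun t : ℝ => p + t • v) v 0 := by
      simpa using ((hasDerivAt_id (0 : ℝ)).smul_const v).const_add p
    refine HasFDerivAt.comp_hasDerivAt (0 : ℝ) ?_ h2
    simpa using h
  filter_upwards [h1.tendsto_slope_zero_right.eventually (gt_mem_nhds hv), self_mem_nhdsWithin]
    with t ht ht0
  have ht0' : 0 < t := ht0
  simp only [zero_add, zero_smul, add_zero, h0, sub_zero, smul_eq_mul] at ht
  by_contra hcon
  have : 0 ≤ t⁻¹ * ρ (p + t • v) := mul_nonneg (by positivity) (not_lt.1 hcon)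
  linarith

/-- If the normals differed, short steps from p along ν' - ν would lie in Ω according to one
defining function and outside Ω according to the other. -/
theorem IsNormalAt.unique {Ω : Set V} {p ν ν' : V} (h : IsNormalAt Ω p ν)
    (h' : IsNormalAt Ω p ν') : ν = ν' := by
  obtain ⟨hν, ρ, c, hc, hd, h0, hρ⟩ := h
  obtain ⟨hν', ρ', c', hc', hd', h0', hρ'⟩ := h'
  by_contra hne
  have hlt : inner ℝ ν ν' < 1 := (inner_lt_one_iff_real_of_norm_eq_one hν hν').2 hne
  have e1 : ∀ᶠ t : ℝ in 𝓝[>] 0, ρ (p + t • (ν' - ν)) < 0 := by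
    refine eventually_neg_of_hasFDerivAt hd h0 ?_
    change c * inner ℝ ν (ν' - ν) < 0
    rw [inner_sub_right, real_inner_self_eq_norm_sq, hν]
    nlinarith
  have e2 : ∀ᶠ t : ℝ in 𝓝[>] 0, -ρ' (p + t • (ν' - ν)) < 0 := by
    refine eventually_neg_of_hasFDerivAt hd'.neg (by simp [h0']) ?_
    change -(c' * inner ℝ ν' (ν' - ν)) < 0
    rw [inner_sub_right, real_inner_self_eq_norm_sq, hν', real_inner_comm]
    nlinarith
  have ht : Tendsto (fun t : ℝ => p + t • (ν' - ν)) (𝓝[>] 0) (𝓝 p) := by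
    have : Continuous fun t : ℝ => p + t • (ν' - ν) := by fun_prop
    simpa using (this.tendsto 0).mono_left nhdsWithin_le_nhds
  obtain ⟨t, h1, h2, h3, h4⟩ :=
    (e1.and (e2.and ((ht.eventually hρ).and (ht.eventually hρ')))).exists
  have := h4.1 (h3.2 h1)
  linarith

variable [FiniteDimensional ℝ V] [MeasurableSpace V] [BorelSpace V]

/-- Multiply φ by a bump function equal to 1 near the base point. -/
theorem IsC1GraphAt.exists_contDiff {Ω : Set V} {p : V} (h : IsC1GraphAt Ω p) :
    ∃ e : V, ‖e‖ = 1 ∧ ∃ φ : (ℝ ∙ e)ᗮ → ℝ, ContDiff ℝ 1 φ ∧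
      ∀ᶠ x in 𝓝 p, (x ∈ Ω ↔ inner ℝ e x < φ (hproj e x)) := by
  obtain ⟨e, he, φ, hφ, hΩ⟩ := h
  have hev : ∀ᶠ y in 𝓝 (hproj e p), ContDiffAt ℝ 1 φ y :=
    hφ.eventually (by simp)
  obtain ⟨r, hr, hball⟩ := Metric.eventually_nhds_iff_ball.1 hev
  let χ : ContDiffBump (hproj e p) := ⟨r / 4, r / 2, by positivity, by linarith⟩
  refine ⟨e, he, fun y => χ y * φ y, ?_, ?_⟩
  · rw [contDiff_iff_contDiffAt]
    intro y
    by_cases hy : y ∈ Metric.ball (hproj e p) r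
    · exact χ.contDiffAt.mul (hball y hy)
    · have hy2 : y ∉ tsupport χ := by
        rw [χ.tsupport_eq]
        intro hy3
        have : dist y (hproj e p) ≤ r / 2 := hy3
        exact hy (lt_of_le_of_lt this (by linarith))
      have : (fun y => χ y * φ y) =ᶠ[𝓝 y] fun _ => 0 := by
        filter_upwards [(isClosed_tsupport χ).isOpen_compl.mem_nhds hy2] with z hz
        rw [image_eq_zero_of_notMem_tsupport hz, zero_mul]
      exact contDiffAt_const.congr_of_eventuallyEq this
  · have h1 : ∀ᶠ x in 𝓝 p, χ (hproj e x) = 1 :=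
      (hproj e).continuous.continuousAt.eventually χ.eventuallyEq_one
    filter_upwards [hΩ, h1] with x hx hx1
    rw [hx, hx1, one_mul]

/-- The Gauss-Green formula on `Ωᶜ` for functions supported in compact subsets of `W`. -/
def GaussGreenOn (Ω : Set V) (N : V → V) (u : V) (W : Set V) : Prop :=
  ∀ (h : V → ℝ) (h' : V → V →L[ℝ] ℝ) (K : Set V), IsCompact K → K ⊆ W → ContinuousOn h Ωᶜ →
    ContinuousOn h' Ωᶜ → (∀ x ∈ interior Ωᶜ, HasFDerivAt h (h' x) x) → (∀ x ∉ K, h x = 0) →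
    (∀ x ∉ K, h' x = 0) → (∀ q ∈ frontier Ω, h q ≠ 0 → IsNormalAt Ω q (N q)) →
    IntegrableOn (fun x => h x * inner ℝ (N x) u) (frontier Ω) μHE[Module.finrank ℝ V - 1] ∧
      ∫ x in Ωᶜ, h' x u = - ∫ x in frontier Ω, h x * inner ℝ (N x) u ∂μHE[Module.finrank ℝ V - 1]

/-- Extended by zero into Ω, h is C¹ on the whole space, because its support does not meet the
boundary; the integral of a derivative then vanishes. -/
theorem gaussGreenOn_of_disjoint_frontier {Ω W : Set V} (hΩ : IsOpen Ω) (N : V → V) (u : V)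
    (hW : Disjoint W (frontier Ω)) : GaussGreenOn Ω N u W := by
  intro h h' K hK hKW hc hc' hd h0 h0' _
  have hz : ∀ x ∈ frontier Ω, h x * inner ℝ (N x) u = 0 := fun x hx => by
    rw [h0 x fun hxK => hW.le_bot ⟨hKW hxK, hx⟩, zero_mul]
  have hzi : IntegrableOn (fun x => h x * inner ℝ (N x) u) (frontier Ω)
      μHE[Module.finrank ℝ V - 1] :=
    integrableOn_zero.congr_fun (fun x hx => (hz x hx).symm) isClosed_frontier.measurableSet
  refine ⟨hzi, ?_⟩
  rw [setIntegral_eq_zero_of_forall_eq_zero hz, neg_zero]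
  let g' : V → V →L[ℝ] ℝ := Ωᶜ.indicator h'
  let g : V → ℝ := Ωᶜ.indicator h
  have hmem (x : V) (hx : x ∈ Ωᶜ) (hxi : x ∉ interior Ωᶜ) : x ∉ K := fun hxK => by
    refine hW.le_bot ⟨hKW hxK, ?_⟩
    rw [← frontier_compl, frontier, hΩ.isClosed_compl.closure_eq]
    exact ⟨hx, hxi⟩
  have hdg (x : V) : HasFDerivAt g (g' x) x ∧ ContinuousAt g' x := by
    by_cases hxK : x ∈ K ∧ x ∈ Ωᶜ
    · have hxi : x ∈ interior Ωᶜ := by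
        by_contra hxi
        exact hmem x hxK.2 hxi hxK.1
      have hn : Ωᶜ ∈ 𝓝 x := mem_interior_iff_mem_nhds.1 hxi
      refine ⟨?_, ?_⟩
      · rw [show g' x = h' x from indicator_of_mem hxK.2 _]
        refine (hd x hxi).congr_of_eventuallyEq ?_
        filter_upwards [hn] with y hy using indicator_of_mem hy _
      · refine ((hc'.continuousAt hn)).congr ?_
        filter_upwards [hn] with y hy using (indicator_of_mem hy _).symm
    · have hn : ∀ᶠ y in 𝓝 x, ¬ (y ∈ K ∧ y ∈ Ωᶜ) :=
        (hK.isClosed.inter hΩ.isClosed_compl).isOpen_compl.mem_nhds hxK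
      have hg0 : ∀ y, ¬ (y ∈ K ∧ y ∈ Ωᶜ) → g y = 0 ∧ g' y = 0 := by
        intro y hy
        by_cases hyΩ : y ∈ Ωᶜ
        · have hyK : y ∉ K := fun hyK => hy ⟨hyK, hyΩ⟩
          exact ⟨(indicator_of_mem hyΩ _).trans (h0 y hyK),
            (indicator_of_mem hyΩ _).trans (h0' y hyK)⟩
        · exact ⟨indicator_of_notMem hyΩ _, indicator_of_notMem hyΩ _⟩
      refine ⟨?_, ?_⟩
      · rw [(hg0 x hxK).2]
        refine (hasFDerivAt_const (0 : ℝ) x).congr_of_eventuallyEq ?_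
        filter_upwards [hn] with y hy using (hg0 y hy).1
      · refine (continuousAt_const (y := (0 : V →L[ℝ] ℝ))).congr ?_
        filter_upwards [hn] with y hy using (hg0 y hy).2.symm
  have hzero := integral_hasFDerivAt_eq_zero (v := u) hK (fun x => (hdg x).1)
    ((continuous_iff_continuousAt.2 fun x => (hdg x).2).clm_apply continuous_const)
    (fun x hx => by
      by_cases hxΩ : x ∈ Ωᶜ
      · exact (indicator_of_mem hxΩ _).trans (h0 x hx)
      · exact indicator_of_notMem hxΩ _)
    (fun x hx => by
      have : g' x = 0 := by
        by_cases hxΩ : x ∈ Ωᶜ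
        · exact (indicator_of_mem hxΩ _).trans (h0' x hx)
        · exact indicator_of_notMem hxΩ _
      rw [this]
      rfl)
  rw [← integral_indicator hΩ.isClosed_compl.measurableSet, ← hzero]
  refine integral_congr_ae (Eventually.of_forall fun x => ?_)
  by_cases hx : x ∈ Ωᶜ
  · simp [g', indicator_of_mem hx]
  · simp [g', indicator_of_notMem hx]

/-- A partition of unity: χ vanishes near the complement of W₁ and equals 1 near K \ W₂, and the
formula is additive in h = χh + (1 - χ)h. -/
theorem GaussGreenOn.union {Ω W₁ W₂ : Set V} {N : V → V} {u : V} (hΩ : IsOpen Ω)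
    (hW₁ : IsOpen W₁) (hW₂ : IsOpen W₂) (h₁ : GaussGreenOn Ω N u W₁)
    (h₂ : GaussGreenOn Ω N u W₂) : GaussGreenOn Ω N u (W₁ ∪ W₂) := by
  intro h h' K hK hKW hc hc' hd h0 h0' hN
  obtain ⟨χ, hχ0, hχ1, -⟩ := exists_contMDiffMap_zero_one_nhds_of_isClosed (n := 1)
    (modelWithCornersSelf ℝ V) hW₁.isClosed_compl (hK.diff hW₂).isClosed (by
      rw [disjoint_left]
      exact fun x hx hx' => (hKW hx'.1).elim hx hx'.2)
  have hχ : ContDiff ℝ 1 χ := χ.contMDiff.contDiff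
  have hχ' : Continuous (fderiv ℝ χ) := hχ.continuous_fderiv one_ne_zero
  have hχd (x : V) : HasFDerivAt χ (fderiv ℝ χ x) x :=
    (hχ.differentiable one_ne_zero x).hasFDerivAt
  -- Interiors are needed so that dχ vanishes there too, and so that K \ O₀ and K \ O₁ are compact
  -- subsets of W₁ and W₂.
  set O₀ := interior {x | χ x = 0}
  set O₁ := interior {x | χ x = 1}
  have hO₀ : W₁ᶜ ⊆ O₀ := fun x hx => mem_interior_iff_mem_nhds.2
    (eventually_nhdsSet_iff_forall.1 hχ0 x hx)
  have hO₁ : K \ W₂ ⊆ O₁ := fun x hx => mem_interior_iff_mem_nhds.2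
    (eventually_nhdsSet_iff_forall.1 hχ1 x hx)
  have hder (c : ℝ) (x : V) (hx : x ∈ interior {x | χ x = c}) : χ x = c ∧ fderiv ℝ χ x = 0 := by
    have hn := mem_interior_iff_mem_nhds.1 hx
    refine ⟨(interior_subset hx : x ∈ {x | χ x = c}), ?_⟩
    have : (χ : V → ℝ) =ᶠ[𝓝 x] fun _ => c := hn
    rw [this.fderiv_eq, fderiv_fun_const]
    rfl
  obtain ⟨i₁, f₁⟩ := h₁ (fun x => χ x * h x) (fun x => χ x • h' x + h x • fderiv ℝ χ x) (K \ O₀)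
    (hK.diff isOpen_interior) (fun x hx => by
      by_contra hxW
      exact hx.2 (hO₀ hxW))
    (hχ.continuous.continuousOn.mul hc)
    ((hχ.continuous.continuousOn.smul hc').add (hc.smul hχ'.continuousOn))
    (fun x hx => (hχd x).mul (hd x hx))
    (fun x hx => by
      by_cases hxK : x ∈ K
      · have hxO : x ∈ O₀ := by
          by_contra hxO
          exact hx ⟨hxK, hxO⟩
        rw [(hder 0 x hxO).1, zero_mul]
      · rw [h0 x hxK, mul_zero])
    (fun x hx => by
      by_cases hxK : x ∈ K
      · have hxO : x ∈ O₀ := by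
          by_contra hxO
          exact hx ⟨hxK, hxO⟩
        rw [(hder 0 x hxO).1, (hder 0 x hxO).2, zero_smul, smul_zero, zero_add]
      · rw [h0 x hxK, h0' x hxK, zero_smul, smul_zero, zero_add])
    (fun q hq hne => hN q hq (right_ne_zero_of_mul hne))
  obtain ⟨i₂, f₂⟩ := h₂ (fun x => (1 - χ x) * h x)
    (fun x => (1 - χ x) • h' x + h x • (-fderiv ℝ χ x)) (K \ O₁)
    (hK.diff isOpen_interior) (fun x hx => by
      by_contra hxW
      exact hx.2 (hO₁ ⟨hx.1, hxW⟩))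
    ((continuousOn_const.sub hχ.continuous.continuousOn).mul hc)
    (((continuousOn_const.sub hχ.continuous.continuousOn).smul hc').add
      (hc.smul hχ'.neg.continuousOn))
    (fun x hx => ((hχd x).const_sub 1).mul (hd x hx))
    (fun x hx => by
      by_cases hxK : x ∈ K
      · have hxO : x ∈ O₁ := by
          by_contra hxO
          exact hx ⟨hxK, hxO⟩
        rw [(hder 1 x hxO).1, sub_self, zero_mul]
      · rw [h0 x hxK, mul_zero])
    (fun x hx => by
      by_cases hxK : x ∈ K
      · have hxO : x ∈ O₁ := by
          by_contra hxO
          exact hx ⟨hxK, hxO⟩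
        rw [(hder 1 x hxO).1, (hder 1 x hxO).2, sub_self, zero_smul, neg_zero, smul_zero, zero_add]
      · rw [h0 x hxK, h0' x hxK, zero_smul, smul_zero, zero_add])
    (fun q hq hne => hN q hq (right_ne_zero_of_mul hne))
  have es : (fun x => χ x * h x * inner ℝ (N x) u + (1 - χ x) * h x * inner ℝ (N x) u)
      = fun x => h x * inner ℝ (N x) u := by
    funext x
    ring
  refine ⟨by simpa only [Pi.add_def, es] using i₁.add i₂, ?_⟩
  have hS := hΩ.isClosed_compl
  have hi₁ : IntegrableOn (fun x => (χ x • h' x + h x • fderiv ℝ χ x) u) Ωᶜ := by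
    refine integrableOn_of_continuousOn_of_eq_zero hS hK (((hχ.continuous.continuousOn.smul
      hc').add (hc.smul hχ'.continuousOn)).clm_apply continuousOn_const) fun x hx => ?_
    simp [h0 x hx, h0' x hx]
  have hi₂ : IntegrableOn (fun x => ((1 - χ x) • h' x + h x • (-fderiv ℝ χ x)) u) Ωᶜ := by
    refine integrableOn_of_continuousOn_of_eq_zero hS hK (((continuousOn_const.sub
      hχ.continuous.continuousOn).smul hc').add
      (hc.smul hχ'.neg.continuousOn) |>.clm_apply continuousOn_const) fun x hx => ?_
    simp [h0 x hx, h0' x hx]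
  have e3 : ∫ x in Ωᶜ, h' x u = (∫ x in Ωᶜ, (χ x • h' x + h x • fderiv ℝ χ x) u)
      + ∫ x in Ωᶜ, ((1 - χ x) • h' x + h x • (-fderiv ℝ χ x)) u := by
    rw [← integral_add hi₁ hi₂]
    refine integral_congr_ae (Eventually.of_forall fun x => ?_)
    simp
    ring
  have e4 := integral_add i₁ i₂
  simp only [es] at e4
  rw [e3, f₁, f₂, ← neg_add, e4]

theorem isNormalAt_of_hasFDerivAt {Ω : Set V} {ρ : V → ℝ} {L : V →L[ℝ] ℝ} {p : V}
    (h : HasFDerivAt ρ L p) (hL : L ≠ 0) (h0 : ρ p = 0) (hΩ : ∀ᶠ x in 𝓝 p, (x ∈ Ω ↔ ρ x < 0)) :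
    IsNormalAt Ω p (‖L‖⁻¹ • (InnerProductSpace.toDual ℝ V).symm L) := by
  have hpos : 0 < ‖L‖ := norm_pos_iff.2 hL
  refine ⟨?_, ρ, ‖L‖, hpos, ?_, h0, hΩ⟩
  · rw [norm_smul, norm_inv, norm_norm, LinearIsometryEquiv.norm_map, inv_mul_cancel₀ hpos.ne']
  · convert h using 1
    ext w
    change ‖L‖ * inner ℝ (‖L‖⁻¹ • (InnerProductSpace.toDual ℝ V).symm L) w = L w
    rw [inner_smul_left, InnerProductSpace.toDual_symm_apply]
    simp [hpos.ne']

/-- Used to pass from the complement of Ω to an epigraph coinciding with it near the support of g.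
-/
theorem continuousOn_of_agree {Y X : Type*} [TopologicalSpace Y] [T2Space Y] [TopologicalSpace X]
    [Zero X] {S D K W : Set Y} (hK : IsCompact K) (hW : IsOpen W) (hKW : K ⊆ W)
    (hSD : ∀ x ∈ W, (x ∈ S ↔ x ∈ D)) {g : Y → X} (hg : ContinuousOn g S)
    (hg0 : ∀ x ∉ K, g x = 0) : ContinuousOn g D := by
  intro x hx
  by_cases hxW : x ∈ W
  · refine (hg x ((hSD x hxW).2 hx)).mono_of_mem_nhdsWithin ?_
    filter_upwards [self_mem_nhdsWithin, mem_nhdsWithin_of_mem_nhds (hW.mem_nhds hxW)] with y hy hyW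
      using (hSD y hyW).2 hy
  · have hxK : x ∉ K := fun hxK => hxW (hKW hxK)
    refine ((continuousAt_const (y := (0 : X))).congr ?_).continuousWithinAt
    filter_upwards [hK.isClosed.isOpen_compl.mem_nhds hxK] with y hy using (hg0 y hy).symm

/-- Inside W, Ωᶜ is the epigraph and the frontier is the graph, so the epigraph formula applies. The
unit normal is (e - ∇φ)/√(1+|∇φ|²), and its denominator cancels the area element. -/
theorem gaussGreenOn_graph {Ω W : Set V} (hΩ : IsOpen Ω) (N : V → V) (u : V) {e : V}
    (he : ‖e‖ = 1) {φ : (ℝ ∙ e)ᗮ → ℝ} (hφ : ContDiff ℝ 1 φ) (hW : IsOpen W)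
    (hWΩ : ∀ x ∈ W, (x ∈ Ω ↔ inner ℝ e x < φ (hproj e x))) : GaussGreenOn Ω N u W := by
  intro h h' K hK hKW hc hc' hd h0 h0' hN
  have hφc := hφ.continuous
  set D := {x : V | φ (hproj e x) ≤ inner ℝ e x} with hD
  have hDc : IsClosed D := isClosed_le (by fun_prop) (by fun_prop)
  have hWD : ∀ x ∈ W, (x ∈ Ωᶜ ↔ x ∈ D) := fun x hx => by
    rw [mem_compl_iff, hWΩ x hx, not_lt]
    rfl
  have hmain := integral_epigraph he hφ hK (continuousOn_of_agree hK hW hKW hWD hc h0) (continuousOn_of_agree hK hW hKW hWD hc' h0')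
    (fun x hx => by
      by_cases hxW : x ∈ W
      · refine hd x (mem_interior_iff_mem_nhds.2 ?_)
        have ho : IsOpen {x : V | φ (hproj e x) < inner ℝ e x} :=
          isOpen_lt (by fun_prop) (by fun_prop)
        filter_upwards [ho.mem_nhds hx, hW.mem_nhds hxW] with y hy hyW
          using (hWD y hyW).2 (le_of_lt hy)
      · have hxK : x ∉ K := fun hxK => hxW (hKW hxK)
        rw [h0' x hxK]
        refine (hasFDerivAt_const (0 : ℝ) x).congr_of_eventuallyEq ?_
        filter_upwards [hK.isClosed.isOpen_compl.mem_nhds hxK] with y hy using h0 y hy)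
    h0 h0' u
  have hI : ∫ x in Ωᶜ, h' x u = ∫ x in D, h' x u := by
    rw [← integral_indicator hΩ.isClosed_compl.measurableSet, ← integral_indicator hDc.measurableSet]
    congr 1
    funext x
    by_cases hxK : x ∈ K
    · by_cases hx : x ∈ D
      · rw [indicator_of_mem hx, indicator_of_mem ((hWD x (hKW hxK)).2 hx)]
      · rw [indicator_of_notMem hx, indicator_of_notMem fun h => hx ((hWD x (hKW hxK)).1 h)]
    · classical
      rw [indicator_apply, indicator_apply]
      simp [h0' x hxK]
  have hinner (y : (ℝ ∙ e)ᗮ) : inner ℝ e (graphMap e φ y) = φ y := inner_add_smul he y _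
  have hproj (y : (ℝ ∙ e)ᗮ) : hproj e (graphMap e φ y) = y := hproj_add_smul e y _
  have hfr : ∀ x ∈ W, (x ∈ frontier Ω ↔ x ∈ range (graphMap e φ)) := by
    intro x hxW
    have hr : x ∈ range (graphMap e φ) ↔ inner ℝ e x = φ (GBC.hproj e x) := by
      constructor
      · rintro ⟨y, rfl⟩
        rw [hinner, hproj]
      · intro hx
        exact ⟨GBC.hproj e x, by rw [graphMap, ← hx, hproj_add_inner_smul he]⟩
    rw [hr, hΩ.frontier_eq]
    constructor
    · rintro ⟨hcl, hxΩ⟩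
      rw [hWΩ x hxW, not_lt] at hxΩ
      refine le_antisymm (not_lt.1 fun hlt => ?_) hxΩ
      have ho : IsOpen ({x : V | φ (GBC.hproj e x) < inner ℝ e x} ∩ W) :=
        (isOpen_lt (by fun_prop) (by fun_prop)).inter hW
      obtain ⟨y, ⟨hy, hyW⟩, hyΩ⟩ := mem_closure_iff.1 hcl _ ho ⟨hlt, hxW⟩
      exact lt_asymm hy ((hWΩ y hyW).1 hyΩ)
    · intro hx
      refine ⟨?_, fun hxΩ => absurd ((hWΩ x hxW).1 hxΩ) (by rw [hx]; exact lt_irrefl _)⟩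
      have ht : Tendsto (fun t : ℝ => x - t • e) (𝓝[>] 0) (𝓝 x) := by
        have : Continuous fun t : ℝ => x - t • e := by fun_prop
        simpa using (this.tendsto 0).mono_left nhdsWithin_le_nhds
      refine mem_closure_of_tendsto ht ?_
      filter_upwards [ht.eventually (hW.mem_nhds hxW), self_mem_nhdsWithin] with t htW ht0
      rw [hWΩ _ htW, inner_sub_right, inner_smul_right, real_inner_self_eq_norm_sq, he, map_sub,
        map_smul, hproj_self, smul_zero, sub_zero, hx]
      have : 0 < t := ht0
      linarith
  have hk (y : (ℝ ∙ e)ᗮ) : Real.sqrt (1 + ‖fderiv ℝ φ y‖ ^ 2) *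
      (h (graphMap e φ y) * inner ℝ (N (graphMap e φ y)) u) =
      (inner ℝ e u - fderiv ℝ φ y (GBC.hproj e u)) * h (graphMap e φ y) := by
    by_cases hh : h (graphMap e φ y) = 0
    · simp [hh]
    have hqW : graphMap e φ y ∈ W := hKW (by
      by_contra hq
      exact hh (h0 _ hq))
    have hqf : graphMap e φ y ∈ frontier Ω := (hfr _ hqW).2 ⟨y, rfl⟩
    set L : V →L[ℝ] ℝ := innerSL ℝ e - (fderiv ℝ φ y).comp (GBC.hproj e) with hL
    have hLap (w : V) : L w = inner ℝ e w - fderiv ℝ φ y (GBC.hproj e w) := rfl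
    have hρ : HasFDerivAt (fun x => inner ℝ e x - φ (GBC.hproj e x)) L (graphMap e φ y) := by
      refine ((innerSL ℝ e).hasFDerivAt).sub ?_
      refine HasFDerivAt.comp (graphMap e φ y) ?_ (GBC.hproj e).hasFDerivAt
      rw [hproj]
      exact (hφ.differentiable one_ne_zero y).hasFDerivAt
    have hLn : ‖L‖ = Real.sqrt (1 + ‖fderiv ℝ φ y‖ ^ 2) := by
      set w := (InnerProductSpace.toDual ℝ (ℝ ∙ e)ᗮ).symm (fderiv ℝ φ y) with hw
      have h1 : L = InnerProductSpace.toDual ℝ V (e - (w : V)) := by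
        ext z
        rw [hLap, InnerProductSpace.toDual_apply_apply, inner_sub_left,
          ← InnerProductSpace.toDual_symm_apply, ← hw]
        congr 1
        exact (Submodule.inner_orthogonalProjectionOnto_eq_of_mem_left w z)
      rw [h1, LinearIsometryEquiv.norm_map, eq_comm, Real.sqrt_eq_iff_mul_self_eq (by positivity)
        (norm_nonneg _), ← pow_two, norm_sub_sq_real, he, inner_coe_orthogonal]
      have : ‖(w : V)‖ = ‖fderiv ℝ φ y‖ := by
        exact LinearIsometryEquiv.norm_map (InnerProductSpace.toDual ℝ (ℝ ∙ e)ᗮ).symm (fderiv ℝ φ y)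
      rw [this]
      ring
    have hL0 : L ≠ 0 := by
      rw [← norm_pos_iff, hLn]
      positivity
    have hnor := isNormalAt_of_hasFDerivAt (Ω := Ω) hρ hL0 (by rw [hinner, hproj, sub_self]) (by
      filter_upwards [hW.mem_nhds hqW] with x hx
      rw [hWΩ x hx, sub_neg])
    -- The prescribed field N is arbitrary where h = 0; elsewhere uniqueness of the normal
    -- identifies it.
    rw [(hN _ hqf hh).unique hnor, inner_smul_left, InnerProductSpace.toDual_symm_apply, ← hLn,
      hLap]
    have : ‖L‖ ≠ 0 := norm_ne_zero_iff.2 hL0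
    simp
    field_simp
  have hki : Integrable fun y => Real.sqrt (1 + ‖fderiv ℝ φ y‖ ^ 2) *
      (h (graphMap e φ y) * inner ℝ (N (graphMap e φ y)) u) := by
    simp only [hk]
    have hφ' : Continuous (fderiv ℝ φ) := hφ.continuous_fderiv one_ne_zero
    rw [← integrableOn_univ]
    refine integrableOn_of_continuousOn_of_eq_zero isClosed_univ
      (hK.image (GBC.hproj e).continuous) (Continuous.continuousOn ?_) fun y hy => ?_
    · refine Continuous.mul (by fun_prop) ((continuousOn_of_agree hK hW hKW hWD hc h0).comp_continuous ?_ fun y => ?_)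
      · unfold graphMap
        fun_prop
      · change φ (GBC.hproj e (graphMap e φ y)) ≤ inner ℝ e (graphMap e φ y)
        rw [hinner, hproj]
    · rw [h0 _ fun hyK => hy ⟨_, hyK, hproj y⟩, mul_zero]
  have hRm : MeasurableSet (range (graphMap e φ)) :=
    (measurableEmbedding_of_leftInverse (P := GBC.hproj e) (hasStrictFDerivAt_graphMap hφ)
      hproj).measurableSet_range
  have hind : (frontier Ω).indicator (fun x => h x * inner ℝ (N x) u)
      = (range (graphMap e φ)).indicator fun x => h x * inner ℝ (N x) u := by
    funext x
    by_cases hxK : x ∈ K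
    · by_cases hx : x ∈ frontier Ω
      · rw [indicator_of_mem hx, indicator_of_mem ((hfr x (hKW hxK)).1 hx)]
      · rw [indicator_of_notMem hx, indicator_of_notMem fun h => hx ((hfr x (hKW hxK)).2 h)]
    · classical
      rw [indicator_apply, indicator_apply]
      simp [h0 x hxK]
  have hfm : MeasurableSet (frontier Ω) := isClosed_frontier.measurableSet
  constructor
  · rw [← integrable_indicator_iff hfm, hind, integrable_indicator_iff hRm]
    exact integrableOn_range_graphMap he hφ hki
  · rw [hI, hmain, ← integral_indicator hfm, hind, integral_indicator hRm,
      setIntegral_range_graphMap he hφ]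
    simp only [hk]

/-- The Gauss-Green formula on the complement of an open set whose boundary is `C¹` at the points
of the support of the integrand. -/
theorem gaussGreen {Ω K : Set V} (hΩ : IsOpen Ω) (hK : IsCompact K) {N : V → V} (u : V)
    {h : V → ℝ} (hus : UniqueDiffOn ℝ Ωᶜ) (hh : ContDiffOn ℝ 1 h Ωᶜ) (h0 : ∀ x ∉ K, h x = 0)
    (hC1 : ∀ p ∈ K ∩ frontier Ω, IsC1GraphAt Ω p)
    (hN : ∀ q ∈ frontier Ω, h q ≠ 0 → IsNormalAt Ω q (N q)) :
    IntegrableOn (fun x => h x * inner ℝ (N x) u) (frontier Ω) μHE[Module.finrank ℝ V - 1] ∧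
      ∫ x in Ωᶜ, fderivWithin ℝ h Ωᶜ x u =
        - ∫ x in frontier Ω, h x * inner ℝ (N x) u ∂μHE[Module.finrank ℝ V - 1] := by
  have hcov : ∃ W, IsOpen W ∧ K ⊆ W ∧ GaussGreenOn Ω N u W := by
    -- Compactness reduces the formula to small open sets, each either missing the frontier or lying
    -- in one graph chart.
    refine hK.induction_on (p := fun S => ∃ W, IsOpen W ∧ S ⊆ W ∧ GaussGreenOn Ω N u W)
      ⟨∅, isOpen_empty, subset_rfl, gaussGreenOn_of_disjoint_frontier hΩ N u (empty_disjoint _)⟩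
      (fun S T hST ⟨W, hW, hTW, hG⟩ => ⟨W, hW, hST.trans hTW, hG⟩)
      (fun S T ⟨W, hW, hSW, hG⟩ ⟨W', hW', hTW, hG'⟩ =>
        ⟨W ∪ W', hW.union hW', union_subset_union hSW hTW, hG.union hΩ hW hW' hG'⟩) ?_
    intro p hp
    by_cases hpf : p ∈ frontier Ω
    · obtain ⟨e, he, φ, hφ, hev⟩ := (hC1 p ⟨hp, hpf⟩).exists_contDiff
      obtain ⟨W, hWsub, hW, hpW⟩ := mem_nhds_iff.1 hev
      exact ⟨W, mem_nhdsWithin_of_mem_nhds (hW.mem_nhds hpW), W, hW, subset_rfl,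
        gaussGreenOn_graph hΩ N u he hφ hW fun x hx => hWsub hx⟩
    · exact ⟨(frontier Ω)ᶜ, mem_nhdsWithin_of_mem_nhds (isClosed_frontier.isOpen_compl.mem_nhds hpf),
        _, isClosed_frontier.isOpen_compl, subset_rfl,
        gaussGreenOn_of_disjoint_frontier hΩ N u disjoint_compl_left⟩
  obtain ⟨W, -, hKW, hG⟩ := hcov
  have hz : ∀ x ∈ Ωᶜ, x ∉ K → fderivWithin ℝ h Ωᶜ x = 0 := by
    intro x hx hxK
    have : h =ᶠ[𝓝[Ωᶜ] x] fun _ => 0 := by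
      filter_upwards [mem_nhdsWithin_of_mem_nhds (hK.isClosed.isOpen_compl.mem_nhds hxK)] with y hy
        using h0 y hy
    rw [this.fderivWithin_eq (h0 x hxK), fderivWithin_fun_const]
    rfl
  have hcd : ContinuousOn (fderivWithin ℝ h Ωᶜ) Ωᶜ := hh.continuousOn_fderivWithin hus le_rfl
  -- The derivative within Ωᶜ has no meaning inside Ω, so it is truncated in order to vanish off K
  -- everywhere.
  have := hG h (Ωᶜ.indicator (fderivWithin ℝ h Ωᶜ)) K hK hKW hh.continuousOn
    (hcd.congr fun x hx => indicator_of_mem hx _) (fun x hx => by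
      rw [indicator_of_mem (interior_subset hx)]
      exact ((hh.differentiableOn one_ne_zero x (interior_subset hx)).hasFDerivWithinAt).hasFDerivAt
        (mem_interior_iff_mem_nhds.1 hx)) h0
    (fun x hxK => by
      by_cases hx : x ∈ Ωᶜ
      · rw [indicator_of_mem hx, hz x hx hxK]
      · rw [indicator_of_notMem hx]) hN
  refine ⟨this.1, ?_⟩
  rw [← this.2]
  refine setIntegral_congr_fun hΩ.isClosed_compl.measurableSet fun x hx => ?_
  rw [indicator_of_mem hx]

end GaussGreen

end GBC

namespace GBC

/-! ### Lipschitz boundaries: height functions, cones, finite area -/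

section LipschitzBoundary

variable {n : ℕ} {Ω : Set (E n)} {p : E n}

/-- `ρ` is a Lipschitz function with unit slope in the direction `e`, and `Ω = {ρ < 0}`
near `p`. -/
structure IsGraphFunctionAt (Ω : Set (E n)) (p e : E n) (ρ : E n → ℝ) : Prop where
  norm_eq_one : ‖e‖ = 1
  exists_lipschitz : ∃ C : NNReal, LipschitzWith C ρ
  translate : ∀ x t, ρ (x + t • e) = ρ x + t
  eventually_mem_iff : ∀ᶠ x in 𝓝 p, (x ∈ Ω ↔ ρ x < 0)

/-- The height above the graph, ρ(x) = ⟨e, x⟩ - φ(x - ⟨e, x⟩ e). -/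
theorem HasLipschitzBoundary.exists_isGraphFunctionAt (hL : HasLipschitzBoundary Ω)
    (hp : p ∈ frontier Ω) : ∃ e ρ, IsGraphFunctionAt Ω p e ρ := by
  obtain ⟨e, he, K, φ, hφ, hev⟩ := hL p hp
  refine ⟨e, fun x => inner ℝ e x - φ (x - inner ℝ e x • e), he, ?_, ?_, ?_⟩
  · have h1 : LipschitzWith ‖innerSL ℝ e‖₊ (fun x : E n => inner ℝ e x) :=
      (innerSL ℝ e).lipschitz
    have h2 : LipschitzWith (1 + ‖innerSL ℝ e‖₊) (fun x : E n => x - inner ℝ e x • e) := by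
      refine LipschitzWith.sub LipschitzWith.id (LipschitzWith.of_dist_le_mul fun x y => ?_)
      rw [dist_eq_norm, ← sub_smul, norm_smul, he, mul_one, ← dist_eq_norm]
      exact h1.dist_le_mul x y
    exact ⟨_, h1.sub (hφ.comp h2)⟩
  · intro x t
    simp only [inner_add_right, inner_smul_right, real_inner_self_eq_norm_sq, he]
    have : x + t • e - (inner ℝ e x + t * 1 ^ 2) • e = x - inner ℝ e x • e := by
      rw [add_smul, one_pow, mul_one]
      abel
    rw [this]
    ring
  · filter_upwards [hev] with x hx
    rw [hx, sub_neg]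

variable {e : E n} {ρ : E n → ℝ}

theorem IsGraphFunctionAt.continuous (h : IsGraphFunctionAt Ω p e ρ) : Continuous ρ :=
  h.exists_lipschitz.choose_spec.continuous

/-- The map x ↦ x - ρ(x) e is thus the projection along e onto the zero set of ρ; it transports
information on the boundary to a full neighbourhood. -/
theorem IsGraphFunctionAt.apply_sub (h : IsGraphFunctionAt Ω p e ρ) (x : E n) :
    ρ (x - ρ x • e) = 0 := by
  rw [sub_eq_add_neg, ← neg_smul, h.translate]
  ring

/-- Since ρ has slope 1 along e, points just below its zero set belong to Ω, so no zero is isolated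
from Ω. -/
theorem IsGraphFunctionAt.eventually_mem_frontier_iff (h : IsGraphFunctionAt Ω p e ρ)
    (hΩ : IsOpen Ω) : ∀ᶠ x in 𝓝 p, (x ∈ frontier Ω ↔ ρ x = 0) := by
  obtain ⟨W, hWΩ, hW, hpW⟩ := mem_nhds_iff.1 h.eventually_mem_iff
  replace hWΩ : ∀ x ∈ W, (x ∈ Ω ↔ ρ x < 0) := fun x hx => hWΩ hx
  filter_upwards [hW.mem_nhds hpW] with x hxW
  rw [hΩ.frontier_eq]
  constructor
  · rintro ⟨hcl, hxΩ⟩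
    rw [hWΩ x hxW, not_lt] at hxΩ
    refine le_antisymm (not_lt.1 fun hlt => ?_) hxΩ
    have ho : IsOpen ({x : E n | 0 < ρ x} ∩ W) := (isOpen_lt continuous_const h.continuous).inter hW
    obtain ⟨y, ⟨hy, hyW⟩, hyΩ⟩ := mem_closure_iff.1 hcl _ ho ⟨hlt, hxW⟩
    exact lt_asymm hy ((hWΩ y hyW).1 hyΩ)
  · intro hx
    refine ⟨?_, fun hxΩ => absurd ((hWΩ x hxW).1 hxΩ) (by rw [hx]; exact lt_irrefl _)⟩
    have ht : Tendsto (fun t : ℝ => x + (-t) • e) (𝓝[>] 0) (𝓝 x) := by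
      have : Continuous fun t : ℝ => x + (-t) • e := by fun_prop
      simpa using (this.tendsto 0).mono_left nhdsWithin_le_nhds
    refine mem_closure_of_tendsto ht ?_
    filter_upwards [ht.eventually (hW.mem_nhds hxW), self_mem_nhdsWithin] with t htW ht0
    rw [hWΩ _ htW, h.translate, hx]
    have : 0 < t := ht0
    linarith

theorem IsGraphFunctionAt.apply_eq_zero (h : IsGraphFunctionAt Ω p e ρ) (hΩ : IsOpen Ω)
    (hp : p ∈ frontier Ω) : ρ p = 0 :=
  (h.eventually_mem_frontier_iff hΩ).self_of_nhds.1 hp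

theorem IsGraphFunctionAt.tendsto_sub (h : IsGraphFunctionAt Ω p e ρ) (hΩ : IsOpen Ω)
    (hp : p ∈ frontier Ω) : Tendsto (fun x => x - ρ x • e) (𝓝 p) (𝓝 p) := by
  have hc : Continuous fun x => x - ρ x • e := continuous_id.sub (h.continuous.smul continuous_const)
  simpa [h.apply_eq_zero hΩ hp] using hc.tendsto p

theorem mem_interior_or_mem_frontier (hΩ : IsOpen Ω) {x : E n} (hx : x ∈ Ωᶜ) :
    x ∈ interior Ωᶜ ∨ x ∈ frontier Ω := by
  rw [← frontier_compl, frontier, hΩ.isClosed_compl.closure_eq]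
  by_cases h : x ∈ interior Ωᶜ
  · exact Or.inl h
  · exact Or.inr ⟨hx, h⟩

/-- Exterior cone condition: near a boundary point the complement contains a convex cone with
nonempty interior, whose opening is set by the Lipschitz constant of ρ. Derivatives within the
complement are therefore unique up to the boundary. -/
theorem HasLipschitzBoundary.uniqueDiffOn_compl (hL : HasLipschitzBoundary Ω) (hΩ : IsOpen Ω) :
    UniqueDiffOn ℝ Ωᶜ := by
  intro p hp
  rcases mem_interior_or_mem_frontier hΩ hp with hpi | hpf
  · exact uniqueDiffWithinAt_of_mem_nhds (mem_interior_iff_mem_nhds.1 hpi)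
  obtain ⟨e, ρ, h⟩ := hL.exists_isGraphFunctionAt hpf
  obtain ⟨C, hC⟩ := h.exists_lipschitz
  have he := h.norm_eq_one
  set S : Set (E n) := {x | (C : ℝ) * ‖(x - p) - inner ℝ e (x - p) • e‖ ≤ inner ℝ e (x - p)}
  have hconv : Convex ℝ S := by
    have hf : ConvexOn ℝ univ fun x : E n =>
        (C : ℝ) * ‖(x - p) - inner ℝ e (x - p) • e‖ - inner ℝ e (x - p) := by
      let T : E n →L[ℝ] E n := ContinuousLinearMap.id ℝ (E n) - (innerSL ℝ e).smulRight e
      have h1 : ConvexOn ℝ univ fun x : E n => ‖T x - T p‖ := by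
        have := (convexOn_norm (E := E n) convex_univ).comp_affineMap
          (T.toLinearMap.toAffineMap - AffineMap.const ℝ (E n) (T p))
        simpa [Function.comp_def] using this
      have h2 : ConcaveOn ℝ univ fun x : E n => inner ℝ e x - inner ℝ e p := by
        refine ConcaveOn.sub ?_ (convexOn_const _ convex_univ)
        exact (innerSL ℝ e).toLinearMap.concaveOn convex_univ
      have := (h1.smul C.2).sub h2
      refine this.congr fun x _ => ?_
      simp only [T, smul_eq_mul, Pi.sub_apply, inner_sub_right, _root_.sub_apply,
        ContinuousLinearMap.id_apply, ContinuousLinearMap.smulRight_apply, innerSL_apply_apply]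
      congr 3
      rw [sub_smul]
      abel
    have := hf.convex_le 0
    simpa [S, sub_nonpos] using this
  have hint : (interior S).Nonempty := by
    refine ⟨p + e, mem_interior_iff_mem_nhds.2 ?_⟩
    have hc : Continuous fun x : E n =>
        inner ℝ e (x - p) - (C : ℝ) * ‖(x - p) - inner ℝ e (x - p) • e‖ := by fun_prop
    have hpos : (0 : ℝ) < inner ℝ e (p + e - p)
        - (C : ℝ) * ‖(p + e - p) - inner ℝ e (p + e - p) • e‖ := by
      simp [he]
    filter_upwards [hc.continuousAt.eventually (lt_mem_nhds hpos)] with x hx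
    exact (sub_pos.1 hx).le
  have hpS : p ∈ S := by simp [S]
  refine (uniqueDiffOn_convex hconv hint p hpS).mono_nhds ?_
  refine le_inf inf_le_left (le_principal_iff.2 ?_)
  filter_upwards [self_mem_nhdsWithin, mem_nhdsWithin_of_mem_nhds h.eventually_mem_iff]
    with x hxS hx
  rw [mem_compl_iff, hx, not_lt]
  have h0 := h.apply_eq_zero hΩ hpf
  set v := (x - p) - inner ℝ e (x - p) • e with hv
  have hx' : x = (p + v) + inner ℝ e (x - p) • e := by
    rw [hv]
    abel
  rw [hx', h.translate]
  have h1 := hC.dist_le_mul (p + v) p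
  rw [Real.dist_eq, h0, dist_eq_norm, add_sub_cancel_left, sub_zero] at h1
  have h2 := neg_abs_le (ρ (p + v))
  have h3 : (C : ℝ) * ‖v‖ ≤ inner ℝ e (x - p) := hxS
  linarith

/-- Moving a boundary point by t e makes ρ equal to t > 0, an open condition. This supplies symmetry
of second derivatives at the boundary. -/
theorem HasLipschitzBoundary.subset_closure_interior (hL : HasLipschitzBoundary Ω)
    (hΩ : IsOpen Ω) : Ωᶜ ⊆ closure (interior Ωᶜ) := by
  intro p hp
  rcases mem_interior_or_mem_frontier hΩ hp with hpi | hpf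
  · exact subset_closure hpi
  obtain ⟨e, ρ, h⟩ := hL.exists_isGraphFunctionAt hpf
  have ht : Tendsto (fun t : ℝ => p + t • e) (𝓝[>] 0) (𝓝 p) := by
    have : Continuous fun t : ℝ => p + t • e := by fun_prop
    simpa using (this.tendsto 0).mono_left nhdsWithin_le_nhds
  refine mem_closure_of_tendsto ht ?_
  filter_upwards [ht.eventually h.eventually_mem_iff.eventually_nhds, self_mem_nhdsWithin]
    with t ht1 ht0
  refine mem_interior_iff_mem_nhds.2 ?_
  have hpos : 0 < ρ (p + t • e) := by
    rw [h.translate, h.apply_eq_zero hΩ hpf, zero_add]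
    exact ht0
  filter_upwards [ht1, h.continuous.continuousAt.eventually (lt_mem_nhds hpos)] with x hx hx0
  rw [mem_compl_iff, hx]
  exact not_lt.2 (le_of_lt hx0)

/-- Locally the boundary lies in the Lipschitz image of a ball of a hyperplane; the compact boundary
is covered by finitely many such pieces. -/
theorem HasLipschitzBoundary.measure_frontier_lt_top (hL : HasLipschitzBoundary Ω)
    (hΩ : IsOpen Ω) (hb : Bornology.IsBounded Ω) : μHE[n - 1] (frontier Ω) < ⊤ := by
  have hcomp : IsCompact (frontier Ω) :=
    Metric.isCompact_of_isClosed_isBounded isClosed_frontier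
      (hb.closure.subset frontier_subset_closure)
  refine hcomp.measure_lt_top_of_nhdsWithin fun p hp => ?_
  obtain ⟨e, ρ, h⟩ := hL.exists_isGraphFunctionAt hp
  obtain ⟨C, hC⟩ := h.exists_lipschitz
  have he := h.norm_eq_one
  have he0 : e ≠ 0 := by rintro rfl; simp at he
  have hr : n - 1 = Module.finrank ℝ (ℝ ∙ e)ᗮ := by
    have := (ℝ ∙ e).finrank_add_finrank_orthogonal
    rw [finrank_span_singleton he0, finrank_euclideanSpace_fin] at this
    omega
  let g : (ℝ ∙ e)ᗮ → E n := fun y => (y : E n) - ρ y • e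
  have hg : LipschitzWith (1 + C) g := by
    refine LipschitzWith.sub (LipschitzWith.subtype_val _) (LipschitzWith.of_dist_le_mul fun x y => ?_)
    rw [dist_eq_norm, ← sub_smul, norm_smul, he, mul_one, ← dist_eq_norm]
    exact hC.dist_le_mul x y
  set B := Metric.closedBall (hproj e p) 1
  refine ⟨frontier Ω ∩ g '' B, ?_, ?_⟩
  · have hev : ∀ᶠ x in 𝓝 p, hproj e x ∈ B :=
      (hproj e).continuous.continuousAt.eventually (Metric.closedBall_mem_nhds _ one_pos)
    filter_upwards [self_mem_nhdsWithin, mem_nhdsWithin_of_mem_nhds hev,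
      mem_nhdsWithin_of_mem_nhds (h.eventually_mem_frontier_iff hΩ)] with x hx hxB hxf
    refine ⟨hx, hproj e x, hxB, ?_⟩
    have h1 : ρ x = ρ (hproj e x) + inner ℝ e x := by
      conv_lhs => rw [← hproj_add_inner_smul he x]
      exact h.translate _ _
    have h2 : ρ (hproj e x) = - inner ℝ e x := by linarith [hxf.1 hx]
    simp only [g]
    rw [h2, neg_smul, sub_neg_eq_add, hproj_add_inner_smul he]
  · refine (measure_mono inter_subset_right).trans_lt ?_
    rw [hr]
    refine ((hg.lipschitzOnWith (s := B)).euclideanHausdorffMeasure_image_le _).trans_lt ?_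
    rw [InnerProductSpace.euclideanHausdorffMeasure_eq_volume]
    exact ENNReal.mul_lt_top (by finiteness) measure_closedBall_lt_top

/-- The projection along e maps a ball around p to a connected subset of the boundary containing p,
hence into the component of p. -/
theorem IsGraphFunctionAt.eventually_eq_of_const (h : IsGraphFunctionAt Ω p e ρ) (hΩ : IsOpen Ω)
    (hp : p ∈ frontier Ω) {X : Type*} {f : E n → X}
    (hconst : ∀ q ∈ connectedComponentIn (frontier Ω) p, f q = f p) :
    ∀ᶠ x in 𝓝 p, x - ρ x • e ∈ frontier Ω ∧ f (x - ρ x • e) = f p := by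
  have h1 := (h.tendsto_sub hΩ hp).eventually (h.eventually_mem_frontier_iff hΩ)
  obtain ⟨r, hr, hball⟩ := Metric.eventually_nhds_iff_ball.1 h1
  have hmem : ∀ x ∈ Metric.ball p r, x - ρ x • e ∈ frontier Ω :=
    fun x hx => (hball x hx).2 (h.apply_sub x)
  have hc : Continuous fun x => x - ρ x • e := continuous_id.sub (h.continuous.smul continuous_const)
  have hpre : IsPreconnected ((fun x => x - ρ x • e) '' Metric.ball p r) :=
    (convex_ball p r).isPreconnected.image _ hc.continuousOn
  have hsub := hpre.subset_connectedComponentIn (x := p) (F := frontier Ω)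
    ⟨p, Metric.mem_ball_self hr, by simp [h.apply_eq_zero hΩ hp]⟩ (image_subset_iff.2 hmem)
  filter_upwards [Metric.ball_mem_nhds p hr] with x hx
  exact ⟨hmem x hx, hconst _ (hsub ⟨x, hx, rfl⟩)⟩

end LipschitzBoundary

end GBC

namespace GBC

/-! ### C² regularity of the boundary where Df ≠ 0 -/

section Regularity

variable {n m : ℕ} {Ω : Set (E n)} {p e : E n} {ρ : E n → ℝ}

/-- Expanding g(y - ρ(y) e) = c to first order, with ρ merely Lipschitz, gives A(y - x) - (ρ(y) -
ρ(x)) A e = o(|y - x|). If A e were 0 then A would vanish; dividing by A e shows that ρ is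
differentiable. -/
theorem hasFDerivAt_of_const_along {s : Set (E n)} {g : E n → ℝ} {A : E n →L[ℝ] ℝ} {x : E n}
    {c : ℝ} {C : NNReal} (hC : LipschitzWith C ρ)
    (hA : HasFDerivWithinAt g A s (x - ρ x • e))
    (hev : ∀ᶠ y in 𝓝 x, y - ρ y • e ∈ s ∧ g (y - ρ y • e) = c) (hA0 : A ≠ 0) :
    A e ≠ 0 ∧ HasFDerivAt ρ ((A e)⁻¹ • A) x := by
  have hγ : Continuous fun y => y - ρ y • e := continuous_id.sub (hC.continuous.smul continuous_const)
  have ht : Tendsto (fun y => y - ρ y • e) (𝓝 x) (𝓝[s] (x - ρ x • e)) :=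
    tendsto_nhdsWithin_iff.2 ⟨hγ.tendsto x, hev.mono fun y hy => hy.1⟩
  have hbig : (fun y => y - ρ y • e - (x - ρ x • e)) =O[𝓝 x] fun y => y - x := by
    refine Asymptotics.IsBigO.of_bound (1 + C * ‖e‖) (Eventually.of_forall fun y => ?_)
    have h1 : y - ρ y • e - (x - ρ x • e) = (y - x) - (ρ y - ρ x) • e := by
      rw [sub_smul]
      abel
    have h2 : ‖ρ y - ρ x‖ ≤ C * ‖y - x‖ := by
      rw [← dist_eq_norm, ← dist_eq_norm]
      exact hC.dist_le_mul y x
    rw [h1]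
    calc ‖(y - x) - (ρ y - ρ x) • e‖ ≤ ‖y - x‖ + ‖(ρ y - ρ x) • e‖ := norm_sub_le _ _
      _ ≤ ‖y - x‖ + C * ‖y - x‖ * ‖e‖ := by rw [norm_smul]; gcongr
      _ = _ := by ring
  have ho : (fun y => A (y - x) - (ρ y - ρ x) * A e) =o[𝓝 x] fun y => y - x := by
    have h1 := (hA.isLittleO.comp_tendsto ht).trans_isBigO hbig
    refine (h1.neg_left).congr' ?_ EventuallyEq.rfl
    filter_upwards [hev] with y hy
    simp only [Function.comp_apply, hy.2, hev.self_of_nhds.2, map_sub, map_smul, smul_eq_mul]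
    ring
  have he : A e ≠ 0 := by
    intro he
    simp only [he, mul_zero, sub_zero] at ho
    have h0 : HasFDerivAt A (0 : E n →L[ℝ] ℝ) x := by
      refine HasFDerivAt.of_isLittleO ?_
      simpa using ho
    exact hA0 (A.hasFDerivAt.unique h0)
  refine ⟨he, HasFDerivAt.of_isLittleO ?_⟩
  refine (ho.const_mul_left (-(A e)⁻¹)).congr_left fun y => ?_
  simp only [_root_.smul_apply, smul_eq_mul]
  field_simp
  ring

/-- Write γ(x) = x - ρ(x) e. The formula Dρ = Dg(γ(x)) / Dg(γ(x))e, valid near p, has right side as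
regular as ρ itself, so ρ climbs from continuous to C¹ to C². It uses g only on the closed exterior
side and needs no extension into Ω. -/
theorem contDiffAt_of_const_along (hΩ : IsOpen Ω) (hus : UniqueDiffOn ℝ Ωᶜ)
    (h : IsGraphFunctionAt Ω p e ρ) (hp : p ∈ frontier Ω) {g : E n → ℝ} {c : ℝ}
    (hg : ContDiffOn ℝ ∞ g Ωᶜ) (hne : fderivWithin ℝ g Ωᶜ p ≠ 0)
    (hev : ∀ᶠ x in 𝓝 p, x - ρ x • e ∈ frontier Ω ∧ g (x - ρ x • e) = c) :
    ContDiffAt ℝ 2 ρ p := by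
  obtain ⟨C, hC⟩ := h.exists_lipschitz
  set s := Ωᶜ with hs
  have hfs : frontier Ω ⊆ s := fun x hx => by
    rw [hΩ.frontier_eq] at hx
    exact hx.2
  set A := fderivWithin ℝ g s with hAdef
  have hAc : ContDiffOn ℝ ∞ A s := hg.fderivWithin hus le_rfl
  have hAd : ∀ q ∈ s, HasFDerivWithinAt g (A q) s q := fun q hq =>
    (hg.differentiableOn (by simp) q hq).hasFDerivWithinAt
  obtain ⟨U₀, hU₀sub, hU₀, hpU₀⟩ := mem_nhds_iff.1 hev
  have hγc : Continuous fun x => x - ρ x • e := continuous_id.sub (h.continuous.smul continuous_const)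
  have hmaps : MapsTo (fun x => x - ρ x • e) U₀ s := fun x hx => hfs (hU₀sub hx).1
  have hevx : ∀ x ∈ U₀, ∀ᶠ y in 𝓝 x, y - ρ y • e ∈ s ∧ g (y - ρ y • e) = c := fun x hx => by
    filter_upwards [hU₀.mem_nhds hx] with y hy
    exact ⟨hmaps hy, (hU₀sub hy).2⟩
  have hγp : p - ρ p • e = p := by simp [h.apply_eq_zero hΩ hp]
  have hAp : A p e ≠ 0 := by
    refine (hasFDerivAt_of_const_along (x := p) hC ?_ (hevx p hpU₀) hne).1
    rw [hγp]
    exact hAd p (hfs hp)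
  have hAγ : ContinuousOn (fun x => A (x - ρ x • e) e) U₀ :=
    (hAc.continuousOn.comp hγc.continuousOn hmaps).clm_apply continuousOn_const
  set U := U₀ ∩ (fun x => A (x - ρ x • e) e) ⁻¹' {0}ᶜ
  have hU : IsOpen U := hAγ.isOpen_inter_preimage hU₀ isClosed_singleton.isOpen_compl
  have hpU : p ∈ U := by
    refine ⟨hpU₀, ?_⟩
    change A (p - ρ p • e) e ≠ 0
    rwa [hγp]
  have hder : ∀ x ∈ U, HasFDerivAt ρ ((A (x - ρ x • e) e)⁻¹ • A (x - ρ x • e)) x := fun x hx =>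
    (hasFDerivAt_of_const_along hC (hAd _ (hmaps hx.1)) (hevx x hx.1) (by
      intro h0
      exact hx.2 (by simp [h0]))).2
  have hfd : ∀ x ∈ U, fderiv ℝ ρ x = (A (x - ρ x • e) e)⁻¹ • A (x - ρ x • e) :=
    fun x hx => (hder x hx).fderiv
  have hdiff : DifferentiableOn ℝ ρ U := fun x hx => (hder x hx).differentiableAt.differentiableWithinAt
  have hstep (k : ℕ∞ω) (hk : k ≤ ∞) (hρ : ContDiffOn ℝ k ρ U) : ContDiffOn ℝ k (fderiv ℝ ρ) U := by
    have hγk : ContDiffOn ℝ k (fun x => x - ρ x • e) U := contDiffOn_id.sub (hρ.smul contDiffOn_const)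
    have h1 : ContDiffOn ℝ k (fun x => A (x - ρ x • e)) U :=
      (hAc.of_le hk).comp hγk (hmaps.mono_left inter_subset_left)
    have h2 : ContDiffOn ℝ k (fun x => A (x - ρ x • e) e) U := h1.clm_apply contDiffOn_const
    exact ((h2.inv fun x hx => hx.2).smul h1).congr hfd
  have h1 : ContDiffOn ℝ (0 + 1) ρ U := (contDiffOn_succ_iff_fderiv_of_isOpen hU).2
    ⟨hdiff, by simp, hstep 0 (by simp) (contDiffOn_zero.2 h.continuous.continuousOn)⟩
  rw [zero_add] at h1
  have h2 : ContDiffOn ℝ (1 + 1) ρ U := (contDiffOn_succ_iff_fderiv_of_isOpen hU).2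
    ⟨hdiff, by simp, hstep 1 (by exact_mod_cast le_top) h1⟩
  have : (1 : ℕ∞ω) + 1 = 2 := one_add_one_eq_two
  rw [this] at h2
  exact h2.contDiffAt (hU.mem_nhds hpU)

theorem IsGraphFunctionAt.isC1GraphAt (h : IsGraphFunctionAt Ω p e ρ) (hρ : ContDiffAt ℝ 2 ρ p) :
    IsC1GraphAt Ω p := by
  have he := h.norm_eq_one
  have hρx (x : E n) : ρ x = ρ (hproj e x) + inner ℝ e x := by
    conv_lhs => rw [← hproj_add_inner_smul he x]
    exact h.translate _ _
  refine ⟨e, he, fun y => -ρ y, ?_, ?_⟩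
  · have h1 : (fun y : (ℝ ∙ e)ᗮ => -ρ y) = fun y : (ℝ ∙ e)ᗮ => inner ℝ e p - ρ ((y : E n) + inner ℝ e p • e) := by
      funext y
      rw [h.translate]
      ring
    rw [h1]
    refine contDiffAt_const.sub (ContDiffAt.comp (hproj e p) ?_ ?_)
    · rw [hproj_add_inner_smul he]
      exact hρ.of_le one_le_two
    · exact (ℝ ∙ e)ᗮ.subtypeL.contDiff.contDiffAt.add contDiffAt_const
  · filter_upwards [h.eventually_mem_iff] with x hx
    rw [hx, hρx]
    constructor <;> intro <;> linarith

/-- The differential is nonzero because ρ has derivative 1 along e. -/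
theorem IsGraphFunctionAt.isDefiningFunctionAt (h : IsGraphFunctionAt Ω p e ρ)
    (hρ : ContDiffAt ℝ 2 ρ p) : IsDefiningFunctionAt Ω ρ p := by
  refine ⟨hρ, fun h0 => ?_, h.eventually_mem_iff⟩
  have h1 : HasFDerivAt ρ (0 : E n →L[ℝ] ℝ) p := by
    rw [← h0]
    exact (hρ.differentiableAt two_ne_zero).hasFDerivAt
  have h2 : HasDerivAt (fun t : ℝ => p + t • e) e 0 := by
    simpa using ((hasDerivAt_id (0 : ℝ)).smul_const e).const_add p
  have h3 : HasDerivAt (fun t : ℝ => ρ (p + t • e)) ((0 : E n →L[ℝ] ℝ) e) 0 := by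
    refine HasFDerivAt.comp_hasDerivAt (0 : ℝ) ?_ h2
    simpa using h1
  have h4 : HasDerivAt (fun t : ℝ => ρ (p + t • e)) 1 0 := by
    simp only [h.translate]
    exact (hasDerivAt_id (0 : ℝ)).const_add _
  exact zero_ne_one (h3.unique h4)

theorem hasFDerivAt_sub_smul (hρ : DifferentiableAt ℝ ρ p) :
    HasFDerivAt (fun x => x - ρ x • e)
      (ContinuousLinearMap.id ℝ (E n) - (fderiv ℝ ρ p).smulRight e) p :=
  (hasFDerivAt_id p).sub (hρ.hasFDerivAt.smul_const e)

theorem apply_eq_of_const_along {S : Set (E n)} {g : E n → ℝ} {A : E n →L[ℝ] ℝ} {c : ℝ} {x : E n}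
    (hρ : DifferentiableAt ℝ ρ x) (hA : HasFDerivWithinAt g A S (x - ρ x • e))
    (hev : ∀ᶠ y in 𝓝 x, y - ρ y • e ∈ S ∧ g (y - ρ y • e) = c) (v : E n) :
    A v = A e * fderiv ℝ ρ x v := by
  have h1 : HasFDerivAt (fun y => g (y - ρ y • e))
      (A.comp (ContinuousLinearMap.id ℝ (E n) - (fderiv ℝ ρ x).smulRight e)) x := by
    have := hA.comp_hasFDerivAt x (hasFDerivAt_sub_smul hρ) (hev.mono fun y hy => hy.1)
    exact this
  have h2 : HasFDerivAt (fun y => g (y - ρ y • e)) (0 : E n →L[ℝ] ℝ) x :=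
    (hasFDerivAt_const c x).congr_of_eventuallyEq (hev.mono fun y hy => hy.2)
  have h3 := DFunLike.congr_fun (h1.unique h2) v
  simp at h3
  linarith

/-- Differentiate B(γ(x))v = B(γ(x))e · dρ(v), with γ(x) = x - ρ(x) e, in the direction w. As w is
tangential, γ moves with velocity w, and as dρ(v) = 0, the derivative of the factor B(γ(x))e does
not contribute. -/
theorem deriv_tangential {S : Set (E n)} {B : E n → E n →L[ℝ] ℝ} {DB : E n →L[ℝ] E n →L[ℝ] ℝ}
    (hρ : ContDiffAt ℝ 2 ρ p) (hρ0 : ρ p = 0) (hB : HasFDerivWithinAt B DB S p)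
    (hev : ∀ᶠ x in 𝓝 p, x - ρ x • e ∈ S ∧
      ∀ v, B (x - ρ x • e) v = B (x - ρ x • e) e * fderiv ℝ ρ x v)
    {w v : E n} (hw : fderiv ℝ ρ p w = 0) (hv : fderiv ℝ ρ p v = 0) :
    DB w v = B p e * fderiv ℝ (fderiv ℝ ρ) p w v := by
  have hγp : p - ρ p • e = p := by simp [hρ0]
  set T := ContinuousLinearMap.id ℝ (E n) - (fderiv ℝ ρ p).smulRight e
  have hTw : T w = w := by simp [T, hw]
  have h1 : HasFDerivAt (fun x => B (x - ρ x • e)) (DB.comp T) p := by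
    have hB' : HasFDerivWithinAt B DB S (p - ρ p • e) := by rwa [hγp]
    exact hB'.comp_hasFDerivAt p
      (hasFDerivAt_sub_smul (hρ.differentiableAt two_ne_zero)) (hev.mono fun y hy => hy.1)
  have h2 : HasFDerivAt (fderiv ℝ ρ) (fderiv ℝ (fderiv ℝ ρ) p) p :=
    ((hρ.fderiv_right (m := 1) (by norm_num)).differentiableAt one_ne_zero).hasFDerivAt
  have h3 := (h1.clm_apply (hasFDerivAt_const e p)).mul (h2.clm_apply (hasFDerivAt_const v p))
  have h4 := h1.clm_apply (hasFDerivAt_const v p)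
  have h5 := (h3.congr_of_eventuallyEq (hev.mono fun y hy => hy.2 v)).unique h4
  have h6 := DFunLike.congr_fun h5 w
  simp [hγp, hTw, hv] at h6
  exact h6.symm

end Regularity

end GBC

namespace GBC

/-! ### The mass field at a regular boundary point -/

section BoundaryAlgebra

variable {n m : ℕ} {Ω : Set (E n)} {p : E n} {ρ : E n → ℝ}

theorem sum_unitNormal_sq (h : fderiv ℝ ρ p ≠ 0) : unitNormal ρ p ⬝ᵥ unitNormal ρ p = 1 := by
  set w := (InnerProductSpace.toDual ℝ (E n)).symm (fderiv ℝ ρ p) with hw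
  have hwi (i : Fin n) : fderiv ℝ ρ p (EuclideanSpace.single i 1) = w i := by
    rw [← InnerProductSpace.toDual_symm_apply, ← hw, EuclideanSpace.inner_single_right]
    simp
  have hn : ‖fderiv ℝ ρ p‖ = ‖w‖ := by rw [hw, LinearIsometryEquiv.norm_map]
  have hpos : ‖w‖ ≠ 0 := by rw [← hn]; exact norm_ne_zero_iff.2 h
  have hsq : ∑ i, w i * w i = ‖w‖ ^ 2 := by
    rw [EuclideanSpace.real_norm_sq_eq]
    exact Finset.sum_congr rfl fun i _ => (pow_two _).symm
  have : ∀ i, unitNormal ρ p i * unitNormal ρ p i = (‖w‖ ^ 2)⁻¹ * (w i * w i) := fun i => by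
    rw [unitNormal, hwi, hn]
    field_simp
  simp only [dotProduct, this, ← Finset.mul_sum, hsq]
  exact inv_mul_cancel₀ (pow_ne_zero 2 hpos)

theorem IsDefiningFunctionAt.eventually_eq_zero (h : IsDefiningFunctionAt Ω ρ p) (hΩ : IsOpen Ω) :
    ∀ᶠ x in 𝓝 p, x ∈ frontier Ω → ρ x = 0 := by
  filter_upwards [h.2.2.eventually_nhds, (h.1.eventually (by simp))] with x hx hc hxf
  rw [hΩ.frontier_eq] at hxf
  refine le_antisymm (not_lt.1 fun hlt => ?_) (not_lt.1 fun hlt => hxf.2 (hx.self_of_nhds.2 hlt))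
  have h1 : ∀ᶠ y in 𝓝 x, 0 < ρ y := hc.continuousAt.eventually (lt_mem_nhds hlt)
  obtain ⟨y, hy, hyΩ⟩ := mem_closure_iff_nhds.1 hxf.1 _ (h1.and hx)
  exact lt_asymm hy.1 (hy.2.1 hyΩ)

theorem IsDefiningFunctionAt.isNormalAt (h : IsDefiningFunctionAt Ω ρ p) (hΩ : IsOpen Ω)
    (hp : p ∈ frontier Ω) : IsNormalAt Ω p (WithLp.toLp 2 (unitNormal ρ p)) := by
  have := isNormalAt_of_hasFDerivAt (Ω := Ω) (h.1.differentiableAt two_ne_zero).hasFDerivAt h.2.1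
    ((h.eventually_eq_zero hΩ).self_of_nhds hp) h.2.2
  convert this using 1
  ext i
  change fderiv ℝ ρ p (EuclideanSpace.single i 1) / ‖fderiv ℝ ρ p‖ = ‖fderiv ℝ ρ p‖⁻¹ *
    ((InnerProductSpace.toDual ℝ (E n)).symm (fderiv ℝ ρ p)) i
  rw [← InnerProductSpace.toDual_symm_apply (y := fderiv ℝ ρ p), EuclideanSpace.inner_single_right]
  simp
  ring

theorem mul_mul_transpose_apply_bilin (Q : Matrix (Fin n) (Fin n) ℝ) (b : E n →L[ℝ] E n →L[ℝ] ℝ)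
    (i j : Fin n) : (Q * Matrix.of (fun i j => b (EuclideanSpace.single i 1)
      (EuclideanSpace.single j 1)) * Qᵀ) i j =
      b (∑ k, Q i k • EuclideanSpace.single k 1) (∑ l, Q j l • EuclideanSpace.single l 1) := by
  simp only [Matrix.mul_apply, Matrix.transpose_apply, Matrix.of_apply, map_sum, map_smul,
    smul_eq_mul, _root_.sum_apply, _root_.smul_apply, Finset.sum_mul, Finset.mul_sum]
  exact Finset.sum_congr rfl fun l _ => Finset.sum_congr rfl fun k _ => by ring

theorem levelShapeOp_transpose (hρ : ContDiffAt ℝ 2 ρ p) :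
    (levelShapeOp ρ p)ᵀ = levelShapeOp ρ p := by
  have hsym : ∀ v w, fderiv ℝ (fderiv ℝ ρ) p v w = fderiv ℝ (fderiv ℝ ρ) p w v :=
    fun v w => (hρ.isSymmSndFDerivAt (by simp)).eq v w
  simp only [levelShapeOp, Matrix.transpose_smul, Matrix.transpose_mul, Matrix.transpose_sub,
    Matrix.transpose_one, Matrix.transpose_vecMulVec, Matrix.mul_assoc]
  congr 3
  ext i j
  simp only [Matrix.transpose_apply, Matrix.of_apply, hsym]

/-- A function which is constant along the boundary has first derivative a multiple of the unit
normal, and tangential second derivative the same multiple of the shape operator. -/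
theorem exists_eq_smul_normal {f : E n → E m} (hΩ : IsOpen Ω) (hL : HasLipschitzBoundary Ω)
    (hf : ContDiffOn ℝ ∞ f Ωᶜ) {e : E n} {ρ₀ : E n → ℝ} (h₀ : IsGraphFunctionAt Ω p e ρ₀)
    (hρ₀ : ContDiffAt ℝ 2 ρ₀ p) (hp : p ∈ frontier Ω)
    (hev : ∀ᶠ x in 𝓝 p, x - ρ₀ x • e ∈ frontier Ω ∧ f (x - ρ₀ x • e) = f p)
    (hρ : IsDefiningFunctionAt Ω ρ p) (a : Fin m) :
    ∃ c : ℝ, (fun i => jac Ωᶜ f p a i) = c • unitNormal ρ p ∧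
      (1 - vecMulVec (unitNormal ρ p) (unitNormal ρ p)) * hess Ωᶜ f a p *
        (1 - vecMulVec (unitNormal ρ p) (unitNormal ρ p)) = c • levelShapeOp ρ p := by
  have hus := hL.uniqueDiffOn_compl hΩ
  have hcl := hL.subset_closure_interior hΩ
  set s := Ωᶜ with hs
  have hfs : frontier Ω ⊆ s := fun x hx => by
    rw [hΩ.frontier_eq] at hx
    exact hx.2
  have hps := hfs hp
  set g : E n → ℝ := fun y => f y a with hg
  have hgc : ContDiffOn ℝ ∞ g s := (contDiffOn_piLp _).1 hf a
  set A := fderivWithin ℝ g s with hA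
  have hAc : ContDiffOn ℝ ∞ A s := hgc.fderivWithin hus le_rfl
  have hAd : ∀ q ∈ s, HasFDerivWithinAt g (A q) s q := fun q hq =>
    (hgc.differentiableOn (by simp) q hq).hasFDerivWithinAt
  have hDA : HasFDerivWithinAt A (fderivWithin ℝ A s p) s p :=
    (hAc.differentiableOn (by simp) p hps).hasFDerivWithinAt
  have h0 := h₀.apply_eq_zero hΩ hp
  have hγp : p - ρ₀ p • e = p := by simp [h0]
  have hγt := h₀.tendsto_sub hΩ hp
  have hρ₀ev : ∀ᶠ x in 𝓝 p, DifferentiableAt ℝ ρ₀ x :=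
    (hρ₀.eventually (by simp)).mono fun x hx => hx.differentiableAt two_ne_zero
  have hρev : ∀ᶠ x in 𝓝 p, DifferentiableAt ℝ ρ x :=
    (hρ.1.eventually (by simp)).mono fun x hx => hx.differentiableAt two_ne_zero
  have hfev : ∀ᶠ x in 𝓝 p, x - ρ₀ x • e ∈ s ∧
      ∀ v, A (x - ρ₀ x • e) v = A (x - ρ₀ x • e) e * fderiv ℝ ρ₀ x v := by
    filter_upwards [hev.eventually_nhds, hρ₀ev] with x hx hd
    refine ⟨hfs hx.self_of_nhds.1, apply_eq_of_const_along (c := f p a) hd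
      (hAd _ (hfs hx.self_of_nhds.1)) ?_⟩
    filter_upwards [hx] with y hy
    exact ⟨hfs hy.1, by rw [hg]; simp only [hy.2]⟩
  have hzero : ∀ᶠ x in 𝓝 p, ρ (x - ρ₀ x • e) = 0 := by
    filter_upwards [hev, hγt.eventually (hρ.eventually_eq_zero hΩ)] with x hx hx0
    exact hx0 hx.1
  -- The arbitrary defining function ρ is treated like a component of f, being itself constant along
  -- the boundary. Comparing both with ρ₀ makes the result independent of the defining function.
  have hρfev : ∀ᶠ x in 𝓝 p, x - ρ₀ x • e ∈ (univ : Set (E n)) ∧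
      ∀ v, fderiv ℝ ρ (x - ρ₀ x • e) v = fderiv ℝ ρ (x - ρ₀ x • e) e * fderiv ℝ ρ₀ x v := by
    filter_upwards [hzero.eventually_nhds, hρ₀ev, hγt.eventually hρev] with x hx hd hd'
    refine ⟨mem_univ _, apply_eq_of_const_along (S := univ) (c := 0) hd
      hd'.hasFDerivAt.hasFDerivWithinAt ?_⟩
    filter_upwards [hx] with y hy using ⟨mem_univ _, hy⟩
  have hAp : ∀ v, A p v = A p e * fderiv ℝ ρ₀ p v := by
    have := hfev.self_of_nhds.2
    rwa [hγp] at this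
  have hρp : ∀ v, fderiv ℝ ρ p v = fderiv ℝ ρ p e * fderiv ℝ ρ₀ p v := by
    have := hρfev.self_of_nhds.2
    rwa [hγp] at this
  have hρe : fderiv ℝ ρ p e ≠ 0 := fun h => hρ.2.1 (by
    ext v
    rw [hρp, h, zero_mul]
    rfl)
  have hnorm : ‖fderiv ℝ ρ p‖ ≠ 0 := norm_ne_zero_iff.2 hρ.2.1
  have htan : ∀ v, fderiv ℝ ρ p v = 0 → fderiv ℝ ρ₀ p v = 0 := fun v hv => by
    rw [hρp] at hv
    exact (mul_eq_zero.1 hv).resolve_left hρe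
  have h2 : HasFDerivAt (fderiv ℝ ρ) (fderiv ℝ (fderiv ℝ ρ) p) p :=
    ((hρ.1.fderiv_right (m := 1) (by norm_num)).differentiableAt one_ne_zero).hasFDerivAt
  have hbil {w v : E n} (hw : fderiv ℝ ρ p w = 0) (hv : fderiv ℝ ρ p v = 0) :
      fderivWithin ℝ A s p w v = A p e / fderiv ℝ ρ p e * fderiv ℝ (fderiv ℝ ρ) p w v := by
    rw [deriv_tangential hρ₀ h0 hDA hfev (htan w hw) (htan v hv),
      deriv_tangential hρ₀ h0 h2.hasFDerivWithinAt hρfev (htan w hw) (htan v hv)]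
    field_simp
  -- This constant is the normal derivative of the component of f: A p is A p e / Dρ(e) times Dρ,
  -- and Dρ is its norm times the normal.
  refine ⟨A p e / fderiv ℝ ρ p e * ‖fderiv ℝ ρ p‖, ?_, ?_⟩
  · funext i
    change A p (EuclideanSpace.single i 1) = A p e / fderiv ℝ ρ p e * ‖fderiv ℝ ρ p‖ *
      (fderiv ℝ ρ p (EuclideanSpace.single i 1) / ‖fderiv ℝ ρ p‖)
    rw [hAp, hρp (EuclideanSpace.single i 1)]
    field_simp
  · set ν := unitNormal ρ p with hν
    set Q : Matrix (Fin n) (Fin n) ℝ := 1 - vecMulVec ν ν with hQ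
    have hQt : Qᵀ = Q := by
      rw [hQ, Matrix.transpose_sub, Matrix.transpose_one, Matrix.transpose_vecMulVec]
    have hνν : ν ⬝ᵥ ν = 1 := sum_unitNormal_sq hρ.2.1
    have hQν : Q *ᵥ ν = 0 := by
      rw [hQ, Matrix.sub_mulVec, Matrix.one_mulVec, vecMulVec_mulVec_eq_smul, hνν, one_smul,
        sub_self]
    have hQtan (i : Fin n) : fderiv ℝ ρ p (∑ k, Q i k • EuclideanSpace.single k 1) = 0 := by
      have h := congrFun hQν i
      have hk (k : Fin n) : fderiv ℝ ρ p (EuclideanSpace.single k 1) = ‖fderiv ℝ ρ p‖ * ν k := by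
        rw [hν, unitNormal]
        field_simp
      simp only [map_sum, map_smul, smul_eq_mul, hk]
      have : ∑ k, Q i k * (‖fderiv ℝ ρ p‖ * ν k) = ‖fderiv ℝ ρ p‖ * (Q *ᵥ ν) i := by
        simp only [Matrix.mulVec, dotProduct, Finset.mul_sum]
        exact Finset.sum_congr rfl fun k _ => by ring
      rw [this, h]
      simp
    have hhess : hess s f a p = Matrix.of fun i j => fderivWithin ℝ A s p
        (EuclideanSpace.single i 1) (EuclideanSpace.single j 1) := by
      rw [← hess_transpose hus hcl hf hps]
      ext i j
      have h1 : HasFDerivWithinAt (fun x => A x (EuclideanSpace.single j 1)) _ s p :=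
        hDA.clm_apply (hasFDerivWithinAt_const (EuclideanSpace.single j 1) p s)
      change fderivWithin ℝ (fun x => A x (EuclideanSpace.single j 1)) s p
        (EuclideanSpace.single i 1) = _
      rw [h1.fderivWithin (hus p hps)]
      simp
    ext i j
    have e1 := mul_mul_transpose_apply_bilin Q (fderivWithin ℝ A s p) i j
    have e2 := mul_mul_transpose_apply_bilin Q (fderiv ℝ (fderiv ℝ ρ) p) i j
    rw [hQt] at e1 e2
    have e3 : levelShapeOp ρ p i j = ‖fderiv ℝ ρ p‖⁻¹ * (Q * Matrix.of (fun i j =>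
        fderiv ℝ (fderiv ℝ ρ) p (EuclideanSpace.single i 1) (EuclideanSpace.single j 1)) * Q) i j :=
      rfl
    rw [hhess, e1, hbil (hQtan i) (hQtan j), ← e2, Matrix.smul_apply, smul_eq_mul, e3,
      mul_assoc (A p e / _), mul_inv_cancel_left₀ hnorm]

/-- The Sherman-Morrison formula. -/
theorem inv_one_add_smul_vecMulVec {κ : Type*} [Fintype κ] [DecidableEq κ] (v : κ → ℝ) {c : ℝ}
    (hc : 1 + c * (v ⬝ᵥ v) ≠ 0) :
    (1 + c • vecMulVec v v)⁻¹ = 1 - (c / (1 + c * (v ⬝ᵥ v))) • vecMulVec v v := by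
  refine Matrix.inv_eq_right_inv ?_
  have h : vecMulVec v v * vecMulVec v v = (v ⬝ᵥ v) • vecMulVec v v := by
    rw [Matrix.vecMulVec_mul_vecMulVec, Matrix.vecMulVec_smul]
  rw [add_mul, one_mul, mul_sub, mul_one, Matrix.smul_mul, Matrix.mul_smul, h, smul_smul, smul_smul]
  have h2 : c - c / (1 + c * (v ⬝ᵥ v)) - c * (c / (1 + c * (v ⬝ᵥ v))) * (v ⬝ᵥ v) = 0 := by
    field_simp
    ring
  have h3 : (1 : Matrix κ κ ℝ) - (c / (1 + c * (v ⬝ᵥ v))) • vecMulVec v v + (c • vecMulVec v v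
      - (c * (c / (1 + c * (v ⬝ᵥ v))) * (v ⬝ᵥ v)) • vecMulVec v v) =
      1 + (c - c / (1 + c * (v ⬝ᵥ v)) - c * (c / (1 + c * (v ⬝ᵥ v))) * (v ⬝ᵥ v)) •
        vecMulVec v v := by
    simp only [sub_smul]
    abel
  rw [h3, h2, zero_smul, add_zero]

theorem polarE3_smul_smul_smul {κ : Type*} [Fintype κ] [DecidableEq κ] (a b c : ℝ)
    (M : Matrix κ κ ℝ) : polarE3 (a • M) (b • M) (c • M) = a * b * c * polarE3 M M M := by
  simp only [polarE3, Matrix.trace_smul, Matrix.smul_mul, Matrix.mul_smul, smul_eq_mul]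
  ring

/-- The flux of `newtonField` through the boundary. -/
theorem newtonField_dotProduct_unit {s : Set (E n)} {f : E n → E m} {ν : Fin n → ℝ}
    (hν : ν ⬝ᵥ ν = 1) (c : Fin m → ℝ) (M : Matrix (Fin n) (Fin n) ℝ)
    (hM : Mᵀ = M) (hjac : ∀ a, (fun i => jac s f p a i) = c a • ν)
    (hhess : ∀ a, (1 - vecMulVec ν ν) * hess s f a p * (1 - vecMulVec ν ν) = c a • M) :
    newtonField s f p ⬝ᵥ ν =
      3 * ((normSqDf s f p / (1 + normSqDf s f p)) ^ 2 * M.charpoly.roots.esymm 3) := by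
  have hj (a : Fin m) (i : Fin n) : d1 s f a i p = c a * ν i := congrFun (hjac a) i
  -- Λ is |Df|². Both g = 1 + Λ ν ⊗ ν and U = 1 + c ⊗ c are rank-one perturbations of the identity
  -- and can be inverted explicitly.
  set Λ := c ⬝ᵥ c with hΛ
  have hΛ0 : 0 ≤ Λ := Finset.sum_nonneg fun a _ => mul_self_nonneg _
  have hΛ1 : 1 + Λ ≠ 0 := by positivity
  have hnorm : normSqDf s f p = Λ := by
    simp only [normSqDf, hj, hΛ, dotProduct, mul_pow, ← Finset.mul_sum]
    have : ∑ i, ν i ^ 2 = 1 := by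
      rw [← hν]
      exact Finset.sum_congr rfl fun i _ => pow_two _
    simp only [this, mul_one]
    exact Finset.sum_congr rfl fun a _ => pow_two _
  have hg : graphMetric s f p = 1 + Λ • vecMulVec ν ν := by
    rw [graphMetric]
    congr 1
    ext i j
    simp only [hj, Matrix.of_apply, Matrix.smul_apply, Matrix.vecMulVec_apply, smul_eq_mul, hΛ,
      dotProduct, Finset.sum_mul]
    exact Finset.sum_congr rfl fun a _ => by ring
  have hU : normalGram s f p = 1 + (1 : ℝ) • vecMulVec c c := by
    rw [normalGram, one_smul]
    congr 1
    ext a b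
    simp only [hj, Matrix.of_apply, Matrix.vecMulVec_apply]
    have : ∀ i, c a * ν i * (c b * ν i) = c a * c b * (ν i * ν i) := fun i => by ring
    simp only [this, ← Finset.mul_sum]
    rw [show ∑ i, ν i * ν i = 1 from hν, mul_one]
  have hgi : (graphMetric s f p)⁻¹ = 1 - (Λ / (1 + Λ)) • vecMulVec ν ν := by
    rw [hg, inv_one_add_smul_vecMulVec ν (by rw [hν, mul_one]; exact hΛ1), hν, mul_one]
  have hUi : (normalGram s f p)⁻¹ = 1 - (1 / (1 + Λ)) • vecMulVec c c := by
    rw [hU, inv_one_add_smul_vecMulVec c (by rw [one_mul, ← hΛ]; exact hΛ1), one_mul]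
  have hgrad (a : Fin m) : gradF s f a p = (c a / (1 + Λ)) • ν := by
    have h1 : (fun i => d1 s f a i p) = c a • ν := hjac a
    rw [gradF, h1, hgi, Matrix.sub_mulVec, Matrix.one_mulVec, Matrix.smul_mulVec,
      Matrix.mulVec_smul, vecMulVec_mulVec_eq_smul, hν, one_smul, smul_smul, ← sub_smul]
    congr 1
    field_simp
    ring
  set Q : Matrix (Fin n) (Fin n) ℝ := 1 - vecMulVec ν ν with hQ
  -- The metric is Euclidean in tangential directions, so the shape operators and the Hessians have
  -- the same compressions.
  have hQg : Q * (graphMetric s f p)⁻¹ = Q := by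
    have h1 : vecMulVec ν ν * vecMulVec ν ν = vecMulVec ν ν := by
      rw [Matrix.vecMulVec_mul_vecMulVec, hν, one_smul]
    have h2 : Q * vecMulVec ν ν = 0 := by
      rw [hQ, sub_mul, one_mul, h1, sub_self]
    rw [hgi, mul_sub, mul_one, Matrix.mul_smul, h2, smul_zero, sub_zero]
  have hS (a : Fin m) : Q * shapeOp s f a p * Q = c a • M := by
    rw [shapeOp_eq, ← Matrix.mul_assoc, hQg, hhess]
  have hN (a b d : Fin m) : (polarNewton (shapeOp s f a p) (shapeOp s f b p) (shapeOp s f d p) *ᵥ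
      gradF s f a p) ⬝ᵥ ν = c a / (1 + Λ) * (c a * c b * c d * (6 * M.charpoly.roots.esymm 3)) := by
    rw [hgrad, Matrix.mulVec_smul, smul_dotProduct, dotProduct_comm, dotProduct_polarNewton_unit ν hν,
      ← hQ, hS, hS, hS, polarE3_smul_smul_smul, six_mul_esymm_three_charpoly M hM, smul_eq_mul]
  have hcUc : ∑ b, ∑ d, (normalGram s f p)⁻¹ b d * (c b * c d) = Λ / (1 + Λ) := by
    have h1 : ∑ b, ∑ d, (normalGram s f p)⁻¹ b d * (c b * c d)
        = c ⬝ᵥ ((normalGram s f p)⁻¹ *ᵥ c) := by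
      simp only [dotProduct, Matrix.mulVec, Finset.mul_sum]
      exact Finset.sum_congr rfl fun b _ => Finset.sum_congr rfl fun d _ => by ring
    rw [h1, hUi, Matrix.sub_mulVec, Matrix.one_mulVec, Matrix.smul_mulVec, vecMulVec_mulVec_eq_smul,
      dotProduct_sub, dotProduct_smul, dotProduct_smul, ← hΛ, smul_eq_mul, smul_eq_mul]
    field_simp
    ring
  have hsum : newtonField s f p ⬝ᵥ ν = (1 / 2) * ∑ a, ∑ b, ∑ d, (normalGram s f p)⁻¹ b d *
      ((polarNewton (shapeOp s f a p) (shapeOp s f b p) (shapeOp s f d p) *ᵥ gradF s f a p) ⬝ᵥ ν) := by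
    simp only [newtonField, smul_dotProduct, sum_dotProduct, smul_eq_mul]
  have hterm (a : Fin m) : ∑ b, ∑ d, (normalGram s f p)⁻¹ b d *
      (c a / (1 + Λ) * (c a * c b * c d * (6 * M.charpoly.roots.esymm 3)))
      = c a * c a * (6 * M.charpoly.roots.esymm 3 / (1 + Λ) * (Λ / (1 + Λ))) := by
    rw [← hcUc, Finset.mul_sum, Finset.mul_sum]
    refine Finset.sum_congr rfl fun b _ => ?_
    rw [Finset.mul_sum, Finset.mul_sum]
    exact Finset.sum_congr rfl fun d _ => by ring
  -- The constants combine as ½ · 6 · Λ/(1+Λ) · Λ/(1+Λ) = 3 (Λ/(1+Λ))², one factor coming from ∇f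
  -- and the other from contracting c ⊗ c with U⁻¹.
  rw [hsum]
  simp only [hN, hterm, ← Finset.sum_mul]
  rw [show ∑ a, c a * c a = Λ from rfl, hnorm]
  field_simp
  ring

end BoundaryAlgebra

end GBC

namespace GBC

/-! ### Decay rates of matrix expressions -/

section Decay

variable {X : Type*} {ι κ η : Type*} [Fintype ι] [Fintype κ] [Fintype η] [DecidableEq ι]
  {l : Filter X}

/-- The entries of `M` are `O(g)` along `l`. -/
def DecayM (l : Filter X) (M : X → Matrix ι κ ℝ) (g : X → ℝ) : Prop :=
  ∀ i j, (fun x => M x i j) =O[l] g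

theorem DecayM.mul {M : X → Matrix ι κ ℝ} {N : X → Matrix κ η ℝ} {g g' : X → ℝ}
    (hM : DecayM l M g) (hN : DecayM l N g') :
    DecayM l (fun x => M x * N x) fun x => g x * g' x := fun i j => by
  simp only [Matrix.mul_apply]
  exact Asymptotics.IsBigO.fun_sum fun k _ => (hM i k).mul (hN k j)

theorem DecayM.add {M N : X → Matrix ι κ ℝ} {g : X → ℝ} (hM : DecayM l M g) (hN : DecayM l N g) :
    DecayM l (fun x => M x + N x) g := fun i j => (hM i j).add (hN i j)

theorem DecayM.sub {M N : X → Matrix ι κ ℝ} {g : X → ℝ} (hM : DecayM l M g) (hN : DecayM l N g) :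
    DecayM l (fun x => M x - N x) g := fun i j => (hM i j).sub (hN i j)

theorem DecayM.smul {c : X → ℝ} {M : X → Matrix ι κ ℝ} {g g' : X → ℝ} (hc : c =O[l] g)
    (hM : DecayM l M g') : DecayM l (fun x => c x • M x) fun x => g x * g' x :=
  fun i j => hc.mul (hM i j)

theorem DecayM.trace {M : X → Matrix ι ι ℝ} {g : X → ℝ} (hM : DecayM l M g) :
    (fun x => (M x).trace) =O[l] g := by
  simp only [Matrix.trace, Matrix.diag]
  exact Asymptotics.IsBigO.fun_sum fun k _ => hM k k

theorem DecayM.congr {M : X → Matrix ι κ ℝ} {g g' : X → ℝ} (hM : DecayM l M g)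
    (h : ∀ x, g x = g' x) : DecayM l M g' := fun i j => (hM i j).congr_right h

theorem DecayM.one : DecayM l (fun _ => (1 : Matrix ι ι ℝ)) fun _ => 1 := fun _ _ =>
  Asymptotics.isBigO_const_const _ one_ne_zero l

variable {A B C : X → Matrix ι ι ℝ} {a b c : X → ℝ}

theorem DecayM.polarE3 (hA : DecayM l A a) (hB : DecayM l B b) (hC : DecayM l C c) :
    (fun x => polarE3 (A x) (B x) (C x)) =O[l] fun x => a x * b x * c x := by
  have hAB := hA.mul hB
  have hAC := hA.mul hC
  have hBC := hB.mul hC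
  exact ((((((hA.trace.mul hB.trace).mul hC.trace).sub
    ((hA.trace.mul hBC.trace).congr_right fun x => by ring)).sub
    ((hB.trace.mul hAC.trace).congr_right fun x => by ring)).sub
    ((hC.trace.mul hAB.trace).congr_right fun x => by ring)).add (hAB.mul hC).trace).add
    ((hAC.mul hB).trace.congr_right fun x => by ring)

theorem DecayM.polarNewton (hA : DecayM l A a) (hB : DecayM l B b) (hC : DecayM l C c) :
    DecayM l (fun x => polarNewton (A x) (B x) (C x)) fun x => a x * b x * c x := by
  have hAB := hA.mul hB
  have hAC := hA.mul hC
  have hBC := hB.mul hC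
  have hBA := (hB.mul hA).congr (g' := fun x => a x * b x) fun x => by ring
  have hCA := (hC.mul hA).congr (g' := fun x => a x * c x) fun x => by ring
  have hCB := (hC.mul hB).congr (g' := fun x => b x * c x) fun x => by ring
  have c1 {M : X → Matrix ι ι ℝ} {g : X → ℝ} (hM : DecayM l M g)
      (h : ∀ x, g x = a x * b x * c x) : DecayM l M fun x => a x * b x * c x := hM.congr h
  exact ((((DecayM.smul (hA.polarE3 hB hC) DecayM.one).congr fun x => by ring).sub
    (((c1 (DecayM.smul ((hB.trace.mul hC.trace).sub hBC.trace) hA) fun x => by ring).add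
      (c1 (DecayM.smul ((hA.trace.mul hC.trace).sub hAC.trace) hB) fun x => by ring)).add
      (c1 (DecayM.smul ((hA.trace.mul hB.trace).sub hAB.trace) hC) fun x => by ring))).add
    (((c1 (DecayM.smul hC.trace (hAB.add hBA)) fun x => by ring).add
      (c1 (DecayM.smul hB.trace (hAC.add hCA)) fun x => by ring)).add
      (c1 (DecayM.smul hA.trace (hBC.add hCB)) fun x => by ring))).sub
    ((((((c1 (hAB.mul hC) fun x => by ring).add (c1 (hAC.mul hB) fun x => by ring)).add
      (c1 (hBA.mul hC) fun x => by ring)).add (c1 (hBC.mul hA) fun x => by ring)).add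
      (c1 (hCA.mul hB) fun x => by ring)).add (c1 (hCB.mul hA) fun x => by ring))

end Decay

/-! ### Bounds for 1 + JᵀJ -/

section Bounds

variable {ι κ : Type*} [Fintype ι] [DecidableEq ι] [Fintype κ]

/-- For the j-th column y of the inverse, pairing (1 + JᵀJ)y = e_j with y gives y_k² ≤ y_j for every
k; taking k = j yields y_j ≤ 1. -/
theorem abs_inv_one_add_le_one (J : Matrix κ ι ℝ) (hu : IsUnit (1 + Jᵀ * J : Matrix ι ι ℝ).det)
    (i j : ι) : |(1 + Jᵀ * J : Matrix ι ι ℝ)⁻¹ i j| ≤ 1 := by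
  set y : ι → ℝ := fun k => (1 + Jᵀ * J : Matrix ι ι ℝ)⁻¹ k j with hy
  have hyv : y = (1 + Jᵀ * J : Matrix ι ι ℝ)⁻¹ *ᵥ Pi.single j 1 := by
    ext k
    simp [hy]
  have h1 : (1 + Jᵀ * J) *ᵥ y = Pi.single j 1 := by
    rw [hyv, Matrix.mulVec_mulVec, Matrix.mul_nonsing_inv _ hu, Matrix.one_mulVec]
  have h2 : y ⬝ᵥ ((1 + Jᵀ * J) *ᵥ y) = y j := by rw [h1, dotProduct_single_one]
  rw [Matrix.add_mulVec, Matrix.one_mulVec, dotProduct_add, ← Matrix.mulVec_mulVec,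
    Matrix.dotProduct_mulVec y, Matrix.vecMul_transpose] at h2
  have h3 : 0 ≤ J *ᵥ y ⬝ᵥ J *ᵥ y := Finset.sum_nonneg fun k _ => mul_self_nonneg _
  have h4 (k : ι) : y k * y k ≤ y j := by
    have : y k * y k ≤ y ⬝ᵥ y :=
      Finset.single_le_sum (f := fun k => y k * y k) (fun k _ => mul_self_nonneg _)
        (Finset.mem_univ k)
    linarith
  have h5 : y j ≤ 1 := by nlinarith [h4 j]
  change |y i| ≤ 1
  exact abs_le_one_iff_mul_self_le_one.2 ((h4 i).trans h5)

/-- Every eigenvalue is at least 1, because JᵀJ is positive semidefinite. -/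
theorem one_le_det_one_add (J : Matrix κ ι ℝ) : 1 ≤ (1 + Jᵀ * J : Matrix ι ι ℝ).det := by
  have hJ : (Jᵀ * J).PosSemidef := by
    have := Matrix.posSemidef_conjTranspose_mul_self J
    rwa [Matrix.conjTranspose_eq_transpose_of_trivial] at this
  have hH : (1 + Jᵀ * J : Matrix ι ι ℝ).IsHermitian := Matrix.isHermitian_one.add hJ.1
  have key (i : ι) : 1 ≤ hH.eigenvalues i := by
    set v : ι → ℝ := ⇑(hH.eigenvectorBasis i)
    have hv : v ⬝ᵥ v = 1 := by
      have h := hH.eigenvectorBasis.orthonormal.1 i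
      have h2 : ‖hH.eigenvectorBasis i‖ ^ 2 = 1 := by rw [h, one_pow]
      rw [EuclideanSpace.real_norm_sq_eq] at h2
      simpa [dotProduct, v, pow_two] using h2
    have h := hH.mulVec_eigenvectorBasis i
    have h' : v ⬝ᵥ ((1 + Jᵀ * J : Matrix ι ι ℝ) *ᵥ v) = hH.eigenvalues i := by
      change v ⬝ᵥ ((1 + Jᵀ * J : Matrix ι ι ℝ) *ᵥ ⇑(hH.eigenvectorBasis i)) = _
      rw [h, dotProduct_smul, hv, smul_eq_mul, mul_one]
    rw [← h', Matrix.add_mulVec, Matrix.one_mulVec, dotProduct_add, hv, ← Matrix.mulVec_mulVec,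
      Matrix.dotProduct_mulVec v, Matrix.vecMul_transpose]
    have h3 : 0 ≤ J *ᵥ v ⬝ᵥ J *ᵥ v := Finset.sum_nonneg fun k _ => mul_self_nonneg _
    linarith
  rw [hH.det_eq_prod_eigenvalues]
  exact Finset.prod_induction _ (fun t : ℝ => 1 ≤ t) (fun _ _ ha hb => one_le_mul_of_one_le_of_one_le ha hb)
    le_rfl fun i _ => key i

end Bounds

end GBC

namespace GBC

/-! ### Integrability of L₂ and L₂^⊥ -/

section Infinity

variable {n m : ℕ} {s : Set (E n)} {f : E n → E m}

theorem decayM_graphMetric_inv (l : Filter (E n)) :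
    DecayM l (fun x => (graphMetric s f x)⁻¹) fun _ => 1 := fun i j =>
  Asymptotics.IsBigO.of_bound 1 (Eventually.of_forall fun x => by
    have h := abs_inv_one_add_le_one (jac s f x)
      (by rw [← graphMetric_eq]; exact graphMetric_isUnit x) i j
    rw [← graphMetric_eq] at h
    simpa using h)

theorem decayM_normalGram_inv (l : Filter (E n)) :
    DecayM l (fun x => (normalGram s f x)⁻¹) fun _ => 1 := fun i j =>
  Asymptotics.IsBigO.of_bound 1 (Eventually.of_forall fun x => by
    have h := abs_inv_one_add_le_one (jac s f x)ᵀ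
      (by rw [Matrix.transpose_transpose, ← normalGram_eq]
          exact (normalGram_posDef x).det_pos.ne'.isUnit) i j
    rw [Matrix.transpose_transpose, ← normalGram_eq] at h
    simpa using h)

theorem one_le_graphMetric_det (x : E n) : 1 ≤ (graphMetric s f x).det := by
  rw [graphMetric_eq]
  exact one_le_det_one_add _

variable {l : Filter (E n)} {u w : E n → ℝ}

/-- Each term contains two gradients and four second derivatives, while g⁻¹ and U⁻¹ are bounded. -/
theorem isBigO_gaussBonnetPerp_aux (hu : DecayM l (jac s f) u) (hw : ∀ a, DecayM l (hess s f a) w) :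
    (fun x => ∑ a, ∑ c, ∑ p, ∑ q, (normalGram s f x)⁻¹ p q *
      (- ∑ i, ((Pi.single i 1 : Fin n → ℝ) ⬝ᵥ polarNewton (Matrix.vecMulVec (gradF s f c x)
          ((hess s f a x * shapeOp s f c x) *ᵥ Pi.single i 1)) (shapeOp s f p x)
            (shapeOp s f q x) *ᵥ gradF s f a x)
      - 2 * ∑ i, ((Pi.single i 1 : Fin n → ℝ) ⬝ᵥ polarNewton (Matrix.vecMulVec (gradF s f c x)
          ((hess s f p x * shapeOp s f c x) *ᵥ Pi.single i 1)) (shapeOp s f a x)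
            (shapeOp s f q x) *ᵥ gradF s f a x))) =O[l] fun x => u x ^ 2 * w x ^ 4 := by
  have hA (a : Fin m) : DecayM l (shapeOp s f a) w := by
    have := ((decayM_graphMetric_inv (s := s) (f := f) l).mul (hw a)).congr (g' := w) fun x => one_mul _
    exact this
  have hG (a : Fin m) (i : Fin n) : (fun x => gradF s f a x i) =O[l] u := by
    simp only [gradF, Matrix.mulVec, dotProduct]
    refine Asymptotics.IsBigO.fun_sum fun k _ => ?_
    exact ((decayM_graphMetric_inv l i k).mul (hu a k)).congr_right fun x => one_mul _
  have key (a b c p q : Fin m) (i : Fin n) : (fun x =>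
      ((Pi.single i 1 : Fin n → ℝ) ⬝ᵥ polarNewton (Matrix.vecMulVec (gradF s f c x)
        ((hess s f b x * shapeOp s f c x) *ᵥ Pi.single i 1)) (shapeOp s f p x)
          (shapeOp s f q x) *ᵥ gradF s f a x)) =O[l] fun x => u x ^ 2 * w x ^ 4 := by
    have hV : DecayM l (fun x => Matrix.vecMulVec (gradF s f c x)
        ((hess s f b x * shapeOp s f c x) *ᵥ Pi.single i 1)) fun x => u x * (w x * w x) :=
      fun j k => by
        simp only [Matrix.vecMulVec_apply, Matrix.mulVec_single_one, Matrix.col_apply]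
        exact (hG c j).mul ((hw b).mul (hA c) k i)
    simp only [single_one_dotProduct]
    simp only [Matrix.mulVec, dotProduct]
    refine Asymptotics.IsBigO.fun_sum fun k _ => ?_
    exact ((hV.polarNewton (hA p) (hA q) i k).mul (hG a k)).congr_right fun x => by ring
  refine Asymptotics.IsBigO.fun_sum fun a _ => Asymptotics.IsBigO.fun_sum fun c _ =>
    Asymptotics.IsBigO.fun_sum fun p _ => Asymptotics.IsBigO.fun_sum fun q _ => ?_
  refine ((decayM_normalGram_inv l p q).mul (g₂ := fun x => u x ^ 2 * w x ^ 4)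
    (Asymptotics.IsBigO.sub ?_ ?_)).congr_right fun x => one_mul _
  · exact (Asymptotics.IsBigO.fun_sum fun i _ => key a a c p q i).neg_left
  · exact (Asymptotics.IsBigO.fun_sum fun i _ => key a p c a q i).const_mul_left 2

theorem integrableOn_of_isBigO_rpow {g : E n → ℝ} {r : ℝ} (hs : IsClosed s)
    (hg : ContinuousOn g s) (hr : (n : ℝ) < r)
    (hO : g =O[Bornology.cobounded (E n) ⊓ 𝓟 s] fun x => ‖x‖ ^ (-r)) : IntegrableOn g s := by
  obtain ⟨C, hC⟩ := hO.bound
  rw [eventually_inf_principal] at hC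
  obtain ⟨R, -, hR⟩ := (Metric.hasBasis_cobounded_compl_closedBall (0 : E n)).eventually_iff.1
    (hC.and (tendsto_norm_cobounded_atTop.eventually_ge_atTop 1))
  have hsplit : s = (s ∩ Metric.closedBall 0 R) ∪ (s ∩ (Metric.closedBall 0 R)ᶜ) := by
    rw [← inter_union_distrib_left, union_compl_self, inter_univ]
  rw [hsplit]
  refine IntegrableOn.union ?_ ?_
  · have hK : IsCompact (s ∩ Metric.closedBall (0 : E n) R) :=
      (isCompact_closedBall _ _).inter_left hs
    exact (hg.mono inter_subset_left).integrableOn_compact hK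
  · have hm : MeasurableSet (s ∩ (Metric.closedBall (0 : E n) R)ᶜ) :=
      hs.measurableSet.inter Metric.isClosed_closedBall.measurableSet.compl
    have hi : Integrable (fun x : E n => |C| * 2 ^ r * (1 + ‖x‖) ^ (-r)) :=
      (integrable_one_add_norm (by simpa using hr)).const_mul _
    refine Integrable.mono' hi.integrableOn
      ((hg.mono inter_subset_left).aestronglyMeasurable hm) ?_
    refine (ae_restrict_iff' hm).2 (Eventually.of_forall fun x hx => ?_)
    obtain ⟨h1, h2⟩ := hR hx.2
    have h3 := h1 hx.1
    have hr0 : 0 ≤ r := (Nat.cast_nonneg n).trans hr.le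
    have hx0 : 0 < ‖x‖ := by linarith
    -- On the tail ‖x‖ ≥ 1, so 1 + ‖x‖ ≤ 2‖x‖; the comparison function is integrable on the whole
    -- space.
    have h4 : ‖x‖ ^ (-r) ≤ 2 ^ r * (1 + ‖x‖) ^ (-r) := by
      rw [Real.rpow_neg hx0.le, Real.rpow_neg (by positivity), ← div_eq_mul_inv,
        inv_eq_one_div, div_le_div_iff₀ (by positivity) (by positivity), one_mul,
        ← Real.mul_rpow (by norm_num) hx0.le]
      exact Real.rpow_le_rpow (by positivity) (by linarith) hr0
    rw [Real.norm_of_nonneg (by positivity : 0 ≤ ‖x‖ ^ (-r))] at h3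
    calc ‖g x‖ ≤ C * ‖x‖ ^ (-r) := h3
      _ ≤ |C| * ‖x‖ ^ (-r) := by gcongr; exact le_abs_self C
      _ ≤ |C| * (2 ^ r * (1 + ‖x‖) ^ (-r)) := by gcongr
      _ = _ := by ring

variable (hs : UniqueDiffOn ℝ s) (hcl : s ⊆ closure (interior s))
include hs

theorem aemeasurable_sqrt_det (hsc : IsClosed s) (hf : ContDiffOn ℝ ∞ f s) :
    AEMeasurable (fun x => ENNReal.ofReal (Real.sqrt (graphMetric s f x).det))
      (volume.restrict s) :=
  ((smoothM_graphMetric hs hf).det.continuousOn.sqrt.aemeasurable hsc.measurableSet).ennreal_ofReal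

theorem riemVolume_div_sqrt_det (hsc : IsClosed s) (hf : ContDiffOn ℝ ∞ f s) {g : E n → ℝ}
    (hi : IntegrableOn g s) :
    Integrable (fun x => g x * (1 / Real.sqrt (graphMetric s f x).det))
      (riemVolume s (graphMetric s f)) ∧
    ∫ x, g x * (1 / Real.sqrt (graphMetric s f x).det) ∂(riemVolume s (graphMetric s f))
      = ∫ x in s, g x := by
  have h1 (x : E n) : (ENNReal.ofReal (Real.sqrt (graphMetric s f x).det)).toReal •
      (g x * (1 / Real.sqrt (graphMetric s f x).det)) = g x := by
    have : 0 < Real.sqrt (graphMetric s f x).det :=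
      Real.sqrt_pos.2 (one_pos.trans_le (one_le_graphMetric_det x))
    rw [ENNReal.toReal_ofReal this.le, smul_eq_mul]
    field_simp
  have hfin : ∀ᵐ x ∂(volume.restrict s),
      ENNReal.ofReal (Real.sqrt (graphMetric s f x).det) < ⊤ :=
    Eventually.of_forall fun _ => ENNReal.ofReal_lt_top
  constructor
  · refine (integrable_withDensity_iff_integrable_smul₀' (aemeasurable_sqrt_det hs hsc hf) hfin).2 ?_
    simp only [h1]
    exact hi
  · rw [riemVolume, integral_withDensity_eq_integral_toReal_smul₀ (aemeasurable_sqrt_det hs hsc hf)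
      hfin]
    simp only [h1]

include hcl

theorem AsymptoticallyFlatMap.isBigO_gaussBonnetPerp (hf : AsymptoticallyFlatMap s f) :
    ∃ r : ℝ, (n : ℝ) < r ∧
      gaussBonnetPerp s f =O[Bornology.cobounded (E n) ⊓ 𝓟 s] fun x => ‖x‖ ^ (-r) := by
  obtain ⟨hf, τ, hτ, hO⟩ := hf
  -- Two gradients of order -τ/2 and four Hessians of order -τ/2 - 1 give the order -(3τ + 4), and
  -- 3τ + 4 > n is the decay hypothesis.
  refine ⟨3 * τ + 4, by linarith, ?_⟩
  set l := Bornology.cobounded (E n) ⊓ 𝓟 s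
  have hpos : ∀ᶠ x in l, 0 < ‖x‖ :=
    (tendsto_norm_cobounded_atTop.eventually_gt_atTop 0).filter_mono inf_le_left
  have hu : DecayM l (jac s f) fun x => ‖x‖ ^ (-τ / 2) := fun a i => by
    refine Asymptotics.IsBigO.trans (Asymptotics.IsBigO.of_bound 1
      (Eventually.of_forall fun x => ?_)) (hO a i i i)
    rw [one_mul, Real.norm_eq_abs, Real.norm_of_nonneg (by positivity)]
    have h1 : 0 ≤ |d2 s f a i i x| * ‖x‖ := by positivity
    have h2 : 0 ≤ |d3 s f a i i i x| * ‖x‖ ^ 2 := by positivity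
    change |d1 s f a i x| ≤ _
    linarith
  have hw (a : Fin m) : DecayM l (hess s f a) fun x => ‖x‖ ^ (-τ / 2) * ‖x‖⁻¹ := fun i j => by
    have h1 : (fun x => d2 s f a i j x * ‖x‖) =O[l] fun x => ‖x‖ ^ (-τ / 2) := by
      refine Asymptotics.IsBigO.trans (Asymptotics.IsBigO.of_bound 1
        (Eventually.of_forall fun x => ?_)) (hO a i j j)
      rw [one_mul, norm_mul, norm_norm, Real.norm_eq_abs, Real.norm_of_nonneg (by positivity)]
      have h1 : 0 ≤ |d1 s f a i x| := by positivity
      have h2 : 0 ≤ |d3 s f a i j j x| * ‖x‖ ^ 2 := by positivity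
      linarith
    refine (h1.mul (Asymptotics.isBigO_refl (fun x => ‖x‖⁻¹) l)).congr' ?_ EventuallyEq.rfl
    filter_upwards [hpos] with x hx
    rw [mul_assoc, mul_inv_cancel₀ hx.ne', mul_one]
    rfl
  refine (isBigO_gaussBonnetPerp_aux hu hw).congr' ?_ ?_
  · filter_upwards [mem_inf_of_right (mem_principal_self s)] with x hx
    exact (gaussBonnetPerp_eq hs hcl hf hx).symm
  · filter_upwards [hpos] with x hx
    have h1 : ‖x‖ ^ (-τ / 2) * ‖x‖⁻¹ = ‖x‖ ^ (-τ / 2 - 1) := by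
      rw [Real.rpow_sub hx, Real.rpow_one, ← div_eq_mul_inv]
    rw [h1, ← Real.rpow_natCast, ← Real.rpow_natCast, ← Real.rpow_mul hx.le, ← Real.rpow_mul hx.le,
      ← Real.rpow_add hx]
    congr 1
    push_cast
    ring

theorem continuousOn_gaussBonnet (hf : ContDiffOn ℝ ∞ f s) :
    ContinuousOn (gaussBonnet s (graphMetric s f)) s := by
  have h : ContDiffOn ℝ ∞ (fun x => ∑ a, ∑ b, ∑ p, ∑ q,
      (normalGram s f x)⁻¹ a b * (normalGram s f x)⁻¹ p q *
      (polarNewton (shapeOp s f a x) (shapeOp s f p x) (shapeOp s f q x)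
        * shapeOp s f b x).trace) s := by
    have hU := smoothM_normalGram_inv hs hf
    have hA := fun a => smoothM_shapeOp hs hf a
    exact ContDiffOn.sum fun a _ => ContDiffOn.sum fun b _ => ContDiffOn.sum fun p _ =>
      ContDiffOn.sum fun q _ => ((hU a b).mul (hU p q)).mul
        (((hA a).polarNewton (hA p) (hA q)).mul (hA b)).trace
  exact h.continuousOn.congr fun x hx => gaussBonnet_eq hs hcl hf hx

/-- The divergence identity expresses L₂^⊥ as twice a smooth divergence minus L₂. -/
theorem continuousOn_gaussBonnetPerp (hf : ContDiffOn ℝ ∞ f s) :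
    ContinuousOn (gaussBonnetPerp s f) s := by
  have h : ContDiffOn ℝ ∞ (fun x => ∑ i, pd s i (fun y => newtonField s f y i) x) s :=
    ContDiffOn.sum fun i _ => contDiffOn_pd hs (smoothV_newtonField hs hf i) i
  refine ((continuousOn_const (c := (2 : ℝ)).mul h.continuousOn).sub (continuousOn_gaussBonnet hs hcl hf)).congr
    fun x hx => ?_
  change _ = (2 : ℝ) * ∑ i, pd s i (fun y => newtonField s f y i) x - _
  rw [sum_pd_newtonField hs hcl hf hx]
  ring

/-- Since √G ≥ 1, integrability for the Riemannian volume is the stronger condition. -/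
theorem integrableOn_of_integrable_riemVolume (hsc : IsClosed s) (hf : ContDiffOn ℝ ∞ f s)
    {g : E n → ℝ} (hg : ContinuousOn g s) (hi : Integrable g (riemVolume s (graphMetric s f))) :
    IntegrableOn g s := by
  have h := (integrable_withDensity_iff_integrable_smul₀' (aemeasurable_sqrt_det hs hsc hf)
    (Eventually.of_forall fun _ => ENNReal.ofReal_lt_top)).1 hi
  refine Integrable.mono h (hg.aestronglyMeasurable hsc.measurableSet)
    (Eventually.of_forall fun x => ?_)
  rw [norm_smul, ENNReal.toReal_ofReal (Real.sqrt_nonneg _), Real.norm_of_nonneg (Real.sqrt_nonneg _)]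
  exact le_mul_of_one_le_left (norm_nonneg _) (Real.one_le_sqrt.2 (one_le_graphMetric_det x))

end Infinity

end GBC

namespace GBC

/-! ### Divergence theorem on balls; derivatives on zero sets -/

section Divergence

variable {V : Type*} [NormedAddCommGroup V] [InnerProductSpace ℝ V] [FiniteDimensional ℝ V]
  [MeasurableSpace V] [BorelSpace V]

theorem gaussGreen_of_eq_zero {Ω K : Set V} (hΩ : IsOpen Ω) (hK : IsCompact K) {N : V → V} (u : V)
    {h : V → ℝ} (hus : UniqueDiffOn ℝ Ωᶜ) (hh : ContDiffOn ℝ 1 h Ωᶜ)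
    (h0 : ∀ x ∈ Ωᶜ, x ∉ K → h x = 0) (hC1 : ∀ p ∈ K ∩ frontier Ω, IsC1GraphAt Ω p)
    (hN : ∀ q ∈ frontier Ω, h q ≠ 0 → IsNormalAt Ω q (N q)) :
    IntegrableOn (fun x => h x * inner ℝ (N x) u) (frontier Ω) μHE[Module.finrank ℝ V - 1] ∧
      ∫ x in Ωᶜ, fderivWithin ℝ h Ωᶜ x u =
        - ∫ x in frontier Ω, h x * inner ℝ (N x) u ∂μHE[Module.finrank ℝ V - 1] := by
  have hfr : frontier Ω ⊆ Ωᶜ := fun x hx hxΩ => (hΩ.frontier_eq ▸ hx).2 hxΩ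
  have he : EqOn (Ωᶜ.indicator h) h Ωᶜ := fun x hx => indicator_of_mem hx h
  have hg := gaussGreen hΩ hK (N := N) u hus (hh.congr he) (fun x hx => by
    by_cases hxs : x ∈ Ωᶜ
    · rw [he hxs, h0 x hxs hx]
    · exact indicator_of_notMem hxs h) hC1 (fun q hq hne => hN q hq (by rwa [he (hfr hq)] at hne))
  have hm : MeasurableSet (frontier Ω) := isClosed_frontier.measurableSet
  refine ⟨hg.1.congr_fun (fun x hx => by simp only [he (hfr hx)]) hm, ?_⟩
  rw [setIntegral_congr_fun hm (g := fun x => Ωᶜ.indicator h x * inner ℝ (N x) u)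
    (fun x hx => by simp only [he (hfr hx)]), ← hg.2]
  refine setIntegral_congr_fun hΩ.isClosed_compl.measurableSet fun x hx => ?_
  rw [fderivWithin_congr he (he hx)]

theorem isC1GraphAt_compl_closedBall {r : ℝ} (hr : 0 < r) {p : V} (hp : ‖p‖ = r) :
    IsC1GraphAt (Metric.closedBall (0 : V) r)ᶜ p := by
  have he : ‖-(r⁻¹ • p)‖ = 1 := by
    rw [norm_neg, norm_smul, norm_inv, Real.norm_of_nonneg hr.le, hp, inv_mul_cancel₀ hr.ne']
  set e := -(r⁻¹ • p) with hedef
  have hep : p = (-r) • e := by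
    rw [hedef, smul_neg, neg_smul, neg_neg, smul_smul, mul_inv_cancel₀ hr.ne', one_smul]
  have hproj0 : hproj e p = 0 := by rw [hep, map_smul, hproj_self, smul_zero]
  refine ⟨e, he, fun y => - Real.sqrt (r ^ 2 - ‖y‖ ^ 2), ?_, ?_⟩
  · rw [hproj0]
    refine ContDiffAt.neg (ContDiffAt.sqrt (contDiffAt_const.sub (contDiff_norm_sq ℝ).contDiffAt) ?_)
    simpa using hr.ne'
  · have hev : ∀ᶠ x in 𝓝 p, inner ℝ e x < 0 := by
      have hc : ContinuousAt (fun x => inner ℝ e x) p := by fun_prop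
      refine hc.eventually (gt_mem_nhds ?_)
      change inner ℝ e p < 0
      rw [hep, inner_smul_right, real_inner_self_eq_norm_sq, he]
      linarith
    filter_upwards [hev] with x hx
    have h1 : ‖hproj e x‖ ^ 2 = ‖x‖ ^ 2 - inner ℝ e x ^ 2 := by
      have h2 : ‖hproj e x‖ = ‖(hproj e x : V)‖ := rfl
      rw [h2, coe_hproj he, norm_sub_sq_real, inner_smul_right, norm_smul, he,
        real_inner_comm, mul_one, Real.norm_eq_abs, sq_abs]
      ring
    rw [mem_compl_iff, mem_closedBall_zero_iff, not_le, lt_neg, Real.sqrt_lt' (by linarith), h1,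
      ← sq_lt_sq₀ hr.le (norm_nonneg x)]
    constructor <;> intro h <;> nlinarith

theorem isNormalAt_compl_closedBall {r : ℝ} (hr : 0 < r) {p : V} (hp : ‖p‖ = r) :
    IsNormalAt (Metric.closedBall (0 : V) r)ᶜ p (-(r⁻¹ • p)) := by
  refine ⟨?_, fun x => r ^ 2 - ‖x‖ ^ 2, 2 * r, by positivity, ?_, ?_, ?_⟩
  · rw [norm_neg, norm_smul, norm_inv, Real.norm_of_nonneg hr.le, hp, inv_mul_cancel₀ hr.ne']
  · have h := (hasStrictFDerivAt_norm_sq p).hasFDerivAt.const_sub (r ^ 2)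
    have he : (2 * r) • innerSL ℝ (-(r⁻¹ • p)) = -(2 • innerSL ℝ p) := by
      refine ContinuousLinearMap.ext fun w => ?_
      change 2 * r * inner ℝ (-(r⁻¹ • p)) w = -((2 • innerSL ℝ p) w)
      rw [inner_neg_left, real_inner_smul_left, two_nsmul, _root_.add_apply, innerSL_apply_apply]
      field_simp
      ring
    rw [he]
    exact h
  · change r ^ 2 - ‖p‖ ^ 2 = 0
    rw [hp, sub_self]
  · refine Eventually.of_forall fun x => ?_
    rw [mem_compl_iff, mem_closedBall_zero_iff, not_le, sub_neg, sq_lt_sq₀ hr.le (norm_nonneg x)]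

/-- The divergence theorem on a ball. -/
theorem integral_closedBall_fderiv {r : ℝ} (hr : 0 < r) (u : V) {h : V → ℝ} (hh : ContDiff ℝ 1 h) :
    IntegrableOn (fun x => h x * (inner ℝ x u / r)) (Metric.sphere 0 r)
      μHE[Module.finrank ℝ V - 1] ∧
    ∫ x in Metric.closedBall 0 r, fderiv ℝ h x u =
      ∫ x in Metric.sphere 0 r, h x * (inner ℝ x u / r) ∂μHE[Module.finrank ℝ V - 1] := by
  -- The general formula concerns complements, so Ω is the exterior of the ball, with outward normal
  -- -x/r; the two signs cancel.
  set Ω : Set V := (Metric.closedBall 0 r)ᶜ with hΩdef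
  have hΩc : Ωᶜ = Metric.closedBall 0 r := compl_compl _
  have hfr : frontier Ω = Metric.sphere 0 r := by
    rw [hΩdef, frontier_compl, frontier_closedBall _ hr.ne']
  have hus : UniqueDiffOn ℝ Ωᶜ := by
    rw [hΩc]
    refine uniqueDiffOn_convex (convex_closedBall _ _) ?_
    rw [interior_closedBall _ hr.ne']
    exact ⟨0, Metric.mem_ball_self hr⟩
  have hg := gaussGreen_of_eq_zero (Ω := Ω) (K := Metric.closedBall 0 r)
    Metric.isClosed_closedBall.isOpen_compl (isCompact_closedBall _ _) (N := fun x => -(r⁻¹ • x)) u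
    hus hh.contDiffOn (fun x hx hx' => absurd (hΩc ▸ hx) hx')
    (fun p hp => isC1GraphAt_compl_closedBall hr (by
      have := hp.2
      rwa [hfr, mem_sphere_zero_iff_norm] at this))
    (fun q hq _ => isNormalAt_compl_closedBall hr (by rwa [hfr, mem_sphere_zero_iff_norm] at hq))
  have hfun : (fun x => h x * inner ℝ (-(r⁻¹ • x)) u) = fun x => -(h x * (inner ℝ x u / r)) := by
    ext x
    rw [inner_neg_left, real_inner_smul_left]
    ring
  rw [hfun, hfr, hΩc, integral_neg, neg_neg] at hg
  refine ⟨by simpa using hg.1.neg, ?_⟩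
  rw [← hg.2]
  refine setIntegral_congr_fun measurableSet_closedBall fun x hx => ?_
  rw [hΩc] at hus
  rw [DifferentiableAt.fderivWithin (hh.differentiable one_ne_zero x) (hus x hx)]

end Divergence

/-- The derivative of a differentiable map vanishes almost everywhere on its zero set. -/
theorem ae_fderivWithin_eq_zero {n : ℕ} {s : Set (E n)} {F : E n → E n} (hs : IsClosed s)
    (hF : DifferentiableOn ℝ F s) :
    ∀ᵐ x ∂(volume.restrict s), F x = 0 → fderivWithin ℝ F s x = 0 := by
  have hZ : MeasurableSet {x ∈ s | F x = 0} := by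
    exact (hF.continuousOn.preimage_isClosed_of_isClosed hs (isClosed_singleton (x := (0 : E n)))).measurableSet
  -- On its zero set F is approximated by the zero map with error constant 0, which at almost every
  -- point (density points) bounds the derivative by 0.
  have hA : ApproximatesLinearOn F (0 : E n →L[ℝ] E n) {x ∈ s | F x = 0} 0 := by
    intro x hx y hy
    simp [hx.2, hy.2]
  have h := hA.norm_fderiv_sub_le volume hZ (fderivWithin ℝ F s) fun x hx =>
    (hF x hx.1).hasFDerivWithinAt.mono (sep_subset _ _)
  rw [ae_restrict_iff' hZ] at h
  rw [ae_restrict_iff' hs.measurableSet]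
  filter_upwards [h] with x hx hxs h0
  simpa using hx ⟨hxs, h0⟩

end GBC

namespace GBC

/-! ### Removing the critical points by cutting off in |Df|² -/

section Cutoff

/-- A smooth step from `0` on `q ≤ 1 / (k + 1)` to `1` on `q ≥ 2 / (k + 1)`. -/
noncomputable def cutoff (k : ℕ) (q : ℝ) : ℝ := Real.smoothTransition ((k + 1) * q - 1)

theorem contDiff_cutoff (k : ℕ) : ContDiff ℝ ∞ (cutoff k) :=
  Real.smoothTransition.contDiff.comp ((contDiff_const.mul contDiff_id).sub contDiff_const)

theorem cutoff_nonneg (k : ℕ) (q : ℝ) : 0 ≤ cutoff k q := Real.smoothTransition.nonneg _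

theorem cutoff_le_one (k : ℕ) (q : ℝ) : cutoff k q ≤ 1 := Real.smoothTransition.le_one _

theorem cutoff_eq_zero {k : ℕ} {q : ℝ} (h : (k + 1) * q ≤ 1) : cutoff k q = 0 :=
  Real.smoothTransition.zero_of_nonpos (by linarith)

theorem eventually_cutoff_eq_one {q : ℝ} (hq : 0 < q) : ∀ᶠ k : ℕ in atTop, 2 < (k + 1) * q := by
  have h : Tendsto (fun k : ℕ => ((k : ℝ) + 1) * q) atTop atTop :=
    (tendsto_atTop_add_const_right _ 1 tendsto_natCast_atTop_atTop).atTop_mul_const hq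
  exact h.eventually_gt_atTop 2

theorem cutoff_eq_one {k : ℕ} {q : ℝ} (h : 2 ≤ (k + 1) * q) : cutoff k q = 1 :=
  Real.smoothTransition.one_of_one_le (by linarith)

theorem deriv_cutoff (k : ℕ) (q : ℝ) :
    deriv (cutoff k) q = deriv Real.smoothTransition ((k + 1) * q - 1) * (k + 1) := by
  have h1 : HasDerivAt (fun q : ℝ => ((k : ℝ) + 1) * q - 1) (k + 1) q := by
    simpa using ((hasDerivAt_id q).const_mul ((k : ℝ) + 1)).sub_const 1
  have h2 := ((Real.smoothTransition.contDiff (n := 1)).differentiable one_ne_zero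
    ((k + 1) * q - 1)).hasDerivAt
  exact (h2.comp q h1).deriv

theorem deriv_smoothTransition_of_one_lt {x : ℝ} (hx : 1 < x) :
    deriv Real.smoothTransition x = 0 := by
  have : Real.smoothTransition =ᶠ[𝓝 x] fun _ => 1 := by
    filter_upwards [lt_mem_nhds hx] with y hy
    exact Real.smoothTransition.one_of_one_le hy.le
  rw [this.deriv_eq, deriv_const]

theorem deriv_smoothTransition_of_neg {x : ℝ} (hx : x < 0) : deriv Real.smoothTransition x = 0 := by
  have : Real.smoothTransition =ᶠ[𝓝 x] fun _ => 0 := by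
    filter_upwards [gt_mem_nhds hx] with y hy
    exact Real.smoothTransition.zero_of_nonpos hy.le
  rw [this.deriv_eq, deriv_const]

theorem deriv_cutoff_eq_zero {k : ℕ} {q : ℝ} (h : 2 < (k + 1) * q) : deriv (cutoff k) q = 0 := by
  rw [deriv_cutoff, deriv_smoothTransition_of_one_lt (by linarith), zero_mul]

/-- Scale invariance: with t = (k+1)q the product is |S'(t - 1)| t, S being the fixed smooth step.
It vanishes unless 1 ≤ t ≤ 2, which gives the factor 2. -/
theorem exists_abs_deriv_cutoff_mul_le :
    ∃ M, 0 ≤ M ∧ ∀ (k : ℕ) (q : ℝ), 0 ≤ q → |deriv (cutoff k) q| * q ≤ M := by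
  have hc : Continuous (deriv Real.smoothTransition) :=
    (Real.smoothTransition.contDiff (n := 1)).continuous_deriv le_rfl
  obtain ⟨M, hM⟩ := isCompact_Icc.exists_bound_of_continuousOn (hc.continuousOn (s := Icc 0 1))
  have hM0 : 0 ≤ M := (norm_nonneg _).trans (hM 0 (by simp))
  refine ⟨M * 2, by positivity, fun k q hq => ?_⟩
  have hk : (0 : ℝ) ≤ k + 1 := by positivity
  rw [deriv_cutoff, abs_mul, abs_of_nonneg hk, mul_assoc]
  set t := ((k : ℝ) + 1) * q with ht
  have ht0 : 0 ≤ t := mul_nonneg hk hq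
  rcases lt_or_ge (t - 1) 0 with h | h
  · rw [deriv_smoothTransition_of_neg h, abs_zero, zero_mul]
    positivity
  rcases lt_or_ge 1 (t - 1) with h' | h'
  · rw [deriv_smoothTransition_of_one_lt h', abs_zero, zero_mul]
    positivity
  · exact mul_le_mul (hM _ ⟨h, h'⟩) (by linarith) ht0 hM0

variable {n : ℕ} {s K : Set (E n)} {Q h : E n → ℝ}

theorem pd_cutoff_mul (hs : UniqueDiffOn ℝ s) (hQ : ContDiffOn ℝ ∞ Q s) (hh : ContDiffOn ℝ ∞ h s)
    {x : E n} (hx : x ∈ s) (i : Fin n) (k : ℕ) :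
    pd s i (fun y => cutoff k (Q y) * h y) x =
      deriv (cutoff k) (Q x) * pd s i Q x * h x + cutoff k (Q x) * pd s i h x := by
  have hc : ContDiffOn ℝ ∞ (fun y => cutoff k (Q y)) s :=
    (contDiff_cutoff k).contDiffOn.comp hQ (mapsTo_univ Q s)
  rw [pd_mul (hs x hx) (hc.diffWithin hx) (hh.diffWithin hx)]
  congr 2
  have h1 : HasDerivAt (cutoff k) (deriv (cutoff k) (Q x)) (Q x) :=
    ((contDiff_cutoff k).differentiable (by simp) (Q x)).hasDerivAt
  have h2 := h1.comp_hasFDerivWithinAt x (hQ.diffWithin hx).hasFDerivWithinAt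
  change fderivWithin ℝ (cutoff k ∘ Q) s x _ = _
  rw [h2.fderivWithin (hs x hx)]
  rfl

theorem pd_eq_zero_of_notMem (hK : IsClosed K) (h0 : ∀ x ∈ s, x ∉ K → h x = 0) {x : E n}
    (hx : x ∈ s) (hxK : x ∉ K) (i : Fin n) : pd s i h x = 0 := by
  have : h =ᶠ[𝓝[s] x] fun _ => 0 := by
    filter_upwards [self_mem_nhdsWithin, mem_nhdsWithin_of_mem_nhds (hK.isOpen_compl.mem_nhds hxK)]
      with y hy hyK using h0 y hy hyK
  rw [pd, this.fderivWithin_eq (h0 x hx hxK), fderivWithin_fun_const]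
  rfl

/-- Dominated convergence. As h and ∂Q are O(√Q), the term with the differentiated cutoff is at most
a constant times |η_k'(Q)| Q, bounded uniformly in k. Where Q > 0 the cutoff is eventually 1; where
Q = 0, h vanishes, and so does ∂h almost everywhere. -/
theorem tendsto_integral_pd_cutoff (hs : UniqueDiffOn ℝ s) (hsc : IsClosed s) (hK : IsCompact K)
    (hQ : ContDiffOn ℝ ∞ Q s) (hQ0 : ∀ x ∈ s, 0 ≤ Q x) (hh : ContDiffOn ℝ ∞ h s)
    (h0 : ∀ x ∈ s, x ∉ K → h x = 0) (i : Fin n) {C D : ℝ}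
    (hC : ∀ x ∈ s ∩ K, |h x| ≤ C * √(Q x)) (hD : ∀ x ∈ s ∩ K, |pd s i Q x| ≤ D * √(Q x))
    (hae : ∀ᵐ x ∂(volume.restrict s), Q x = 0 → pd s i h x = 0) :
    Tendsto (fun k : ℕ => ∫ x in s, pd s i (fun y => cutoff k (Q y) * h y) x) atTop
      (𝓝 (∫ x in s, pd s i h x)) := by
  obtain ⟨M, hM0, hM⟩ := exists_abs_deriv_cutoff_mul_le
  have hpd : ContinuousOn (pd s i h) s := (contDiffOn_pd hs hh i).continuousOn
  obtain ⟨B, hB⟩ := (hK.inter_left hsc).exists_bound_of_continuousOn (hpd.mono inter_subset_left)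
  have hkey (x : E n) (hx : x ∈ s) : Q x = 0 → h x = 0 := fun hq => by
    by_cases hxK : x ∈ K
    · have := hC x ⟨hx, hxK⟩
      rw [hq, Real.sqrt_zero, mul_zero] at this
      exact abs_nonpos_iff.1 this
    · exact h0 x hx hxK
  refine tendsto_integral_of_dominated_convergence (K.indicator fun _ => |D| * |C| * M + |B|)
    (fun k => ?_) ?_ (fun k => ?_) ?_
  · have hc := ((contDiff_cutoff k).contDiffOn.comp hQ (mapsTo_univ Q s))
    exact (contDiffOn_pd hs (hc.mul hh) i).continuousOn.aestronglyMeasurable hsc.measurableSet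
  · refine Integrable.integrableOn ?_
    rw [integrable_indicator_iff hK.isClosed.measurableSet]
    exact integrableOn_const hK.measure_lt_top.ne
  · refine (ae_restrict_iff' hsc.measurableSet).2 (Eventually.of_forall fun x hx => ?_)
    by_cases hxK : x ∈ K
    · rw [indicator_of_mem hxK, pd_cutoff_mul hs hQ hh hx, Real.norm_eq_abs]
      refine (abs_add_le _ _).trans (add_le_add ?_ ?_)
      · have hq := Real.sqrt_nonneg (Q x)
        calc |deriv (cutoff k) (Q x) * pd s i Q x * h x|
            = |deriv (cutoff k) (Q x)| * (|pd s i Q x| * |h x|) := by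
              rw [abs_mul, abs_mul, mul_assoc]
          _ ≤ |deriv (cutoff k) (Q x)| * ((|D| * √(Q x)) * (|C| * √(Q x))) := by
              gcongr
              · exact (hD x ⟨hx, hxK⟩).trans (by gcongr; exact le_abs_self D)
              · exact (hC x ⟨hx, hxK⟩).trans (by gcongr; exact le_abs_self C)
          _ = |D| * |C| * (|deriv (cutoff k) (Q x)| * (√(Q x) * √(Q x))) := by ring
          _ ≤ |D| * |C| * M := by
              rw [Real.mul_self_sqrt (hQ0 x hx)]
              gcongr
              exact hM k (Q x) (hQ0 x hx)
      · rw [abs_mul, abs_of_nonneg (cutoff_nonneg _ _)]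
        exact (mul_le_of_le_one_left (abs_nonneg _) (cutoff_le_one _ _)).trans
          ((hB x ⟨hx, hxK⟩).trans (le_abs_self B))
    · rw [indicator_of_notMem hxK, pd_eq_zero_of_notMem hK.isClosed _ hx hxK, norm_zero]
      intro y hy hyK
      rw [h0 y hy hyK, mul_zero]
  · filter_upwards [hae, ae_restrict_mem hsc.measurableSet] with x hx hxs
    rcases (hQ0 x hxs).eq_or_lt with hq | hq
    · refine tendsto_const_nhds.congr fun k => ?_
      rw [pd_cutoff_mul hs hQ hh hxs, hx hq.symm, hkey x hxs hq.symm, mul_zero, mul_zero, add_zero]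
    · refine tendsto_const_nhds.congr' ?_
      filter_upwards [eventually_cutoff_eq_one hq] with k hk
      rw [pd_cutoff_mul hs hQ hh hxs, deriv_cutoff_eq_zero hk, cutoff_eq_one hk.le]
      ring

end Cutoff

end GBC

namespace GBC

/-! ### The mass field is O(|Df|) on compact sets -/

section NewtonFieldBounds

variable {n m : ℕ} {s K : Set (E n)} {f : E n → E m}

theorem normSqDf_nonneg (x : E n) : 0 ≤ normSqDf s f x :=
  Finset.sum_nonneg fun _ _ => Finset.sum_nonneg fun _ _ => sq_nonneg _

theorem abs_d1_le (a : Fin m) (i : Fin n) (x : E n) : |d1 s f a i x| ≤ √(normSqDf s f x) := by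
  refine Real.abs_le_sqrt ?_
  exact (Finset.single_le_sum (f := fun i => d1 s f a i x ^ 2) (fun _ _ => sq_nonneg _)
    (Finset.mem_univ i)).trans (Finset.single_le_sum (f := fun a => ∑ i, d1 s f a i x ^ 2)
      (fun _ _ => Finset.sum_nonneg fun _ _ => sq_nonneg _) (Finset.mem_univ a))

theorem exists_abs_sum_mul_d1_le (hs : IsClosed s) (hK : IsCompact K) {B : Fin m → Fin n → E n → ℝ}
    (hB : ∀ a i, ContinuousOn (B a i) s) :
    ∃ C, ∀ x ∈ s ∩ K, |∑ a, ∑ i, B a i x * d1 s f a i x| ≤ C * √(normSqDf s f x) := by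
  have hc : ContinuousOn (fun x => ∑ a, ∑ i, |B a i x|) s :=
    continuousOn_finsetSum _ fun a _ => continuousOn_finsetSum _ fun i _ => (hB a i).abs
  obtain ⟨C, hC⟩ := (hK.inter_left hs).exists_bound_of_continuousOn (hc.mono inter_subset_left)
  refine ⟨C, fun x hx => ?_⟩
  calc |∑ a, ∑ i, B a i x * d1 s f a i x| ≤ ∑ a, ∑ i, |B a i x * d1 s f a i x| :=
        (Finset.abs_sum_le_sum_abs _ _).trans
          (Finset.sum_le_sum fun a _ => Finset.abs_sum_le_sum_abs _ _)
    _ ≤ ∑ a, ∑ i, |B a i x| * √(normSqDf s f x) := by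
        refine Finset.sum_le_sum fun a _ => Finset.sum_le_sum fun i _ => ?_
        rw [abs_mul]
        exact mul_le_mul_of_nonneg_left (abs_d1_le a i x) (abs_nonneg _)
    _ = (∑ a, ∑ i, |B a i x|) * √(normSqDf s f x) := by simp only [Finset.sum_mul]
    _ ≤ C * √(normSqDf s f x) :=
        mul_le_mul_of_nonneg_right ((le_abs_self _).trans (hC x hx)) (Real.sqrt_nonneg _)

theorem ae_pd_eq_zero (hs : IsClosed s) {h : E n → ℝ} (hh : DifferentiableOn ℝ h s) (i : Fin n)
    (hus : UniqueDiffOn ℝ s) : ∀ᵐ x ∂(volume.restrict s), h x = 0 → pd s i h x = 0 := by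
  -- The zero-set lemma is about maps of the space to itself, so h is multiplied by a basis vector.
  have hF : DifferentiableOn ℝ (fun x => h x • (EuclideanSpace.single i 1 : E n)) s :=
    hh.smul_const _
  filter_upwards [ae_fderivWithin_eq_zero hs hF, ae_restrict_mem hs.measurableSet] with x hx hxs h0
  have h1 := hx (by rw [h0, zero_smul])
  rw [fderivWithin_smul_const (hus x hxs) (hh x hxs)] at h1
  have h2 := congrArg (fun v : E n => v i) (DFunLike.congr_fun h1 (EuclideanSpace.single i 1))
  simpa [pd] using h2

variable (hus : UniqueDiffOn ℝ s) (hs : IsClosed s) (hK : IsCompact K) (hf : ContDiffOn ℝ ∞ f s)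
include hus hf

theorem contDiffOn_normSqDf : ContDiffOn ℝ ∞ (normSqDf s f) s :=
  ContDiffOn.sum fun a _ => ContDiffOn.sum fun i _ => (contDiffOn_d1 hus hf a i).pow 2

include hs hK

theorem exists_abs_pd_normSqDf_le (i : Fin n) :
    ∃ C, ∀ x ∈ s ∩ K, |pd s i (normSqDf s f) x| ≤ C * √(normSqDf s f x) := by
  obtain ⟨C, hC⟩ := exists_abs_sum_mul_d1_le (f := f) hs hK
    (B := fun a j x => 2 * pd s i (d1 s f a j) x) fun a j =>
      continuousOn_const.mul (contDiffOn_pd hus (contDiffOn_d1 hus hf a j) i).continuousOn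
  refine ⟨C, fun x hx => ?_⟩
  have hd (a : Fin m) (j : Fin n) := (contDiffOn_d1 hus hf a j).diffWithin hx.1
  have hd2 (a : Fin m) (j : Fin n) : DifferentiableWithinAt ℝ (fun y => d1 s f a j y ^ 2) s x :=
    (hd a j).pow 2
  have hp (a : Fin m) (j : Fin n) :
      pd s i (fun y => d1 s f a j y ^ 2) x = 2 * pd s i (d1 s f a j) x * d1 s f a j x := by
    simp only [pow_two]
    rw [pd_mul (hus x hx.1) (hd a j) (hd a j)]
    ring
  have heq : pd s i (normSqDf s f) x = ∑ a, ∑ j, 2 * pd s i (d1 s f a j) x * d1 s f a j x := by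
    change pd s i (fun y => ∑ a, ∑ j, d1 s f a j y ^ 2) x = _
    rw [pd_sum (hus x hx.1) _ fun a _ => DifferentiableWithinAt.fun_sum fun j _ => hd2 a j]
    refine Finset.sum_congr rfl fun a _ => ?_
    rw [pd_sum (hus x hx.1) _ fun j _ => hd2 a j]
    exact Finset.sum_congr rfl fun j _ => hp a j
  rw [heq]
  exact hC x hx

/-- The field is linear in the explicit factor Df^a of ∇f^a, and the remaining coefficients are
continuous up to the boundary. -/
theorem exists_abs_newtonField_le (i : Fin n) :
    ∃ C, ∀ x ∈ s ∩ K, |newtonField s f x i| ≤ C * √(normSqDf s f x) := by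
  have hU := smoothM_normalGram_inv hus hf
  have hA := fun a => smoothM_shapeOp hus hf a
  obtain ⟨C, hC⟩ := exists_abs_sum_mul_d1_le (f := f) hs hK
    (B := fun a j x => (1 / 2 : ℝ) * ∑ p, ∑ q, (normalGram s f x)⁻¹ p q *
      (polarNewton (shapeOp s f a x) (shapeOp s f p x) (shapeOp s f q x)
        * (graphMetric s f x)⁻¹) i j) fun a j => by
      refine ContDiffOn.continuousOn (𝕜 := ℝ) (n := ∞) (contDiffOn_const.mul
        (ContDiffOn.sum fun p _ => ContDiffOn.sum fun q _ => (hU p q).mul ?_))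
      exact ((hA a).polarNewton (hA p) (hA q)).mul (smoothM_graphMetric_inv hus hf) i j
  refine ⟨C, fun x hx => ?_⟩
  have heq : newtonField s f x i = ∑ a, ∑ j, ((1 / 2 : ℝ) * ∑ p, ∑ q, (normalGram s f x)⁻¹ p q *
      (polarNewton (shapeOp s f a x) (shapeOp s f p x) (shapeOp s f q x)
        * (graphMetric s f x)⁻¹) i j) * d1 s f a j x := by
    simp only [newtonField, Pi.smul_apply, Finset.sum_apply, smul_eq_mul, gradF,
      Matrix.mulVec_mulVec]
    rw [Finset.mul_sum]
    refine Finset.sum_congr rfl fun a _ => ?_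
    simp only [Matrix.mulVec, dotProduct, Finset.mul_sum, Finset.sum_mul]
    symm
    rw [Finset.sum_comm]
    refine Finset.sum_congr rfl fun p _ => ?_
    rw [Finset.sum_comm]
    exact Finset.sum_congr rfl fun q _ => Finset.sum_congr rfl fun j _ => by ring
  rw [heq]
  exact hC x hx

end NewtonFieldBounds

/-! ### Normal and flux at boundary points with Df ≠ 0 -/

section BoundaryNormal

variable {n m : ℕ} {Ω : Set (E n)} {f : E n → E m} {p : E n}

open Classical in
/-- The outward unit normal of `Ω` at points where the boundary is `C²`, and `0` elsewhere. -/
noncomputable def boundaryNormal (Ω : Set (E n)) (p : E n) : E n :=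
  if h : ∃ ρ, IsDefiningFunctionAt Ω ρ p then WithLp.toLp 2 (unitNormal (Classical.choose h) p)
  else 0

variable (hΩ : IsOpen Ω) (hL : HasLipschitzBoundary Ω) (hf : ContDiffOn ℝ ∞ f Ωᶜ)
  (hp : p ∈ frontier Ω) (hconst : ∀ q ∈ connectedComponentIn (frontier Ω) p, f q = f p)
  (hne : normSqDf Ωᶜ f p ≠ 0)
include hΩ hL hf hp hconst hne

theorem exists_contDiffAt_graphFunction : ∃ e ρ, IsGraphFunctionAt Ω p e ρ ∧ ContDiffAt ℝ 2 ρ p := by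
  obtain ⟨e, ρ, h⟩ := hL.exists_isGraphFunctionAt hp
  have hus := hL.uniqueDiffOn_compl hΩ
  have hev := h.eventually_eq_of_const hΩ hp hconst
  -- One component with nonzero derivative suffices for the regularity argument.
  obtain ⟨a, ha⟩ : ∃ a, fderivWithin ℝ (fun y => f y a) Ωᶜ p ≠ 0 := by
    by_contra! h0
    refine hne (Finset.sum_eq_zero fun a _ => Finset.sum_eq_zero fun i _ => ?_)
    simp [d1, pd, h0 a]
  refine ⟨e, ρ, h, contDiffAt_of_const_along hΩ hus h hp (c := f p a) (contDiffOn_coord hus hf a) ha ?_⟩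
  filter_upwards [hev] with x hx
  exact ⟨hx.1, by rw [hx.2]⟩

theorem exists_isDefiningFunctionAt : ∃ ρ, IsDefiningFunctionAt Ω ρ p := by
  obtain ⟨e, ρ, h, hρ⟩ := exists_contDiffAt_graphFunction hΩ hL hf hp hconst hne
  exact ⟨ρ, h.isDefiningFunctionAt hρ⟩

theorem isC1GraphAt_of_normSqDf_ne_zero : IsC1GraphAt Ω p := by
  obtain ⟨e, ρ, h, hρ⟩ := exists_contDiffAt_graphFunction hΩ hL hf hp hconst hne
  exact h.isC1GraphAt hρ

theorem isNormalAt_boundaryNormal : IsNormalAt Ω p (boundaryNormal Ω p) := by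
  have h := exists_isDefiningFunctionAt hΩ hL hf hp hconst hne
  rw [boundaryNormal, dif_pos h]
  exact (Classical.choose_spec h).isNormalAt hΩ hp

theorem sum_newtonField_mul_boundaryNormal :
    ∑ i, newtonField Ωᶜ f p i * boundaryNormal Ω p i =
      3 * ((normSqDf Ωᶜ f p / (1 + normSqDf Ωᶜ f p)) ^ 2 * thirdMeanCurvature Ω p) := by
  obtain ⟨e, ρ₀, h₀, hρ₀⟩ := exists_contDiffAt_graphFunction hΩ hL hf hp hconst hne
  have h := exists_isDefiningFunctionAt hΩ hL hf hp hconst hne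
  have hev := h₀.eventually_eq_of_const hΩ hp hconst
  have hρ := Classical.choose_spec h
  choose c hc using fun a => exists_eq_smul_normal hΩ hL hf h₀ hρ₀ hp hev hρ a
  -- The normal and H₃ are both evaluated with the same chosen defining function, so no independence
  -- of the choice is needed here.
  rw [boundaryNormal, dif_pos h, thirdMeanCurvature, dif_pos h]
  exact newtonField_dotProduct_unit (sum_unitNormal_sq hρ.2.1) c _ (levelShapeOp_transpose hρ.1)
    (fun a => (hc a).1) fun a => (hc a).2

end BoundaryNormal

end GBC

namespace GBC

/-! ### Flux through the whole Lipschitz boundary -/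

section BoundaryFlux

variable {n m : ℕ} {Ω K : Set (E n)} {f : E n → E m} {χ : E n → ℝ}

theorem frontier_subset_compl (hΩ : IsOpen Ω) : frontier Ω ⊆ Ωᶜ := fun _ hx hxΩ =>
  (hΩ.frontier_eq ▸ hx).2 hxΩ

/-- The boundary integrand `(|Df|² / (1 + |Df|²))² H₃`. -/
noncomputable def boundaryDensity (Ω : Set (E n)) (f : E n → E m) (x : E n) : ℝ :=
  (normSqDf Ωᶜ f x / (1 + normSqDf Ωᶜ f x)) ^ 2 * thirdMeanCurvature Ω x

variable (hΩ : IsOpen Ω) (hL : HasLipschitzBoundary Ω) (hf : ContDiffOn ℝ ∞ f Ωᶜ)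
  (hconst : ∀ p ∈ frontier Ω, ∀ q ∈ connectedComponentIn (frontier Ω) p, f q = f p)
  (hK : IsCompact K) (hχ : ContDiff ℝ ∞ χ) (hχK : ∀ x ∉ K, χ x = 0)
include hΩ hL hf hconst hK hχ hχK

/-- The divergence theorem for the cut-off field, away from the critical points of `f`. -/
theorem cutoff_gaussGreen (hχ1 : ∀ x ∈ frontier Ω, χ x = 1) (k : ℕ) :
    IntegrableOn (fun x => cutoff k (normSqDf Ωᶜ f x) * (3 * boundaryDensity Ω f x)) (frontier Ω)
      μHE[n - 1] ∧
    ∑ i, ∫ x in Ωᶜ, pd Ωᶜ i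
        (fun y => cutoff k (normSqDf Ωᶜ f y) * (χ y * newtonField Ωᶜ f y i)) x =
      - ∫ x in frontier Ω, cutoff k (normSqDf Ωᶜ f x) * (3 * boundaryDensity Ω f x) ∂μHE[n - 1] := by
  have hus := hL.uniqueDiffOn_compl hΩ
  have hsc : IsClosed Ωᶜ := hΩ.isClosed_compl
  have hfs := frontier_subset_compl hΩ
  have hQ : ContDiffOn ℝ ∞ (normSqDf Ωᶜ f) Ωᶜ := contDiffOn_normSqDf hus hf
  have hY := smoothV_newtonField hus hf
  have hη : ContDiffOn ℝ ∞ (fun y => cutoff k (normSqDf Ωᶜ f y)) Ωᶜ :=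
    (contDiff_cutoff k).contDiffOn.comp hQ (mapsTo_univ _ _)
  have hcl : IsClosed {x ∈ Ωᶜ | 1 ≤ ((k : ℝ) + 1) * normSqDf Ωᶜ f x} :=
    (continuousOn_const.mul hQ.continuousOn).preimage_isClosed_of_isClosed hsc isClosed_Ici
  have hη0 {x : E n} (h : cutoff k (normSqDf Ωᶜ f x) ≠ 0) :
      1 ≤ ((k : ℝ) + 1) * normSqDf Ωᶜ f x ∧ normSqDf Ωᶜ f x ≠ 0 := by
    refine ⟨le_of_lt (not_le.1 fun hle => h (cutoff_eq_zero hle)), fun h0 => h (cutoff_eq_zero ?_)⟩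
    rw [h0]
    norm_num
  have hpos {x : E n} (h : 1 ≤ ((k : ℝ) + 1) * normSqDf Ωᶜ f x) : normSqDf Ωᶜ f x ≠ 0 := by
    rintro h0
    rw [h0, mul_zero] at h
    norm_num at h
  have key (i : Fin n) := gaussGreen_of_eq_zero (Ω := Ω)
    (h := fun y => cutoff k (normSqDf Ωᶜ f y) * (χ y * newtonField Ωᶜ f y i))
    -- Outside this compact set the cut-off field vanishes, and at its boundary points Df ≠ 0, so Σ
    -- is a C¹ graph there.
    (K := K ∩ {x ∈ Ωᶜ | 1 ≤ ((k : ℝ) + 1) * normSqDf Ωᶜ f x}) hΩ (hK.inter_right hcl)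
    (N := boundaryNormal Ω) (EuclideanSpace.single i (1 : ℝ)) hus
    ((hη.mul (hχ.contDiffOn.mul (hY i))).of_le (by simp))
    (fun x hx hxK => by
      by_cases h1 : x ∈ K
      · have : cutoff k (normSqDf Ωᶜ f x) = 0 := by
          by_contra h
          exact hxK ⟨h1, hx, (hη0 h).1⟩
        simp only [this, zero_mul]
      · simp only [hχK x h1, zero_mul, mul_zero])
    (fun p hp => isC1GraphAt_of_normSqDf_ne_zero hΩ hL hf hp.2 (hconst p hp.2) (hpos hp.1.2.2))
    (fun q hq hne => isNormalAt_boundaryNormal hΩ hL hf hq (hconst q hq)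
      (hη0 (left_ne_zero_of_mul hne)).2)
  simp only [finrank_euclideanSpace_fin, EuclideanSpace.inner_single_right, one_mul,
    conj_trivial] at key
  have hm : MeasurableSet (frontier Ω) := isClosed_frontier.measurableSet
  have hsum (x : E n) (hx : x ∈ frontier Ω) :
      ∑ i, cutoff k (normSqDf Ωᶜ f x) * (χ x * newtonField Ωᶜ f x i) * boundaryNormal Ω x i
        = cutoff k (normSqDf Ωᶜ f x) * (3 * boundaryDensity Ω f x) := by
    by_cases h : cutoff k (normSqDf Ωᶜ f x) = 0
    · simp only [h, zero_mul, Finset.sum_const_zero]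
    · rw [boundaryDensity, ← sum_newtonField_mul_boundaryNormal hΩ hL hf hx (hconst x hx) (hη0 h).2,
        Finset.mul_sum, hχ1 x hx]
      exact Finset.sum_congr rfl fun i _ => by ring
  refine ⟨IntegrableOn.congr_fun (integrable_finsetSum Finset.univ fun i _ => (key i).1) hsum hm, ?_⟩
  rw [← setIntegral_congr_fun hm hsum, integral_finsetSum _ fun i _ => (key i).1,
    ← Finset.sum_neg_distrib]
  exact Finset.sum_congr rfl fun i _ => (key i).2

/-- Let k → ∞ in the cut-off formula. In the domain the limit is `tendsto_integral_pd_cutoff`; on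
the boundary it is dominated convergence with a constant bound, Σ having finite area. -/
theorem boundary_flux (hb : Bornology.IsBounded Ω) (hχle : ∀ x, |χ x| ≤ 1)
    (hχ1 : ∀ x ∈ frontier Ω, χ x = 1) :
    IntegrableOn (boundaryDensity Ω f) (frontier Ω) μHE[n - 1] ∧
    ∑ i, ∫ x in Ωᶜ, pd Ωᶜ i (fun y => χ y * newtonField Ωᶜ f y i) x =
      - (3 * ∫ x in frontier Ω, boundaryDensity Ω f x ∂μHE[n - 1]) := by
  have hus := hL.uniqueDiffOn_compl hΩ
  have hsc : IsClosed Ωᶜ := hΩ.isClosed_compl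
  have hfs := frontier_subset_compl hΩ
  have hQ : ContDiffOn ℝ ∞ (normSqDf Ωᶜ f) Ωᶜ := contDiffOn_normSqDf hus hf
  have hY := smoothV_newtonField hus hf
  have hm : MeasurableSet (frontier Ω) := isClosed_frontier.measurableSet
  have hcomp : IsCompact (frontier Ω) :=
    Metric.isCompact_of_isClosed_isBounded isClosed_frontier
      (hb.closure.subset frontier_subset_closure)
  have hfin := hL.measure_frontier_lt_top hΩ hb
  have hG := cutoff_gaussGreen hΩ hL hf hconst hK hχ hχK hχ1
  have hlim (i : Fin n) : Tendsto (fun k : ℕ => ∫ x in Ωᶜ, pd Ωᶜ i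
      (fun y => cutoff k (normSqDf Ωᶜ f y) * (χ y * newtonField Ωᶜ f y i)) x) atTop
      (𝓝 (∫ x in Ωᶜ, pd Ωᶜ i (fun y => χ y * newtonField Ωᶜ f y i) x)) := by
    obtain ⟨C, hC⟩ := exists_abs_newtonField_le hus hsc hK hf i
    obtain ⟨D, hD⟩ := exists_abs_pd_normSqDf_le hus hsc hK hf i
    have hh : ContDiffOn ℝ ∞ (fun y => χ y * newtonField Ωᶜ f y i) Ωᶜ := hχ.contDiffOn.mul (hY i)
    refine tendsto_integral_pd_cutoff hus hsc hK hQ (fun x _ => normSqDf_nonneg x) hh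
      (fun x _ hxK => by rw [hχK x hxK, zero_mul]) i (C := C) (fun x hx => ?_) hD ?_
    · rw [abs_mul]
      exact (mul_le_of_le_one_left (abs_nonneg _) (hχle x)).trans (hC x hx)
    · filter_upwards [ae_pd_eq_zero hsc (hh.differentiableOn (by simp)) i hus,
        ae_restrict_mem hsc.measurableSet] with x hx hxs h0
      refine hx ?_
      by_cases hxK : x ∈ K
      · have h1 := hC x ⟨hxs, hxK⟩
        rw [h0, Real.sqrt_zero, mul_zero] at h1
        rw [abs_nonpos_iff.1 h1, mul_zero]
      · rw [hχK x hxK, zero_mul]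
  -- H₃ itself may blow up towards critical points, but three times the density is Y·ν with |ν| = 1
  -- and Y continuous on the compact boundary.
  obtain ⟨B, hB⟩ : ∃ B, ∀ x ∈ frontier Ω, normSqDf Ωᶜ f x ≠ 0 → ‖boundaryDensity Ω f x‖ ≤ B := by
    have hc : ContinuousOn (fun x => ∑ i, |newtonField Ωᶜ f x i|) (frontier Ω) :=
      continuousOn_finsetSum _ fun i _ => ((hY i).continuousOn.mono hfs).abs
    obtain ⟨B, hB⟩ := hcomp.exists_bound_of_continuousOn hc
    refine ⟨B, fun x hx hne => ?_⟩
    have h1 := sum_newtonField_mul_boundaryNormal hΩ hL hf hx (hconst x hx) hne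
    have hN := (isNormalAt_boundaryNormal hΩ hL hf hx (hconst x hx) hne).1
    have h2 : |∑ i, newtonField Ωᶜ f x i * boundaryNormal Ω x i| ≤ B := by
      refine (Finset.abs_sum_le_sum_abs _ _).trans (le_trans (Finset.sum_le_sum fun i _ => ?_)
        ((le_abs_self _).trans (hB x hx)))
      rw [abs_mul]
      refine mul_le_of_le_one_right (abs_nonneg _) ?_
      rw [← hN]
      exact PiLp.norm_apply_le (boundaryNormal Ω x) i
    rw [h1, abs_mul, abs_of_nonneg (by norm_num : (0 : ℝ) ≤ 3)] at h2
    change |(normSqDf Ωᶜ f x / (1 + normSqDf Ωᶜ f x)) ^ 2 * thirdMeanCurvature Ω x| ≤ B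
    linarith [abs_nonneg ((normSqDf Ωᶜ f x / (1 + normSqDf Ωᶜ f x)) ^ 2 * thirdMeanCurvature Ω x)]
  have hzero (x : E n) (h0 : normSqDf Ωᶜ f x = 0) : boundaryDensity Ω f x = 0 := by
    rw [boundaryDensity, h0, zero_div, zero_pow two_ne_zero, zero_mul]
  have hB' : ∀ x ∈ frontier Ω, ‖boundaryDensity Ω f x‖ ≤ |B| := fun x hx => by
    by_cases h0 : normSqDf Ωᶜ f x = 0
    · rw [hzero x h0, norm_zero]
      exact abs_nonneg B
    · exact (hB x hx h0).trans (le_abs_self B)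
  have hpt (x : E n) : Tendsto (fun k : ℕ => cutoff k (normSqDf Ωᶜ f x) *
      (3 * boundaryDensity Ω f x)) atTop (𝓝 (3 * boundaryDensity Ω f x)) := by
    by_cases h0 : normSqDf Ωᶜ f x = 0
    · simp only [hzero x h0, mul_zero, tendsto_const_nhds_iff]
    · refine tendsto_const_nhds.congr' ?_
      filter_upwards [eventually_cutoff_eq_one ((normSqDf_nonneg x).lt_of_ne' h0)] with k hk
      rw [cutoff_eq_one hk.le, one_mul]
  -- The density involves a choice of defining function at each point; its measurability is
  -- inherited from the cut-off integrands, which converge to it pointwise.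
  have hmeas : AEStronglyMeasurable (fun x => 3 * boundaryDensity Ω f x)
      ((μHE[n - 1] : Measure (E n)).restrict (frontier Ω)) :=
    aestronglyMeasurable_of_tendsto_ae atTop (fun k => (hG k).1.aestronglyMeasurable)
      (Eventually.of_forall hpt)
  have hconstI : Integrable (fun _ : E n => 3 * |B|)
      ((μHE[n - 1] : Measure (E n)).restrict (frontier Ω)) := integrableOn_const hfin.ne
  have hint3 : IntegrableOn (fun x => 3 * boundaryDensity Ω f x) (frontier Ω) μHE[n - 1] := by
    refine Integrable.mono' hconstI hmeas ((ae_restrict_iff' hm).2 (Eventually.of_forall fun x hx => ?_))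
    rw [norm_mul, Real.norm_of_nonneg (by norm_num : (0 : ℝ) ≤ 3)]
    exact mul_le_mul_of_nonneg_left (hB' x hx) (by norm_num)
  have hlim2 : Tendsto (fun k : ℕ => - ∫ x in frontier Ω, cutoff k (normSqDf Ωᶜ f x) *
      (3 * boundaryDensity Ω f x) ∂μHE[n - 1]) atTop
      (𝓝 (- ∫ x in frontier Ω, 3 * boundaryDensity Ω f x ∂μHE[n - 1])) := by
    refine (tendsto_integral_of_dominated_convergence (fun _ => 3 * |B|)
      (fun k => (hG k).1.aestronglyMeasurable) hconstI (fun k => ?_)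
      (Eventually.of_forall hpt)).neg
    refine (ae_restrict_iff' hm).2 (Eventually.of_forall fun x hx => ?_)
    rw [norm_mul, norm_mul, Real.norm_of_nonneg (by norm_num : (0 : ℝ) ≤ 3),
      Real.norm_of_nonneg (cutoff_nonneg _ _)]
    exact (mul_le_of_le_one_left (by positivity) (cutoff_le_one _ _)).trans
      (mul_le_mul_of_nonneg_left (hB' x hx) (by norm_num))
  refine ⟨by simpa [IntegrableOn] using hint3.const_mul (3⁻¹ : ℝ), ?_⟩
  rw [← integral_const_mul]
  refine tendsto_nhds_unique (tendsto_finsetSum Finset.univ fun i _ => hlim i) ?_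
  exact hlim2.congr fun k => (hG k).2.symm

end BoundaryFlux

end GBC

namespace GBC

/-! ### Flux through large spheres -/

section MassFlux

variable {n m : ℕ} {Ω : Set (E n)} {f : E n → E m}

/-- The flux depends only on values on the sphere, so Y may be replaced by any C¹ field on the whole
space agreeing with it there. -/
theorem massFlux_eq_sum {s : Set (E n)} (hs : UniqueDiffOn ℝ s) (hcl : s ⊆ closure (interior s))
    (hf : ContDiffOn ℝ ∞ f s) {r : ℝ} (hr : 0 < r) (hrs : Metric.sphere (0 : E n) r ⊆ s)
    {h : Fin n → E n → ℝ} (hh : ∀ i, ContDiff ℝ 1 (h i))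
    (hY : ∀ i, ∀ x ∈ Metric.sphere (0 : E n) r, h i x = newtonField s f x i) :
    massFlux s (graphMetric s f) r =
      ∑ i, ∫ x in Metric.closedBall (0 : E n) r, fderiv ℝ (h i) x (EuclideanSpace.single i 1) := by
  have hd (i : Fin n) := integral_closedBall_fderiv hr (EuclideanSpace.single i (1 : ℝ)) (hh i)
  simp only [finrank_euclideanSpace_fin, EuclideanSpace.inner_single_right, one_mul,
    conj_trivial] at hd
  rw [Finset.sum_congr rfl fun i _ => (hd i).2, ← integral_finsetSum _ fun i _ => (hd i).1]
  refine setIntegral_congr_fun Metric.isClosed_sphere.measurableSet fun x hx => ?_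
  refine Finset.sum_congr rfl fun i _ => ?_
  rw [hY i x hx, ← massField_eq hs hcl hf (hrs hx)]
  simp only [massField, Finset.sum_mul]

variable (hΩ : IsOpen Ω) (hL : HasLipschitzBoundary Ω) (hb : Bornology.IsBounded Ω)
  (hf : ContDiffOn ℝ ∞ f Ωᶜ)
  (hconst : ∀ p ∈ frontier Ω, ∀ q ∈ connectedComponentIn (frontier Ω) p, f q = f p)
include hΩ hL hb hf hconst

/-- Split Y = χY + (1 - χ)Y with χ a bump equal to 1 near the closure of Ω. The first part has
compact support and yields the boundary term; the second extends by zero into Ω and agrees with Y on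
large spheres, so the ball formula applies. The two divergences add up to that of Y. -/
theorem integrableOn_boundaryDensity_and_eventually_massFlux_eq :
    IntegrableOn (boundaryDensity Ω f) (frontier Ω) μHE[n - 1] ∧
    ∀ᶠ r : ℝ in atTop, massFlux Ωᶜ (graphMetric Ωᶜ f) r =
      (∫ x in Ωᶜ ∩ Metric.closedBall 0 r, (1 / 2) * (gaussBonnet Ωᶜ (graphMetric Ωᶜ f) x
        + gaussBonnetPerp Ωᶜ f x)) + 3 * ∫ x in frontier Ω, boundaryDensity Ω f x ∂μHE[n - 1] := by
  have hus := hL.uniqueDiffOn_compl hΩ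
  have hsc : IsClosed Ωᶜ := hΩ.isClosed_compl
  have hcl := hL.subset_closure_interior hΩ
  have hfs := frontier_subset_compl hΩ
  have hY := smoothV_newtonField hus hf
  obtain ⟨R, hR0, hR⟩ : ∃ R : ℝ, 0 < R ∧ closure Ω ⊆ Metric.ball 0 R := by
    obtain ⟨R, hR⟩ := hb.closure.subset_ball (0 : E n)
    exact ⟨max R 1, by positivity, hR.trans (Metric.ball_subset_ball (le_max_left _ _))⟩
  let χ : ContDiffBump (0 : E n) := ⟨R, R + 1, hR0, by linarith⟩
  have hχ : ContDiff ℝ ∞ χ := χ.contDiff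
  have hχ1 : ∀ x ∈ Metric.ball (0 : E n) R, χ x = 1 := fun x hx =>
    χ.one_of_mem_closedBall (Metric.ball_subset_closedBall hx)
  have hχ0 : ∀ x : E n, R + 1 ≤ ‖x‖ → χ x = 0 := fun x hx =>
    χ.zero_of_le_dist (by rw [dist_zero_right]; exact hx)
  have hχK : ∀ x ∉ Metric.closedBall (0 : E n) (R + 1), χ x = 0 := fun x hx =>
    hχ0 x (by rw [mem_closedBall_zero_iff, not_le] at hx; exact hx.le)
  have hflux := boundary_flux hΩ hL hf hconst (isCompact_closedBall (0 : E n) (R + 1)) hχ hχK hb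
    (fun x => by rw [abs_of_nonneg χ.nonneg]; exact χ.le_one)
    fun x hx => hχ1 x (hR (frontier_subset_closure hx))
  refine ⟨hflux.1, ?_⟩
  filter_upwards [eventually_ge_atTop (R + 1)] with r hr
  have hsub : Metric.closedBall (0 : E n) (R + 1) ⊆ Metric.closedBall 0 r :=
    Metric.closedBall_subset_closedBall hr
  let h : Fin n → E n → ℝ := fun i x => (1 - χ x) * newtonField Ωᶜ f x i
  have hzero (i : Fin n) {x : E n} (hx : x ∈ Metric.ball (0 : E n) R) : h i =ᶠ[𝓝 x] fun _ => 0 := by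
    filter_upwards [Metric.isOpen_ball.mem_nhds hx] with y hy
    simp only [h, hχ1 y hy, sub_self, zero_mul]
  have hh (i : Fin n) : ContDiff ℝ 1 (h i) := by
    rw [contDiff_iff_contDiffAt]
    intro x
    by_cases hx : x ∈ Metric.ball (0 : E n) R
    · exact contDiffAt_const.congr_of_eventuallyEq (hzero i hx)
    · have hxs : Ωᶜ ∈ 𝓝 x := mem_of_superset
        (isClosed_closure.isOpen_compl.mem_nhds fun h => hx (hR h))
        (compl_subset_compl.2 subset_closure)
      exact (((contDiffAt_const (n := ∞)).sub hχ.contDiffAt).mul ((hY i).contDiffAt hxs)).of_le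
        (by simp)
  have hsph : Metric.sphere (0 : E n) r ⊆ Ωᶜ := fun x hx hxΩ => by
    have h1 := hR (subset_closure hxΩ)
    rw [mem_sphere_zero_iff_norm] at hx
    rw [mem_ball_zero_iff] at h1
    linarith
  rw [massFlux_eq_sum hus hcl hf (by linarith) hsph hh fun i x hx => by
    simp only [h, hχ0 x (by rw [mem_sphere_zero_iff_norm] at hx; linarith), sub_zero, one_mul]]
  have hBm : MeasurableSet (Ωᶜ ∩ Metric.closedBall (0 : E n) r) :=
    hsc.measurableSet.inter measurableSet_closedBall
  have hBK : IsCompact (Ωᶜ ∩ Metric.closedBall (0 : E n) r) := (isCompact_closedBall _ _).inter_left hsc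
  have hχY (i : Fin n) : ContDiffOn ℝ ∞ (fun y => χ y * newtonField Ωᶜ f y i) Ωᶜ :=
    hχ.contDiffOn.mul (hY i)
  have hhs (i : Fin n) : ContDiffOn ℝ ∞ (h i) Ωᶜ := (contDiffOn_const.sub hχ.contDiffOn).mul (hY i)
  have hint {g : E n → ℝ} (hg : ContDiffOn ℝ ∞ g Ωᶜ) (i : Fin n) :
      IntegrableOn (pd Ωᶜ i g) (Ωᶜ ∩ Metric.closedBall 0 r) :=
    ((contDiffOn_pd hus hg i).continuousOn.mono inter_subset_left).integrableOn_compact hBK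
  have h1 (i : Fin n) : ∫ x in Metric.closedBall (0 : E n) r,
      fderiv ℝ (h i) x (EuclideanSpace.single i 1) =
      ∫ x in Ωᶜ ∩ Metric.closedBall 0 r, pd Ωᶜ i (h i) x := by
    rw [setIntegral_eq_of_subset_of_forall_sdiff_eq_zero measurableSet_closedBall
      (inter_subset_right (s := Ωᶜ)) fun x hx => ?_]
    · refine setIntegral_congr_fun hBm fun x hx => ?_
      rw [pd, ((hh i).differentiable one_ne_zero x).fderivWithin (hus x hx.1)]
    · have hxΩ : x ∈ Ω := not_not.1 fun hn => hx.2 ⟨hn, hx.1⟩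
      rw [(hzero i (hR (subset_closure hxΩ))).fderiv_eq, fderiv_fun_const]
      rfl
  have h2 (i : Fin n) : ∫ x in Ωᶜ, pd Ωᶜ i (fun y => χ y * newtonField Ωᶜ f y i) x =
      ∫ x in Ωᶜ ∩ Metric.closedBall 0 r, pd Ωᶜ i (fun y => χ y * newtonField Ωᶜ f y i) x := by
    refine setIntegral_eq_of_subset_of_forall_sdiff_eq_zero hsc.measurableSet inter_subset_left
      fun x hx => ?_
    exact pd_eq_zero_of_notMem Metric.isClosed_closedBall
      (fun y _ hyK => by rw [hχK y hyK, zero_mul]) hx.1 (fun hxK => hx.2 ⟨hx.1, hsub hxK⟩) i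
  have h3 : ∫ x in Ωᶜ ∩ Metric.closedBall 0 r, (1 / 2) * (gaussBonnet Ωᶜ (graphMetric Ωᶜ f) x
        + gaussBonnetPerp Ωᶜ f x) =
      ∑ i, ((∫ x in Ωᶜ ∩ Metric.closedBall 0 r, pd Ωᶜ i (fun y => χ y * newtonField Ωᶜ f y i) x)
        + ∫ x in Ωᶜ ∩ Metric.closedBall 0 r, pd Ωᶜ i (h i) x) := by
    simp only [← integral_add (hint (hχY _) _) (hint (hhs _) _)]
    rw [← integral_finsetSum Finset.univ (f := fun i x => pd Ωᶜ i
      (fun y => χ y * newtonField Ωᶜ f y i) x + pd Ωᶜ i (h i) x)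
      fun i _ => (hint (hχY i) i).add (hint (hhs i) i)]
    refine setIntegral_congr_fun hBm fun x hx => ?_
    rw [← sum_pd_newtonField hus hcl hf hx.1]
    refine Finset.sum_congr rfl fun i _ => ?_
    rw [← pd_add (hus x hx.1) ((hχY i).diffWithin hx.1) ((hhs i).diffWithin hx.1)]
    congr 1
    funext y
    simp only [h]
    ring
  have h4 := hflux.2
  simp only [h2] at h4
  rw [h3, Finset.sum_add_distrib, h4]
  simp only [h1]
  ring

end MassFlux

end GBC

/-! ### Passage to the limit r → ∞ -/

theorem mainTheorem3 (n m : ℕ) (hn : 5 ≤ n)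
    (Ω : Set (GBC.E n)) (hΩo : IsOpen Ω) (hΩb : Bornology.IsBounded Ω)
    (hΩL : GBC.HasLipschitzBoundary Ω)
    (f : GBC.E n → GBC.E m) (hf : GBC.AsymptoticallyFlatMap Ωᶜ f)
    (hconst : ∀ p ∈ frontier Ω, ∀ q ∈ connectedComponentIn (frontier Ω) p, f q = f p)
    (hL2 : Integrable (GBC.gaussBonnet Ωᶜ (GBC.graphMetric Ωᶜ f))
      (GBC.riemVolume Ωᶜ (GBC.graphMetric Ωᶜ f))) :
    (∀ p ∈ frontier Ω, GBC.normSqDf Ωᶜ f p ≠ 0 → ∃ ρ, GBC.IsDefiningFunctionAt Ω ρ p) ∧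
    Integrable
      (fun x => (GBC.gaussBonnet Ωᶜ (GBC.graphMetric Ωᶜ f) x + GBC.gaussBonnetPerp Ωᶜ f x)
        * (1 / Real.sqrt (GBC.graphMetric Ωᶜ f x).det))
      (GBC.riemVolume Ωᶜ (GBC.graphMetric Ωᶜ f)) ∧
    IntegrableOn
      (fun x => (GBC.normSqDf Ωᶜ f x / (1 + GBC.normSqDf Ωᶜ f x)) ^ 2
        * GBC.thirdMeanCurvature Ω x)
      (frontier Ω) μHE[n - 1] ∧
    GBC.IsGBCMass Ωᶜ (GBC.graphMetric Ωᶜ f)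
      ((1 / 2) * GBC.c2 n *
          (∫ x, (GBC.gaussBonnet Ωᶜ (GBC.graphMetric Ωᶜ f) x + GBC.gaussBonnetPerp Ωᶜ f x)
            * (1 / Real.sqrt (GBC.graphMetric Ωᶜ f x).det)
            ∂(GBC.riemVolume Ωᶜ (GBC.graphMetric Ωᶜ f)))
        + 3 * GBC.c2 n *
          (∫ x in frontier Ω, (GBC.normSqDf Ωᶜ f x / (1 + GBC.normSqDf Ωᶜ f x)) ^ 2
            * GBC.thirdMeanCurvature Ω x ∂μHE[n - 1])) := by
  have hus := hΩL.uniqueDiffOn_compl hΩo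
  have hcl := hΩL.subset_closure_interior hΩo
  have hsc : IsClosed Ωᶜ := hΩo.isClosed_compl
  have hc1 := GBC.continuousOn_gaussBonnet hus hcl hf.1
  have hc2 := GBC.continuousOn_gaussBonnetPerp hus hcl hf.1
  obtain ⟨r, hr, hO⟩ := hf.isBigO_gaussBonnetPerp hus hcl
  -- L₂ passes from the Riemannian volume to Lebesgue measure because √G ≥ 1; L₂^⊥ is integrable by
  -- its decay.
  have hi : IntegrableOn (fun x => GBC.gaussBonnet Ωᶜ (GBC.graphMetric Ωᶜ f) x
      + GBC.gaussBonnetPerp Ωᶜ f x) Ωᶜ :=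
    (GBC.integrableOn_of_integrable_riemVolume hus hcl hsc hf.1 hc1 hL2).add
      (GBC.integrableOn_of_isBigO_rpow hsc hc2 hr hO)
  obtain ⟨hi1, hi2⟩ := GBC.riemVolume_div_sqrt_det hus hsc hf.1 hi
  obtain ⟨hB, hflux⟩ :=
    GBC.integrableOn_boundaryDensity_and_eventually_massFlux_eq hΩo hΩL hΩb hf.1 hconst
  refine ⟨fun p hp hne => GBC.exists_isDefiningFunctionAt hΩo hΩL hf.1 hp (hconst p hp) hne, hi1, hB,
    hL2, ?_⟩
  rw [hi2]
  -- Balls exhaust space, so integrability of the divergence makes the ball integrals converge;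
  -- together with the r-independent boundary term this proves that the mass limit exists.
  have hlim := (aecover_closedBall (μ := volume.restrict Ωᶜ) (x := (0 : GBC.E n))
    (tendsto_id (α := ℝ) (x := atTop))).integral_tendsto_of_countably_generated
    (hi.const_mul (1 / 2))
  rw [integral_const_mul] at hlim
  have h := ((hlim.add_const (3 * ∫ x in frontier Ω, GBC.boundaryDensity Ω f x ∂μHE[n - 1])).const_mul
    (GBC.c2 n))
  refine (h.congr' ?_).trans (le_of_eq ?_)
  · filter_upwards [hflux] with r hr
    rw [hr, Measure.restrict_restrict measurableSet_closedBall, inter_comm]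
    rfl
  · congr 1
    simp only [GBC.boundaryDensity]
    ring
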